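/- **Setting.** Let $d,n,l\ge 1$ be integers, let $U=B(x_0,r)\subset\mathbb R^d$ be an open Euclidean ball of radius $r>0$, and for $\lambda>0$ write $\lambda U=B(x_0,\lambda r)$. Put $$\tilde U=3^{n+1}U,\qquad \tilde U^+=3^{n+d+2}U .$$ Let $f=(f_1,\dots,f_n)$ be an $n$-tuple of $C^{l+1}$ functions on the closure of $\tilde U^+$ which is $l$-non-degenerate at every point $x$ of this closure, i.e. the partial derivatives of $f$ at $x$ of orders $1,\dots,l$ span $\mathbb R^n$ (Assumption 1). Let $s_0$ be the supremum of all $s\in\mathbb R$ such that for every $x\in\tilde U^+$ and every unit vector $v\in\mathbb R^n$ there are an integer $0<k\le l$ and a unit vector $u\in\mathbb R^d$ with $\left|\frac{\partial^k(f\cdot v)}{\partial u^k}(x)\right|\ge s$. Let $M\ge1$ be a constant such that $$\sup_{x\in\tilde U^+}\left\|\frac{\partial^k f}{\partial u_1\cdots\partial u_k}(x)\right\|_2\le M\qquad\text{for all }1\le k\le l+1\text{ and all unit vectors }u_1,\dots,u_k\in\mathbb R^d .$$ Let $$V_d=\frac{\pi^{d/2}}{\Gamma(1+d/2)},\qquad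 C_{d,l}=\frac{2^{d+1}dl(l+1)^{1/l}}{V_d},\qquad \phi(\omega,B,k)=\frac{\omega^{k(k-1)/2}}{2\sqrt2\,B^k(k+1)!},$$ $$\sigma(l,d)=2^{-3l(d-1)/2}\,\phi\!\left(\left(\sqrt2\,(2l)^{2+l(l-1)/2}(l+1)!\right)^{-1},2,l\right)^{d-1},$$ $$\eta=\min\left\{\frac1{16},\left(\frac{V_d}{2^{d+2}dl(l+1)^{1/l}5^d}\right)^{d(2l-1)(2l-2)}\right\},$$ and assume that $$r\le\min\left\{\frac{s_0\,\sigma(l,d)}{2\cdot3^{n+d+2}\sqrt d\,M},\ \frac{\eta\, s_0}{4\cdot10^7\,3^{n+d+2}\,d\,M\,l^{l+2}(l+1)!}\right\}.$$ Put $$\tau=\frac{r^ls_0}{4l^l(l+1)!},\qquad \rho_2=\frac{s_0}{4l^l(l+1)!}\left(\frac\tau M\right)^{l-1}\frac{\left(\tau(1-1/\sqrt2)\right)^2}{\sqrt{\left(\frac{s_0}{4l^l(l+1)!}\left(\frac\tau M\right)^l\right)^2+\left(\tau(1+1/\sqrt2)\right)^2}} .$$ For a differentiable map $g=(g_1,g_2)$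 into $\mathbb R^2$, the skew gradient is $\tilde\nabla g=g_1\nabla g_2-g_2\nabla g_1$. A function $h:V\to\mathbb R$ on $V\subset\mathbb R^d$ is $(C,\alpha)$-good on $V$ if for every open ball $B\subset V$ and every $\varepsilon>0$ the set $\{x\in B:|h(x)|<\varepsilon\sup_B|h|\}$ has Lebesgue measure at most $C\varepsilon^\alpha|B|$. **Proposition.** (a) For all $u_0\in\mathbb R$ and all $u_1,u_2\in\mathbb R^n$ with $u_1\perp u_2$, the map $g=(u_1\cdot f,\ u_2\cdot f+u_0)$ has the property that $\|\tilde\nabla g\|_2$ is $\left(2C_{d,l},\frac1{d(2l-1)}\right)$-good on $\tilde U$. (b) For all $u_0\in\mathbb R$ and all unit vectors $u_1,u_2\in\mathbb R^n$ with $u_1\perp u_2$, the map $g=(u_1\cdot f,\ u_2\cdot f+u_0)$ satisfies $$\sup_{x\in U}\|\tilde\nabla g(x)\|_2\ge\rho_2 .$$ -/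

import Mathlib

open MeasureTheory Metric

namespace SkewGood

/-- `ℝᵈ` with its Euclidean norm. -/
abbrev E (d : ℕ) : Type := EuclideanSpace ℝ (Fin d)

/-- `f` is `l`-non-degenerate at `x`, relative to a set `D` (meant to be a closed ball, on which
`f` is of class `C^l`): the partial derivatives of `f` at `x` of orders `1, …, l` span `ℝⁿ`.
At boundary points of `D` the derivatives are taken within `D`. -/
def NondegenerateAt {d n : ℕ} (l : ℕ) (f : E d → E n) (D : Set (E d)) (x : E d) : Prop :=
  Submodule.span ℝ {w : E n | ∃ k : ℕ, 1 ≤ k ∧ k ≤ l ∧ ∃ j : Fin k → Fin d,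
    w = iteratedFDerivWithin ℝ k f D x (fun i => EuclideanSpace.single (j i) (1 : ℝ))} = ⊤

/-- The measure of `l`-non-degeneracy `s(l; f, V)` of a map on an open set `V`: the supremum of
the `s` such that for all `x ∈ V` and all unit vectors `v` there are `0 < k ≤ l` and a unit vector
`u` with `|∂ᵏ(f · v)/∂uᵏ (x)| ≥ s`. -/
noncomputable def nondegMeasure {d n : ℕ} (l : ℕ) (f : E d → E n) (V : Set (E d)) : ℝ :=
  sSup {s : ℝ | ∀ x ∈ V, ∀ v : E n, ‖v‖ = 1 → ∃ k : ℕ, 0 < k ∧ k ≤ l ∧ ∃ u : E d, ‖u‖ = 1 ∧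
    s ≤ |iteratedFDeriv ℝ k (fun y => inner ℝ (f y) v) x (fun _ => u)|}

/-- `h` is `(C, α)`-good on `V`: for every open ball `B ⊆ V` and every `ε > 0`,
`|{x ∈ B : |h x| < ε sup_B |h|}| ≤ C ε^α |B|`. The supremum is taken in `[0, ∞]`. -/
def IsGood {d : ℕ} (C α : ℝ) (V : Set (E d)) (h : E d → ℝ) : Prop :=
  ∀ (c : E d) (t : ℝ), ball c t ⊆ V → ∀ ε : ℝ, 0 < ε →
    volume {x ∈ ball c t | ‖h x‖ₑ < ENNReal.ofReal ε * ⨆ y ∈ ball c t, ‖h y‖ₑ}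
      ≤ ENNReal.ofReal (C * ε ^ α) * volume (ball c t)

/-- The skew gradient `g₁ ∇g₂ - g₂ ∇g₁` of a map `g = (g₁, g₂)`. -/
noncomputable def skewGradient {d : ℕ} (g : E d → ℝ × ℝ) (x : E d) : E d :=
  (g x).1 • gradient (fun y => (g y).2) x - (g x).2 • gradient (fun y => (g y).1) x

/-- The map `(u₁ · f, u₂ · f + u₀)`. -/
noncomputable def pairMap {d n : ℕ} (f : E d → E n) (u₁ u₂ : E n) (u₀ : ℝ) (x : E d) : ℝ × ℝ :=
  (inner ℝ u₁ (f x), inner ℝ u₂ (f x) + u₀)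

/-- The volume `V_d` of the `d`-dimensional Euclidean unit ball. -/
noncomputable def ballVol (d : ℕ) : ℝ :=
  Real.pi ^ ((d : ℝ) / 2) / Real.Gamma (1 + (d : ℝ) / 2)

/-- `C_{d,l} = 2^{d+1} d l (l+1)^{1/l} / V_d`. -/
noncomputable def goodConst (d l : ℕ) : ℝ :=
  2 ^ (d + 1) * d * l * ((l : ℝ) + 1) ^ (1 / (l : ℝ)) / ballVol d

/-- `φ(ω, B, k) = ω^{k(k-1)/2} / (2 √2 B^k (k+1)!)`. -/
noncomputable def phi (ω B : ℝ) (k : ℕ) : ℝ :=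
  ω ^ (k * (k - 1) / 2) / (2 * √2 * B ^ k * ((k + 1).factorial : ℝ))

/-- `σ(l, d) = 2^{-3l(d-1)/2} φ((√2 (2l)^{2+l(l-1)/2} (l+1)!)⁻¹, 2, l)^{d-1}`. -/
noncomputable def sigma (l d : ℕ) : ℝ :=
  1 / (2 : ℝ) ^ (3 * (l : ℝ) * ((d : ℝ) - 1) / 2) *
    phi (√2 * (2 * (l : ℝ)) ^ (2 + l * (l - 1) / 2) * ((l + 1).factorial : ℝ))⁻¹ 2 l ^ (d - 1)

/-- `η = min {1/16, (V_d / (2^{d+2} d l (l+1)^{1/l} 5^d))^{d(2l-1)(2l-2)}}`. -/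
noncomputable def eta (d l : ℕ) : ℝ :=
  min (1 / 16)
    ((ballVol d / (2 ^ (d + 2) * d * l * ((l : ℝ) + 1) ^ (1 / (l : ℝ)) * 5 ^ d)) ^
      (d * (2 * l - 1) * (2 * l - 2)))

/-- The upper bound imposed on the radius of the ball `U`, in terms of the measure of
non-degeneracy `s₀` and the bound `M` for the derivatives. -/
noncomputable def radiusBound (d n l : ℕ) (s₀ M : ℝ) : ℝ :=
  min (s₀ * sigma l d / (2 * 3 ^ (n + d + 2) * √(d : ℝ) * M))
    (eta d l * s₀ /
      (4 * 10 ^ 7 * 3 ^ (n + d + 2) * d * M * (l : ℝ) ^ (l + 2) * ((l + 1).factorial : ℝ)))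

/-- `τ = r^l s₀ / (4 l^l (l+1)!)`. -/
noncomputable def tau (l : ℕ) (s₀ r : ℝ) : ℝ :=
  r ^ l * s₀ / (4 * (l : ℝ) ^ l * ((l + 1).factorial : ℝ))

/-- The lower bound `ρ₂` for the supremum of the skew gradient. -/
noncomputable def rhoTwo (l : ℕ) (s₀ M r : ℝ) : ℝ :=
  s₀ / (4 * (l : ℝ) ^ l * ((l + 1).factorial : ℝ)) * (tau l s₀ r / M) ^ (l - 1) *
    ((tau l s₀ r * (1 - 1 / √2)) ^ 2 /
      √((s₀ / (4 * (l : ℝ) ^ l * ((l + 1).factorial : ℝ)) * (tau l s₀ r / M) ^ l) ^ 2 +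
        (tau l s₀ r * (1 + 1 / √2)) ^ 2))

end SkewGood

/-! ### Polynomials on an interval: interpolation, Remez and Markov type bounds, finite differences,
Taylor polynomials -/

namespace SkewGood

/-! For (a), let B be a ball inside `3^{n+1} U` and K = B ∩ ball(x, s) with x in B. Non-degeneracy
and finite differences show that a function w·f + c bounded by 1 on a ball of radius ρ has ‖w‖ at
most about (l/ρ)^l / s₀ (`DerivBound.le_of_abs_le`). Its Taylor remainder along segments, of size
‖w‖ M ρ^(l+1), is then of order Mρ/s₀, which the bound on r makes small. So at every scale such
functions are uniformly close, on segments, to polynomials of degree l.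

To put g in this position, choose x₁, x₂ in the closure of K maximising |g₁(x₁)g₂(x₂) -
g₂(x₁)g₁(x₂)|. The combinations a, b of g₁, g₂ dual to these two points are bounded by 1, and the
change of basis only multiplies the skew gradient by a constant
(`DerivBound.exists_normalizedPair`). The skew gradient of (a, b) is close on segments to
polynomials of degree k = 2l - 1, or 2l - 2 when d = 1. The error is also small relative to its
maximum: divided by a², the skew gradient is the gradient of b/a, so if it were tiny then b would be
tiny near x₁, and extrapolating a polynomial would contradict b(x₂) = 1
(`NormalizedPair.le_of_norm_skewForm_le`). A Remez inequality on the rays issuing from a maximum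
point, integrated in polar coordinates, bounds the proportion of K where the norm is below ε times
its maximum by d k (2.06 ε)^(1/k), provided ε is at least a threshold ε₀ dictated by the Taylor
error (`NormalizedPair.volume_le`).

Below ε₀ a Vitali covering is iterated (`volume_lt_le_of_scale`): the one-scale estimate holds on
all K with the same constants, and each further factor ε₀ in ε costs τ^d C ε₀^(1/k) in measure.
Lowering the exponent to 1/(d(2l-1)) absorbs the overlap constant τ^d C once ε₀ is small, and η is
calibrated so that one ε₀ meets both requirements. When l = 1 the power in η is trivial and a
separate ε₀ serves; when d = l = 1 the degree k is 0 and the norm is nearly constant.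

For (b), non-degeneracy gives a point of U where |g₁| exceeds τ. After rotating (u₁, u₂) so that g
there lies on the first axis, a skew gradient bounded by H makes the angle of g vary slowly, so on a
ball of radius τ/(√2 M) the second coordinate stays small. Non-degeneracy bounds this coordinate
from below, and comparing the two gives H ≥ ρ₂ (`SmallBall.rhoTwo_le`). -/

open Polynomial in
theorem prod_abs_sub_erase (k i : ℕ) (hi : i ≤ k) :
    ∏ j ∈ (Finset.range (k + 1)).erase i, |(i : ℝ) - j| = (i.factorial : ℝ) * (k - i).factorial := by
  induction k, hi using Nat.le_induction with
  | base =>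
    have h1 : (Finset.range (i + 1)).erase i = Finset.range i := by
      ext j; simp only [Finset.mem_erase, Finset.mem_range]; omega
    rw [h1, Nat.sub_self, Nat.factorial_zero, Nat.cast_one, mul_one,
      ← Finset.prod_range_add_one_eq_factorial, ← Finset.prod_range_reflect]
    push_cast
    refine Finset.prod_congr rfl fun j hj => ?_
    have hj' := Finset.mem_range.1 hj
    have : ((i - 1 - j : ℕ) : ℝ) = (i : ℝ) - 1 - j := by
      rw [Nat.cast_sub (by omega), Nat.cast_sub (by omega)]; simp
    rw [this, abs_of_nonneg]
    · ring
    · have : (j : ℝ) + 1 ≤ i := by exact_mod_cast hj'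
      linarith
  | succ k hk ih =>
    have h1 : (Finset.range (k + 1 + 1)).erase i
        = insert (k + 1) ((Finset.range (k + 1)).erase i) := by
      ext j; simp only [Finset.mem_erase, Finset.mem_range, Finset.mem_insert]; omega
    rw [h1, Finset.prod_insert (by simp), ih, Nat.succ_sub hk, Nat.factorial_succ]
    have hk' : (i : ℝ) ≤ k := by exact_mod_cast hk
    rw [abs_sub_comm, abs_of_nonneg (by push_cast; linarith)]
    push_cast [Nat.cast_sub hk]
    ring

/-- Lagrange interpolation at separated nodes. -/
theorem abs_eval_le_of_separated {k : ℕ} {q : Polynomial ℝ} (hq : q.natDegree ≤ k) {x : ℕ → ℝ}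
    {h A L y : ℝ} (hh : 0 < h) (hA : 0 ≤ A) (hL : 0 ≤ L) (hx : ∀ i < k, x i + h ≤ x (i + 1))
    (hqx : ∀ i ≤ k, |q.eval (x i)| ≤ A) (hy : ∀ i ≤ k, |y - x i| ≤ L) :
    |q.eval y| ≤ A * ((2 * L / h) ^ k / (k.factorial : ℝ)) := by
  have hsep : ∀ i j, i ≤ j → j ≤ k → x i + ((j : ℝ) - i) * h ≤ x j := by
    intro i j hij
    induction j, hij using Nat.le_induction with
    | base => intro _; simp
    | succ j hj ih =>
      intro hjk
      have h1 := ih (by omega)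
      have h2 := hx j (by omega)
      push_cast
      linarith
  have habs : ∀ i ≤ k, ∀ j ≤ k, |(i : ℝ) - j| * h ≤ |x i - x j| := by
    intro i hi j hj
    rcases le_total i j with hij | hij
    · have := hsep i j hij hj
      rw [abs_sub_comm, abs_sub_comm (x i)]
      have hc : (i : ℝ) ≤ j := by exact_mod_cast hij
      rw [abs_of_nonneg (sub_nonneg.2 hc)]
      exact le_trans (by linarith) (le_abs_self _)
    · have := hsep j i hij hi
      have hc : (j : ℝ) ≤ i := by exact_mod_cast hij
      rw [abs_of_nonneg (sub_nonneg.2 hc)]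
      exact le_trans (by linarith) (le_abs_self _)
  have hinj : Set.InjOn x (Finset.range (k + 1) : Set ℕ) := by
    intro i hi j hj hij
    by_contra hne
    have h1 := habs i (by simpa [Nat.lt_succ_iff] using hi) j (by simpa [Nat.lt_succ_iff] using hj)
    rw [hij, sub_self, abs_zero] at h1
    have h2 : 0 < |(i : ℝ) - j| := abs_pos.2 (sub_ne_zero.2 (by exact_mod_cast hne))
    nlinarith [mul_pos h2 hh]
  have hdeg : q.degree < (Finset.range (k + 1)).card := by
    rw [Finset.card_range]
    exact lt_of_le_of_lt Polynomial.degree_le_natDegree (by exact_mod_cast Nat.lt_succ_of_le hq)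
  rw [Lagrange.eq_interpolate hinj hdeg, Lagrange.interpolate_apply, Polynomial.eval_finsetSum]
  refine (Finset.abs_sum_le_sum_abs _ _).trans ?_
  have hterm : ∀ i ∈ Finset.range (k + 1),
      |Polynomial.eval y (Polynomial.C (q.eval (x i)) * Lagrange.basis (Finset.range (k + 1)) x i)|
        ≤ A * (L / h) ^ k * ((k.choose i : ℝ) / k.factorial) := by
    intro i hi
    have hik : i ≤ k := by simpa [Nat.lt_succ_iff] using hi
    rw [Polynomial.eval_mul, Polynomial.eval_C, abs_mul, mul_assoc]
    refine mul_le_mul (hqx i hik) ?_ (abs_nonneg _) hA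
    rw [Lagrange.basis, Polynomial.eval_prod, Finset.abs_prod]
    have hprod : ∏ j ∈ (Finset.range (k + 1)).erase i, (L / h) / |(i : ℝ) - j|
        = (L / h) ^ k * ((k.choose i : ℝ) / k.factorial) := by
      rw [Finset.prod_div_distrib, prod_abs_sub_erase k i hik, Finset.prod_const,
        Finset.card_erase_of_mem hi, Finset.card_range, Nat.add_sub_cancel,
        Nat.cast_choose ℝ hik]
      have := (Nat.cast_ne_zero (R := ℝ)).2 (Nat.factorial_ne_zero k)
      field_simp
    rw [← hprod]
    refine Finset.prod_le_prod (fun _ _ => abs_nonneg _) fun j hj => ?_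
    obtain ⟨hji, hj⟩ := Finset.mem_erase.1 hj
    have hjk : j ≤ k := by simpa [Nat.lt_succ_iff] using hj
    have h2 : 0 < |(i : ℝ) - j| := abs_pos.2 (sub_ne_zero.2 (by exact_mod_cast Ne.symm hji))
    have h3 := habs i hik j hjk
    have h4 : 0 < |x i - x j| := lt_of_lt_of_le (mul_pos h2 hh) h3
    rw [Lagrange.basisDivisor, Polynomial.eval_mul, Polynomial.eval_C, Polynomial.eval_sub,
      Polynomial.eval_X, Polynomial.eval_C, abs_mul, abs_inv, div_div, inv_mul_eq_div,
      div_le_div_iff₀ h4 (mul_pos hh h2)]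
    have := hy j hjk
    calc |y - x j| * (h * |(i : ℝ) - j|) ≤ L * (h * |(i : ℝ) - j|) := by gcongr
      _ = L * (|(i : ℝ) - j| * h) := by ring
      _ ≤ L * |x i - x j| := by gcongr
  refine (Finset.sum_le_sum hterm).trans (le_of_eq ?_)
  rw [← Finset.mul_sum, ← Finset.sum_div]
  have : ∑ i ∈ Finset.range (k + 1), (k.choose i : ℝ) = 2 ^ k := by
    exact_mod_cast Nat.sum_range_choose k
  rw [this, mul_div_assoc 2, mul_pow]
  ring

/-- Greedy choice from the left: take a point a almost at the infimum and discard everything up to a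
+ h. This costs barely more than h in measure, so the strict inequality survives k steps. -/
theorem exists_separated_of_lt_volume {E : Set ℝ} {h : ℝ} (hh : 0 ≤ h) (hE : BddBelow E) (k : ℕ)
    (hk : ENNReal.ofReal (k * h) < volume E) :
    ∃ x : ℕ → ℝ, (∀ i ≤ k, x i ∈ E) ∧ ∀ i < k, x i + h ≤ x (i + 1) := by
  induction k generalizing E with
  | zero =>
    have : E.Nonempty := by
      by_contra hne
      rw [Set.not_nonempty_iff_eq_empty.1 hne] at hk
      simp at hk
    obtain ⟨a, ha⟩ := this
    exact ⟨fun _ => a, fun _ _ => ha, fun i hi => absurd hi (Nat.not_lt_zero i)⟩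
  | succ k ih =>
    have hne : E.Nonempty := by
      by_contra hne
      rw [Set.not_nonempty_iff_eq_empty.1 hne] at hk
      simp at hk
    -- The infimum need not belong to `E`; the slack δ pays for choosing a point slightly above it.
    obtain ⟨δ, hδ, hδv⟩ : ∃ δ > 0, ENNReal.ofReal (k * h + h + δ) < volume E := by
      obtain ⟨c, hc1, hc2⟩ := ENNReal.lt_iff_exists_nnreal_btwn.1 hk
      refine ⟨(c : ℝ) - (k * h + h), ?_, ?_⟩
      · have := (ENNReal.ofReal_lt_coe_iff (by positivity)).1 hc1
        push_cast at this
        linarith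
      · simpa using hc2
    obtain ⟨a, haE, ha⟩ := exists_lt_of_csInf_lt hne (lt_add_of_pos_right (sInf E) hδ)
    set E' := E ∩ Set.Ici (a + h) with hE'
    have hcov : E ⊆ Set.Icc (sInf E) (a + h) ∪ E' := by
      intro z hz
      rcases le_total z (a + h) with hza | hza
      · exact Or.inl ⟨csInf_le hE hz, hza⟩
      · exact Or.inr ⟨hz, hza⟩
    have hv : volume E ≤ ENNReal.ofReal (h + δ) + volume E' := by
      refine (measure_mono hcov).trans ((measure_union_le _ _).trans ?_)
      gcongr
      rw [Real.volume_Icc]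
      exact ENNReal.ofReal_le_ofReal (by linarith)
    have hk' : ENNReal.ofReal (k * h) < volume E' := by
      by_contra hcon
      have : volume E ≤ ENNReal.ofReal (k * h + h + δ) := by
        have he : (k : ℝ) * h + h + δ = (h + δ) + k * h := by ring
        rw [he, ENNReal.ofReal_add (by positivity) (by positivity)]
        exact hv.trans (add_le_add_right (not_lt.1 hcon) _)
      exact absurd hδv (not_lt.2 this)
    obtain ⟨x, hx, hxs⟩ := ih (hE.mono Set.inter_subset_left) hk'
    refine ⟨fun i => if i = 0 then a else x (i - 1), ?_, ?_⟩
    · intro i hi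
      by_cases h0 : i = 0
      · simp [h0, haE]
      · simp only [h0, if_false]
        exact (hx _ (by omega)).1
    · intro i hi
      by_cases h0 : i = 0
      · simp only [h0, if_true]
        simpa using (hx 0 (by omega)).2
      · have := hxs (i - 1) (by omega)
        simp only [h0, if_false, Nat.add_sub_cancel, Nat.add_eq_zero_iff, one_ne_zero, and_false]
        rwa [Nat.sub_add_cancel (by omega)] at this

/-- A Remez type inequality: a polynomial of degree at most `k` that is small relative to its
value at an end point. -/
theorem volume_le_of_abs_eval_le {k : ℕ} (hk : 1 ≤ k) {q : Polynomial ℝ} (hq : q.natDegree ≤ k)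
    {E : Set ℝ} {L δ : ℝ} (hL : 0 ≤ L) (hE : E ⊆ Set.Icc 0 L) (hδ : 0 < δ) (hq0 : q.eval 0 ≠ 0)
    (hqE : ∀ x ∈ E, |q.eval x| ≤ δ * |q.eval 0|) :
    volume E ≤ ENNReal.ofReal (k * ((2 * δ) ^ (1 / (k : ℝ)) * L)) := by
  by_contra hcon
  rw [not_le] at hcon
  obtain ⟨c, hc1, hc2⟩ := ENNReal.lt_iff_exists_nnreal_btwn.1 hcon
  have hkR : (0 : ℝ) < k := by exact_mod_cast hk
  have hr : 0 < (2 * δ) ^ (1 / (k : ℝ)) := Real.rpow_pos_of_pos (by positivity) _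
  have hc1' : k * ((2 * δ) ^ (1 / (k : ℝ)) * L) < c :=
    (ENNReal.ofReal_lt_coe_iff (by positivity)).1 hc1
  set h : ℝ := (c : ℝ) / k with hh
  have hhL : (2 * δ) ^ (1 / (k : ℝ)) * L < h := by
    rw [hh, lt_div_iff₀ hkR]; linarith
  have hh0 : 0 < h := lt_of_le_of_lt (by positivity) hhL
  obtain ⟨x, hx, hxs⟩ := exists_separated_of_lt_volume hh0.le
    (bddBelow_Icc.mono hE) k (by
      rw [hh, mul_div_cancel₀ _ hkR.ne']; simpa using hc2)
  have hb := abs_eval_le_of_separated hq (y := 0) (A := δ * |q.eval 0|) hh0 (by positivity) hL hxs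
    (fun i hi => hqE _ (hx i hi)) (fun i hi => by
      have := hE (hx i hi)
      rw [zero_sub, abs_neg, abs_of_nonneg this.1]; exact this.2)
  have hq0' : 0 < |q.eval 0| := abs_pos.2 hq0
  have hb' : 1 ≤ δ * ((2 * L / h) ^ k / (k.factorial : ℝ)) := by
    by_contra hlt
    rw [not_le] at hlt
    nlinarith [mul_lt_mul_of_pos_left hlt hq0']
  have hpow : (L / h) ^ k < 1 / (2 * δ) := by
    have h1 : L / h < (2 * δ) ^ (-(1 / (k : ℝ))) := by
      rw [Real.rpow_neg (by positivity), div_lt_iff₀ hh0, inv_mul_eq_div, lt_div_iff₀ hr]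
      linarith
    have h2 := pow_lt_pow_left₀ h1 (by positivity) (by omega : k ≠ 0)
    rwa [← Real.rpow_natCast ((2 * δ) ^ (-(1 / (k : ℝ)))), ← Real.rpow_mul (by positivity), neg_mul,
      one_div_mul_cancel hkR.ne', Real.rpow_neg_one, ← one_div] at h2
  -- The k! of the interpolation bound absorbs 2^k up to a factor 2, which is the 2 in (2δ)^(1/k).
  have hfac : (2 : ℝ) ^ k ≤ 2 * k.factorial := by
    have h3 : 2 ^ k ≤ 2 * k.factorial := by
      clear * - hk
      induction k, hk using Nat.le_induction with
      | base => simp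
      | succ k hk ih =>
        rw [pow_succ, Nat.factorial_succ]
        nlinarith [Nat.factorial_pos k]
    exact_mod_cast h3
  have hf0 : (0 : ℝ) < k.factorial := by exact_mod_cast Nat.factorial_pos k
  rw [mul_div_assoc, mul_pow] at hb'
  have h5 : δ * ((2 : ℝ) ^ k * (L / h) ^ k / k.factorial) < 1 := by
    have : δ * ((2 : ℝ) ^ k * (L / h) ^ k / k.factorial) ≤ δ * (2 * (L / h) ^ k) := by
      gcongr
      rw [div_le_iff₀ hf0]
      have : 0 ≤ (L / h) ^ k := by positivity
      nlinarith
    have h6 : δ * (2 * (L / h) ^ k) < 1 := by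
      rw [lt_div_iff₀ (by positivity)] at hpow
      linarith
    linarith
  linarith

/-- The constant in the bound for the derivative of a polynomial at an end point. -/
noncomputable def markovConst (l : ℕ) : ℝ := l * ((2 * l) ^ l / l.factorial)

/-- The derivative p'(0) is the value at 0 of q = (p - p(0))/X. The bound on p controls q away from
0, namely at the nodes 1/l, 2/l, …, 1, and interpolation carries it to 0. -/
theorem abs_eval_derivative_zero_le {l : ℕ} (hl : 1 ≤ l) {p : Polynomial ℝ} (hp : p.natDegree ≤ l)
    {A : ℝ} (hA : 0 ≤ A) (hpA : ∀ x ∈ Set.Icc (0 : ℝ) 1, |p.eval x| ≤ A) :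
    |p.derivative.eval 0| ≤ A * markovConst l := by
  obtain ⟨m, rfl⟩ : ∃ m, l = m + 1 := ⟨l - 1, by omega⟩
  set q := p.divX with hq
  have hpq : ∀ x, p.eval x = x * q.eval x + p.eval 0 := by
    intro x
    conv_lhs => rw [← Polynomial.divX_mul_X_add p]
    simp [hq, Polynomial.coeff_zero_eq_eval_zero]; ring
  have hd : p.derivative.eval 0 = q.eval 0 := by
    conv_lhs => rw [← Polynomial.divX_mul_X_add p]
    simp [hq]
  have hqdeg : q.natDegree ≤ m := by
    rw [hq, Polynomial.natDegree_divX_eq_natDegree_tsub_one]; omega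
  have hm : (0 : ℝ) < m + 1 := by positivity
  have := abs_eval_le_of_separated hqdeg (x := fun i => ((i : ℝ) + 1) / (m + 1)) (h := 1 / (m + 1))
    (A := 2 * A * (m + 1)) (L := 1) (y := 0) (by positivity) (by positivity) zero_le_one
    (fun i hi => by push_cast; rw [← add_div])
    (fun i hi => by
      have hi' : (i : ℝ) ≤ m := by exact_mod_cast hi
      have hx0 : 0 < ((i : ℝ) + 1) / (m + 1) := by positivity
      have hx1 : ((i : ℝ) + 1) / (m + 1) ≤ 1 := by rw [div_le_one hm]; linarith
      have h1 := hpA _ ⟨hx0.le, hx1⟩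
      have h0 := hpA 0 ⟨le_rfl, zero_le_one⟩
      have h2 : |((i : ℝ) + 1) / (m + 1) * q.eval (((i : ℝ) + 1) / (m + 1))| ≤ 2 * A := by
        have : ((i : ℝ) + 1) / (m + 1) * q.eval (((i : ℝ) + 1) / (m + 1))
            = p.eval (((i : ℝ) + 1) / (m + 1)) - p.eval 0 := by rw [hpq (((i : ℝ) + 1) / (m + 1))]; ring
        rw [this]
        exact (abs_sub _ _).trans (by linarith)
      rw [abs_mul, abs_of_pos hx0] at h2
      have h3 : 1 / ((m : ℝ) + 1) ≤ ((i : ℝ) + 1) / (m + 1) := by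
        gcongr; have : (0 : ℝ) ≤ i := by positivity
        linarith
      have h4 : 1 / ((m : ℝ) + 1) * |q.eval (((i : ℝ) + 1) / (m + 1))| ≤ 2 * A :=
        (mul_le_mul_of_nonneg_right h3 (abs_nonneg _)).trans h2
      rw [one_div, inv_mul_eq_div, div_le_iff₀ hm] at h4
      exact h4)
    (fun i hi => by
      have hi' : (i : ℝ) ≤ m := by exact_mod_cast hi
      rw [zero_sub, abs_neg, abs_of_nonneg (by positivity), div_le_one hm]; linarith)
  rw [hd]
  refine this.trans (le_of_eq ?_)
  rw [markovConst, Nat.factorial_succ]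
  have := (Nat.cast_ne_zero (R := ℝ)).2 (Nat.factorial_ne_zero m)
  push_cast
  field_simp
  ring

/-- Finite differences: a function whose `k`-th derivative is bounded below cannot be small. -/
theorem finite_difference_le (k : ℕ) {δ : ℝ} (hδ : 0 ≤ δ) : ∀ {ψ : ℕ → ℝ → ℝ} {a c A : ℝ},
    (∀ i < k, ∀ x ∈ Set.Icc a (a + k * δ), HasDerivAt (ψ i) (ψ (i + 1) x) x) →
    (∀ x ∈ Set.Icc a (a + k * δ), c ≤ ψ k x) →
    (∀ x ∈ Set.Icc a (a + k * δ), |ψ 0 x| ≤ A) → c * δ ^ k ≤ 2 ^ k * A := by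
  induction k with
  | zero =>
    intro ψ a c A _ h2 h3
    have ha : a ∈ Set.Icc a (a + ((0 : ℕ) : ℝ) * δ) := by simp
    simpa using (h2 a ha).trans ((le_abs_self _).trans (h3 a ha))
  | succ k ih =>
    intro ψ a c A h1 h2 h3
    have hsub : ∀ x ∈ Set.Icc a (a + k * δ), Set.Icc x (x + δ) ⊆ Set.Icc a (a + (k + 1 : ℕ) * δ) := by
      intro x hx y hy
      refine ⟨hx.1.trans hy.1, ?_⟩
      have := hx.2; have := hy.2
      push_cast; linarith
    -- Passing to the first difference gains a factor δ by the mean value inequality, doubles the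
    -- sup bound and shortens the interval by δ.
    have key := ih (ψ := fun i x => ψ i (x + δ) - ψ i x) (a := a) (c := c * δ) (A := 2 * A)
      (fun i hi x hx => by
        have hx1 := hsub x hx ⟨le_rfl, by linarith⟩
        have hx2 := hsub x hx (⟨by linarith, le_rfl⟩ : x + δ ∈ Set.Icc x (x + δ))
        have e1 := (h1 i (by omega) _ hx2).comp_add_const x δ
        exact e1.sub (h1 i (by omega) _ hx1))
      (fun x hx => by
        have := (convex_Icc x (x + δ)).mul_sub_le_image_sub_of_le_deriv (f := ψ k) (C := c)
          (fun y hy => (h1 k (by omega) y (hsub x hx hy)).continuousAt.continuousWithinAt)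
          (fun y hy => (h1 k (by omega) y (hsub x hx (interior_subset hy))).differentiableAt.differentiableWithinAt)
          (fun y hy => by
            rw [(h1 k (by omega) y (hsub x hx (interior_subset hy))).deriv]
            exact h2 y (hsub x hx (interior_subset hy)))
          x ⟨le_rfl, by linarith⟩ (x + δ) ⟨by linarith, le_rfl⟩ (by linarith)
        simpa using this)
      (fun x hx => by
        have hx1 := h3 x (hsub x hx ⟨le_rfl, by linarith⟩)
        have hx2 := h3 (x + δ) (hsub x hx ⟨by linarith, le_rfl⟩)
        exact (abs_sub _ _).trans (by linarith))
    calc c * δ ^ (k + 1) = c * δ * δ ^ k := by ring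
      _ ≤ 2 ^ k * (2 * A) := key
      _ = _ := by ring

/-- The Taylor polynomial with `m` terms of `ψ 0`, where `ψ i` is the `i`-th derivative. -/
noncomputable def taylorPoly (ψ : ℕ → ℝ → ℝ) (m : ℕ) : Polynomial ℝ :=
  ∑ i ∈ Finset.range m, Polynomial.monomial i (ψ i 0 / i.factorial)

theorem natDegree_taylorPoly_le (ψ : ℕ → ℝ → ℝ) (m : ℕ) : (taylorPoly ψ m).natDegree ≤ m - 1 := by
  refine Polynomial.natDegree_sum_le_of_forall_le _ _ fun i hi => ?_
  refine (Polynomial.natDegree_monomial_le _).trans ?_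
  have := Finset.mem_range.1 hi
  omega

theorem derivative_taylorPoly (ψ : ℕ → ℝ → ℝ) (m : ℕ) :
    (taylorPoly ψ (m + 1)).derivative = taylorPoly (fun i => ψ (i + 1)) m := by
  rw [taylorPoly, taylorPoly, Finset.sum_range_succ', Polynomial.derivative_add,
    Polynomial.derivative_monomial, Polynomial.derivative_sum]
  simp only [Nat.cast_zero, mul_zero, Polynomial.monomial_zero_right, add_zero]
  refine Finset.sum_congr rfl fun i _ => ?_
  rw [Polynomial.derivative_monomial, Nat.add_sub_cancel, Nat.factorial_succ]
  congr 1
  have := (Nat.cast_ne_zero (R := ℝ)).2 (Nat.factorial_ne_zero i)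
  push_cast
  field_simp

theorem eval_taylorPoly_zero (ψ : ℕ → ℝ → ℝ) {m : ℕ} (hm : 1 ≤ m) :
    (taylorPoly ψ m).eval 0 = ψ 0 0 := by
  obtain ⟨m, rfl⟩ : ∃ k, m = k + 1 := ⟨m - 1, by omega⟩
  rw [taylorPoly, Finset.sum_range_succ', Polynomial.eval_add, Polynomial.eval_finsetSum]
  simp

theorem abs_sub_taylorPoly_le (m : ℕ) : ∀ {ψ : ℕ → ℝ → ℝ} {C L : ℝ},
    (∀ i < m, ∀ x ∈ Set.Icc 0 L, HasDerivAt (ψ i) (ψ (i + 1) x) x) →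
    (∀ x ∈ Set.Icc 0 L, |ψ m x| ≤ C) →
    ∀ x ∈ Set.Icc 0 L, |ψ 0 x - (taylorPoly ψ m).eval x| ≤ C * x ^ m / m.factorial := by
  induction m with
  | zero => intro ψ C L _ h2 x hx; simpa [taylorPoly] using h2 x hx
  | succ m ih =>
    intro ψ C L h1 h2 x hx
    have hsub := ih (ψ := fun i => ψ (i + 1)) (fun i hi y hy => h1 (i + 1) (by omega) y hy) h2
    have hd : ∀ y ∈ Set.Icc 0 L, HasDerivAt (fun z => ψ 0 z - (taylorPoly ψ (m + 1)).eval z)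
        (ψ 1 y - (taylorPoly (fun i => ψ (i + 1)) m).eval y) y := by
      intro y hy
      rw [← derivative_taylorPoly]
      exact (h1 0 (by omega) y hy).sub ((taylorPoly ψ (m + 1)).hasDerivAt y)
    have hB : ∀ y, HasDerivAt (fun z : ℝ => C * z ^ (m + 1) / (m + 1).factorial)
        (C * y ^ m / m.factorial) y := by
      intro y
      have := (((hasDerivAt_pow (m + 1) y).const_mul C).div_const ((m + 1).factorial : ℝ))
      refine this.congr_deriv ?_
      rw [Nat.factorial_succ]
      have := (Nat.cast_ne_zero (R := ℝ)).2 (Nat.factorial_ne_zero m)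
      push_cast
      field_simp
    have := image_norm_le_of_norm_deriv_right_le_deriv_boundary
      (f := fun z => ψ 0 z - (taylorPoly ψ (m + 1)).eval z)
      (B := fun z : ℝ => C * z ^ (m + 1) / (m + 1).factorial) (a := 0) (b := L)
      (fun y hy => (hd y hy).continuousAt.continuousWithinAt)
      (fun y hy => (hd y ⟨hy.1, hy.2.le⟩).hasDerivWithinAt)
      (by rw [eval_taylorPoly_zero ψ (by omega)]; simp) hB
      (fun y hy => hsub y ⟨hy.1, hy.2.le⟩) hx
    exact this

end SkewGood

/-! ### Polar coordinates -/

namespace SkewGood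

theorem volume_eq_lintegral_rays {d : ℕ} {T : Set (E d)} (hd : 1 ≤ d) (hT : MeasurableSet T) :
    volume T = ∫⁻ ω : sphere (0 : E d) 1,
      Measure.volumeIoiPow (d - 1) {s : Set.Ioi (0 : ℝ) | s.1 • ω.1 ∈ T}
        ∂(volume : Measure (E d)).toSphere := by
  have : Nontrivial (E d) := by
    have : Nonempty (Fin d) := ⟨⟨0, hd⟩⟩
    infer_instance
  have hmp := (volume : Measure (E d)).measurePreserving_homeomorphUnitSphereProd
  rw [finrank_euclideanSpace_fin] at hmp
  set T' : Set (({0}ᶜ : Set (E d)) : Type) := Subtype.val ⁻¹' T with hT'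
  have hmT' : MeasurableSet T' := measurable_subtype_coe hT
  have h1 : volume T = (Measure.comap (Subtype.val : ({0}ᶜ : Set (E d)) → E d) volume) T' := by
    rw [(MeasurableEmbedding.subtype_coe (measurableSet_singleton (0 : E d)).compl).comap_apply,
      Subtype.image_preimage_coe, Set.inter_comm, ← Set.sdiff_eq,
      measure_sdiff_null (measure_singleton _)]
  have h2 := hmp.symm (e := (homeomorphUnitSphereProd (E d)).toMeasurableEquiv)
  rw [h1, ← h2.measure_preimage hmT'.nullMeasurableSet, Measure.prod_apply]
  · rfl
  · exact h2.measurable hmT'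

theorem volumeIoiPow_le {n : ℕ} {L : ℝ} (A : Set (Set.Ioi (0 : ℝ))) (hA : MeasurableSet A)
    (hL : ∀ s ∈ A, s.1 ≤ L) :
    Measure.volumeIoiPow n A ≤ ENNReal.ofReal (L ^ n) * volume (Subtype.val '' A) := by
  rw [Measure.volumeIoiPow, withDensity_apply _ hA]
  calc ∫⁻ a in A, ENNReal.ofReal (a.1 ^ n) ∂Measure.comap Subtype.val volume
      ≤ ∫⁻ _ in A, ENNReal.ofReal (L ^ n) ∂Measure.comap Subtype.val volume := by
        refine setLIntegral_mono' hA fun a ha => ENNReal.ofReal_le_ofReal ?_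
        exact pow_le_pow_left₀ (le_of_lt a.2) (hL a ha) n
    _ = _ := by
        rw [setLIntegral_const, (MeasurableEmbedding.subtype_coe measurableSet_Ioi).comap_apply]

/-- Comparison of volumes in polar coordinates. -/
theorem volume_le_of_rays {d : ℕ} (hd : 1 ≤ d) {K S : Set (E d)} (hK : MeasurableSet K)
    (hS : MeasurableSet S) (hSK : S ⊆ K) (x : E d) {c : ℝ} (hc : 0 ≤ c)
    (h : ∀ ω : E d, ‖ω‖ = 1 → ∃ L : ℝ, 0 ≤ L ∧ (∀ s, 0 < s → s < L → x + s • ω ∈ K) ∧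
      (∀ s, 0 < s → x + s • ω ∈ K → s ≤ L) ∧
      volume {s : ℝ | 0 < s ∧ x + s • ω ∈ S} ≤ ENNReal.ofReal (c * L)) :
    volume S ≤ ENNReal.ofReal (d * c) * volume K := by
  have tr : ∀ T : Set (E d), volume T = volume ((fun z => x + z) ⁻¹' T) :=
    fun T => (measure_preimage_add volume x T).symm
  have hmeas : Measurable (fun z : E d => x + z) := measurable_const_add x
  rw [tr S, tr K, volume_eq_lintegral_rays hd (hmeas hS), volume_eq_lintegral_rays hd (hmeas hK)]
  rw [← lintegral_const_mul' _ _ ENNReal.ofReal_ne_top]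
  refine lintegral_mono fun ω => ?_
  obtain ⟨L, hL0, hL1, hL2, hL3⟩ := h ω.1 (by simp)
  have hm : Measurable (fun s : Set.Ioi (0 : ℝ) => x + s.1 • ω.1) :=
    (measurable_subtype_coe.smul_const _).const_add x
  have e1 := volumeIoiPow_le (n := d - 1) (L := L) {s : Set.Ioi (0 : ℝ) | x + s.1 • ω.1 ∈ S}
    (hm hS) (fun s hs => hL2 s.1 s.2 (hSK hs))
  have e2 : (Subtype.val '' {s : Set.Ioi (0 : ℝ) | x + s.1 • ω.1 ∈ S})
      = {s : ℝ | 0 < s ∧ x + s • ω.1 ∈ S} := by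
    ext s; constructor
    · rintro ⟨s, hs, rfl⟩; exact ⟨s.2, hs⟩
    · rintro ⟨hs, hs'⟩; exact ⟨⟨s, hs⟩, hs', rfl⟩
  rw [e2] at e1
  refine e1.trans ?_
  rcases hL0.eq_or_lt with hL | hL
  · rw [← hL, mul_zero, ENNReal.ofReal_zero] at hL3
    rw [le_antisymm hL3 bot_le]; simp
  have hdR : (d : ℝ) ≠ 0 := by exact_mod_cast (by omega : d ≠ 0)
  have e3 : ENNReal.ofReal (L ^ d / d) ≤
      Measure.volumeIoiPow (d - 1) {s : Set.Ioi (0 : ℝ) | s.1 • ω.1 ∈ (fun z => x + z) ⁻¹' K} := by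
    have := Measure.volumeIoiPow_apply_Iio (d - 1) ⟨L, hL⟩
    have hd1 : ((d - 1 : ℕ) : ℝ) + 1 = d := by
      rw [Nat.cast_sub hd]; simp
    rw [Nat.sub_add_cancel hd, hd1] at this
    rw [← this]
    exact measure_mono fun s hs => hL1 s.1 s.2 hs
  -- The factor d is the loss from bounding the density s^(d-1) by L^(d-1) on the small set, while
  -- the whole ray has mass L^d/d.
  calc ENNReal.ofReal (L ^ (d - 1)) * volume {s : ℝ | 0 < s ∧ x + s • ω.1 ∈ S}
      ≤ ENNReal.ofReal (L ^ (d - 1)) * ENNReal.ofReal (c * L) := by gcongr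
    _ = ENNReal.ofReal (d * c) * ENNReal.ofReal (L ^ d / d) := by
        rw [← ENNReal.ofReal_mul (by positivity), ← ENNReal.ofReal_mul (by positivity)]
        congr 1
        obtain ⟨m, rfl⟩ : ∃ m, d = m + 1 := ⟨d - 1, by omega⟩
        rw [Nat.add_sub_cancel]
        field_simp
        ring
    _ ≤ _ := by gcongr

end SkewGood

/-! ### Vitali covering: from one scale to all scales -/

namespace SkewGood

/-- The contraction by 1/τ towards b preserves the convex set B, so truncation by B costs nothing in
the doubling constant, even near the boundary. -/
theorem volume_convex_inter_ball_le {d : ℕ} {B : Set (E d)} (hB : Convex ℝ B) {b : E d} (hb : b ∈ B)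
    {τ ρ : ℝ} (hτ : 1 ≤ τ) :
    volume (B ∩ ball b (τ * ρ)) ≤ ENNReal.ofReal (τ ^ d) * volume (B ∩ ball b ρ) := by
  have hτ0 : 0 < τ := by linarith
  have hsub : B ∩ ball b (τ * ρ) ⊆ AffineMap.homothety b τ '' (B ∩ ball b ρ) := by
    rintro z ⟨hzB, hz⟩
    refine ⟨b + τ⁻¹ • (z - b), ⟨?_, ?_⟩, ?_⟩
    · have := hB.add_smul_sub_mem hb hzB (t := τ⁻¹) ⟨by positivity, inv_le_one_of_one_le₀ hτ⟩
      exact this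
    · rw [mem_ball, dist_eq_norm, add_sub_cancel_left, norm_smul, norm_inv, Real.norm_of_nonneg hτ0.le,
        inv_mul_eq_div, div_lt_iff₀ hτ0, ← dist_eq_norm]
      rw [mem_ball] at hz; linarith
    · rw [AffineMap.homothety_apply]
      simp [smul_smul, hτ0.ne']
  refine (measure_mono hsub).trans (le_of_eq ?_)
  rw [Measure.addHaar_image_homothety, finrank_euclideanSpace_fin, abs_of_nonneg (by positivity)]

/-- A covering argument: an estimate for the proportion of small values at one fixed scale, on all
intersections of a ball `B` with balls centred in `B`, self-improves to all scales. -/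
theorem volume_lt_le_of_scale {d : ℕ} {c : E d} {t : ℝ} (ht : 0 < t) {h : E d → ℝ}
    (hcont : ContinuousOn h (ball c t)) {ε₀ C α β τ : ℝ} (hε₀ : 0 < ε₀) (hε₁ : ε₀ < 1) (hC : 0 ≤ C)
    (hαβ : α ≤ β) (hτ : 3 < τ) (hrec : τ ^ d * (C * ε₀ ^ β) ≤ ε₀ ^ α)
    (G : ∀ x ∈ ball c t, ∀ s, 0 < s → s ≤ 2 * t → ∀ ε, ε₀ ≤ ε → ε ≤ 1 → ∀ A, 0 < A →
      (∃ z ∈ ball c t ∩ ball x s, A ≤ h z) →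
      volume {z | z ∈ ball c t ∩ ball x s ∧ h z < ε * A}
        ≤ ENNReal.ofReal (C * ε ^ β) * volume (ball c t ∩ ball x s))
    {ε A : ℝ} (hε : 0 < ε) (hε' : ε ≤ 1) (hA : 0 < A) (hex : ∃ z ∈ ball c t, A ≤ h z) :
    volume {z | z ∈ ball c t ∧ h z < ε * A} ≤ ENNReal.ofReal (C * ε ^ α) * volume (ball c t) := by
  have base : ∀ ε, ε₀ ≤ ε → ε ≤ 1 →
      volume {z | z ∈ ball c t ∧ h z < ε * A}
        ≤ ENNReal.ofReal (C * ε ^ α) * volume (ball c t) := by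
    intro ε h1 h2
    have := G c (mem_ball_self ht) t ht (by linarith) ε h1 h2 A hA (by rwa [Set.inter_self])
    rw [Set.inter_self] at this
    refine this.trans ?_
    gcongr ENNReal.ofReal (C * ?_) * _
    exact Real.rpow_le_rpow_of_exponent_ge (hε₀.trans_le h1) h2 hαβ
  -- Induction on the number of factors ε₀ in ε: the set at level ε = ε₀ε' is compared with the
  -- larger set `T` at level ε'.
  have main : ∀ n : ℕ, ∀ ε, ε₀ ^ (n + 1) ≤ ε → ε ≤ 1 →
      volume {z | z ∈ ball c t ∧ h z < ε * A}
        ≤ ENNReal.ofReal (C * ε ^ α) * volume (ball c t) := by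
    intro n
    induction n with
    | zero => intro ε h1 h2; exact base ε (by simpa using h1) h2
    | succ n ih =>
      intro ε h1 h2
      rcases le_or_gt ε₀ ε with hge | hlt
      · exact base ε hge h2
      have hεp : 0 < ε := lt_of_lt_of_le (by positivity) h1
      set ε' := ε / ε₀ with hε'def
      have hε'1 : ε' < 1 := by rw [hε'def, div_lt_one hε₀]; exact hlt
      have hε'0 : 0 < ε' := by positivity
      have hee : ε = ε₀ * ε' := by rw [hε'def]; field_simp
      have hlt' : ε < ε' := by rw [hee]; nlinarith
      have ihε := ih ε' (by rw [hε'def, le_div_iff₀ hε₀, ← pow_succ]; exact h1) hε'1.le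
      set S := {z | z ∈ ball c t ∧ h z < ε * A} with hS
      set T := {z | z ∈ ball c t ∧ h z < ε' * A} with hT
      have hopen : IsOpen T := by
        have := hcont.isOpen_inter_preimage isOpen_ball (isOpen_Iio (a := ε' * A))
        exact this
      have hex' : ¬ (ball c t ⊆ T) := by
        obtain ⟨z, hz, hzA⟩ := hex
        intro hsub
        have := (hsub hz).2
        nlinarith
      -- A radius within a factor τ of the largest for which the truncated ball stays in `T`: the
      -- ball is charged to `T`, while its enlargement contains a point where h ≥ ε'A.
      have hrad : ∀ x ∈ S, ∃ ρ, 0 < ρ ∧ ρ ≤ 2 * t ∧ ball c t ∩ ball x ρ ⊆ T ∧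
          ¬ (ball c t ∩ ball x (τ * ρ) ⊆ T) := by
        intro x hx
        have hxT : x ∈ T := ⟨hx.1, hx.2.trans (by gcongr)⟩
        set V := {ρ : ℝ | 0 < ρ ∧ ball c t ∩ ball x ρ ⊆ T} with hV
        have hVne : V.Nonempty := by
          obtain ⟨ρ, hρ, hρT⟩ := Metric.isOpen_iff.1 hopen x hxT
          exact ⟨ρ, hρ, fun z hz => hρT hz.2⟩
        have hVb : ∀ ρ ∈ V, ρ ≤ 2 * t := by
          intro ρ hρ
          by_contra hcon
          rw [not_le] at hcon
          refine hex' fun z hz => hρ.2 ⟨hz, ?_⟩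
          have h1 := mem_ball.1 hz
          have h2 := mem_ball'.1 hx.1
          exact mem_ball.2 (lt_of_le_of_lt (dist_triangle z c x) (by linarith))
        have hbdd : BddAbove V := ⟨2 * t, hVb⟩
        have hpos : 0 < sSup V := by
          obtain ⟨ρ, hρ⟩ := hVne
          exact lt_of_lt_of_le hρ.1 (le_csSup hbdd hρ)
        obtain ⟨ρ, hρV, hρ⟩ := exists_lt_of_lt_csSup hVne
          (show sSup V / τ < sSup V from div_lt_self hpos (by linarith))
        refine ⟨ρ, hρV.1, hVb ρ hρV, hρV.2, fun hsub => ?_⟩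
        have : τ * ρ ∈ V := ⟨by have := hρV.1; positivity, hsub⟩
        have := le_csSup hbdd this
        rw [div_lt_iff₀ (by linarith)] at hρ
        linarith
      choose! ρ hρ0 hρt hρ1 hρ2 using hrad
      obtain ⟨u, huS, hudisj, hucov⟩ := Vitali.exists_disjoint_subfamily_covering_enlargement_ball
        S id ρ (2 * t) hρt τ hτ
      have hucount : u.Countable := hudisj.countable_of_isOpen (fun _ _ => isOpen_ball)
        fun a ha => ⟨a, mem_ball_self (hρ0 a (huS ha))⟩
      have hScov : S ⊆ ⋃ b ∈ u, (S ∩ ball b (τ * ρ b)) := by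
        intro x hx
        obtain ⟨b, hb, hsub⟩ := hucov x hx
        exact Set.mem_biUnion hb ⟨hx, hsub (mem_ball_self (hρ0 x hx))⟩
      have hpiece : ∀ b ∈ u, volume (S ∩ ball b (τ * ρ b))
          ≤ ENNReal.ofReal (τ ^ d * (C * ε₀ ^ β)) * volume (ball c t ∩ ball b (ρ b)) := by
        intro b hb
        have hbS := huS hb
        have hρb := hρ0 b hbS
        -- The fixed-scale estimate is available only up to 2t; beyond that the truncated ball is
        -- already all of `ball c t`.
        set s := min (τ * ρ b) (2 * t) with hs
        have hKs : ball c t ∩ ball b s = ball c t ∩ ball b (τ * ρ b) := by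
          rcases le_total (τ * ρ b) (2 * t) with h | h
          · rw [hs, min_eq_left h]
          · rw [hs, min_eq_right h]
            have : ball c t ⊆ ball b (2 * t) := by
              intro z hz
              have h1 := mem_ball.1 hz
              have h2 := mem_ball'.1 hbS.1
              exact mem_ball.2 (lt_of_le_of_lt (dist_triangle z c b) (by linarith))
            rw [Set.inter_eq_left.2 this, Set.inter_eq_left.2 (this.trans (ball_subset_ball h))]
        have hsp : 0 < s := lt_min (by positivity) (by linarith)
        have := G b hbS.1 s hsp (min_le_right _ _) ε₀ le_rfl hε₁.le (ε' * A) (by positivity) (by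
          rw [hKs]
          obtain ⟨z, hz, hzT⟩ := Set.not_subset.1 (hρ2 b hbS)
          refine ⟨z, hz, ?_⟩
          by_contra hcon
          exact hzT ⟨hz.1, not_le.1 hcon⟩)
        rw [hKs] at this
        have hsub : S ∩ ball b (τ * ρ b)
            ⊆ {z | z ∈ ball c t ∩ ball b (τ * ρ b) ∧ h z < ε₀ * (ε' * A)} := by
          rintro z ⟨hz1, hz2⟩
          refine ⟨⟨hz1.1, hz2⟩, ?_⟩
          have := hz1.2
          rw [hee] at this
          linarith
        refine (measure_mono hsub).trans (this.trans ?_)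
        have h3 := volume_convex_inter_ball_le (convex_ball c t) hbS.1 (τ := τ) (ρ := ρ b)
          (by linarith)
        calc _ ≤ ENNReal.ofReal (C * ε₀ ^ β) *
              (ENNReal.ofReal (τ ^ d) * volume (ball c t ∩ ball b (ρ b))) := by gcongr
          _ = _ := by
            rw [← mul_assoc, ← ENNReal.ofReal_mul (by positivity), mul_comm (C * _)]
      calc volume S ≤ ∑' b : u, volume (S ∩ ball b.1 (τ * ρ b)) :=
            (measure_mono hScov).trans (measure_biUnion_le _ hucount _)
        _ ≤ ∑' b : u, ENNReal.ofReal (τ ^ d * (C * ε₀ ^ β)) *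
              volume (ball c t ∩ ball b.1 (ρ b)) := by
            exact ENNReal.tsum_le_tsum fun b => hpiece b.1 b.2
        _ = ENNReal.ofReal (τ ^ d * (C * ε₀ ^ β)) *
              volume (⋃ b ∈ u, (ball c t ∩ ball b (ρ b))) := by
            rw [ENNReal.tsum_mul_left, measure_biUnion hucount]
            · exact hudisj.mono fun b => Set.inter_subset_right
            · exact fun b _ => (isOpen_ball.inter isOpen_ball).measurableSet
        _ ≤ ENNReal.ofReal (ε₀ ^ α) * volume T := by
            gcongr
            exact Set.iUnion₂_subset fun b hb => hρ1 b (huS hb)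
        _ ≤ ENNReal.ofReal (ε₀ ^ α) * (ENNReal.ofReal (C * ε' ^ α) * volume (ball c t)) := by
            gcongr
        _ = ENNReal.ofReal (C * ε ^ α) * volume (ball c t) := by
            rw [← mul_assoc, ← ENNReal.ofReal_mul (by positivity)]
            congr 2
            rw [hee, Real.mul_rpow hε₀.le hε'0.le]
            ring
  obtain ⟨n, hn⟩ := exists_pow_lt_of_lt_one hε hε₁
  exact main n ε ((pow_le_pow_of_le_one hε₀.le hε₁.le (Nat.le_succ n)).trans hn.le) hε'

end SkewGood

/-! ### Taylor approximation along segments, and the effect of non-degeneracy -/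

namespace SkewGood

/-- `f` is `C^{l+1}` on the open set `W` and its derivatives of orders `1, …, l + 1` are bounded
by `M` there. -/
structure DerivBound {d n : ℕ} (l : ℕ) (M : ℝ) (f : E d → E n) (W : Set (E d)) : Prop where
  isOpen : IsOpen W
  contDiffAt : ∀ x ∈ W, ContDiffAt ℝ ((l + 1 : ℕ) : WithTop ℕ∞) f x
  nonneg : 0 ≤ M
  bound : ∀ k : ℕ, 1 ≤ k → k ≤ l + 1 → ∀ x ∈ W, ∀ m : Fin k → E d,
    ‖iteratedFDeriv ℝ k f x m‖ ≤ M * ∏ i, ‖m i‖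

theorem norm_multilinear_le_of_unit {d n k : ℕ} {A : ContinuousMultilinearMap ℝ (fun _ : Fin k => E d) (E n)}
    {M : ℝ} (h : ∀ u : Fin k → E d, (∀ i, ‖u i‖ = 1) → ‖A u‖ ≤ M) (hM : 0 ≤ M) (m : Fin k → E d) :
    ‖A m‖ ≤ M * ∏ i, ‖m i‖ := by
  by_cases hm : ∃ i, m i = 0
  · obtain ⟨i, hi⟩ := hm
    rw [A.map_coord_zero i hi, norm_zero]
    positivity
  · push Not at hm
    have h1 : m = fun i => ‖m i‖ • ((‖m i‖)⁻¹ • m i) := by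
      funext i
      rw [smul_smul, mul_inv_cancel₀ (norm_ne_zero_iff.2 (hm i)), one_smul]
    rw [h1, A.map_smul_univ, norm_smul, Real.norm_of_nonneg (by positivity), mul_comm]
    have h2 := h (fun i => (‖m i‖)⁻¹ • m i) fun i => by
      rw [norm_smul, norm_inv, norm_norm, inv_mul_cancel₀ (norm_ne_zero_iff.2 (hm i))]
    have h3 : ∏ i, ‖‖m i‖ • (‖m i‖)⁻¹ • m i‖ = ∏ i, ‖m i‖ := by
      refine Finset.prod_congr rfl fun i _ => ?_
      rw [smul_smul, mul_inv_cancel₀ (norm_ne_zero_iff.2 (hm i)), one_smul]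
    rw [h3]
    gcongr

variable {d n l : ℕ} {M : ℝ} {f : E d → E n} {W : Set (E d)}

theorem DerivBound.hasDerivAt_line (hf : DerivBound l M f W) {j : ℕ} (hj : j ≤ l) (w : E n)
    (z v : E d) (m : Fin j → E d) {s : ℝ} (hs : z + s • v ∈ W) :
    HasDerivAt (fun s : ℝ => inner ℝ w (iteratedFDeriv ℝ j f (z + s • v) m))
      (inner ℝ w (iteratedFDeriv ℝ (j + 1) f (z + s • v) (Fin.cons v m))) s := by
  have h1 : DifferentiableAt ℝ (iteratedFDeriv ℝ j f) (z + s • v) :=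
    (hf.contDiffAt _ hs).differentiableAt_iteratedFDeriv (by exact_mod_cast Nat.lt_succ_of_le hj)
  have h2 : HasDerivAt (fun s : ℝ => z + s • v) v s := by
    simpa using ((hasDerivAt_id s).smul_const v).const_add z
  have h3 := h1.hasFDerivAt.comp_hasDerivAt s h2
  have h4 := ((ContinuousMultilinearMap.apply ℝ (fun _ : Fin j => E d) (E n) m).hasFDerivAt).comp_hasDerivAt s h3
  have h5 := ((innerSL ℝ w).hasFDerivAt).comp_hasDerivAt s h4
  refine h5.congr_deriv ?_
  rw [iteratedFDeriv_succ_apply_left]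
  simp

theorem DerivBound.abs_inner_le (hf : DerivBound l M f W) {k : ℕ} (hk : 1 ≤ k) (hkl : k ≤ l + 1)
    (w : E n) {x : E d} (hx : x ∈ W) (m : Fin k → E d) {v : ℝ} (hm : ∏ i, ‖m i‖ ≤ v) :
    |inner ℝ w (iteratedFDeriv ℝ k f x m)| ≤ ‖w‖ * M * v := by
  refine (abs_real_inner_le_norm _ _).trans ?_
  rw [mul_assoc]
  have := hf.nonneg
  exact mul_le_mul_of_nonneg_left ((hf.bound k hk hkl x hx m).trans (by gcongr)) (norm_nonneg _)

theorem DerivBound.hasFDerivAt_inner (hf : DerivBound l M f W) (w : E n) (c : ℝ) {x : E d}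
    (hx : x ∈ W) :
    HasFDerivAt (fun z => inner ℝ w (f z) + c) ((innerSL ℝ w).comp (fderiv ℝ f x)) x := by
  have h1 : DifferentiableAt ℝ f x := (hf.contDiffAt x hx).differentiableAt (by simp)
  exact (((innerSL ℝ w).hasFDerivAt).comp x h1.hasFDerivAt).add_const c

/-- The derivatives of `⟪w, f⟫ + c` along the line `z + s v`. -/
noncomputable def lineSeq (f : E d → E n) (w : E n) (c : ℝ) (z v : E d) (j : ℕ) (s : ℝ) : ℝ :=
  inner ℝ w (iteratedFDeriv ℝ j f (z + s • v) fun _ => v) + if j = 0 then c else 0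

theorem lineSeq_zero (w : E n) (c : ℝ) (z v : E d) (s : ℝ) :
    lineSeq f w c z v 0 s = inner ℝ w (f (z + s • v)) + c := by
  simp [lineSeq]

theorem DerivBound.hasDerivAt_lineSeq (hf : DerivBound l M f W) {j : ℕ} (hj : j ≤ l) (w : E n)
    (c : ℝ) (z v : E d) {s : ℝ} (hs : z + s • v ∈ W) :
    HasDerivAt (lineSeq f w c z v j) (lineSeq f w c z v (j + 1) s) s := by
  have h := (hf.hasDerivAt_line hj w z v (fun _ => v) hs).add_const (if j = 0 then c else 0)
  refine h.congr_deriv ?_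
  have : (Fin.cons v (fun _ => v) : Fin (j + 1) → E d) = fun _ => v := by
    funext i; refine Fin.cases ?_ ?_ i <;> simp
  simp [lineSeq, this]

theorem DerivBound.abs_lineSeq_le (hf : DerivBound l M f W) {j : ℕ} (hj : 1 ≤ j) (hjl : j ≤ l + 1)
    (w : E n) (c : ℝ) (z v : E d) {s : ℝ} (hs : z + s • v ∈ W) :
    |lineSeq f w c z v j s| ≤ ‖w‖ * M * ‖v‖ ^ j := by
  have := hf.abs_inner_le hj hjl w hs (fun _ => v) (v := ‖v‖ ^ j) (by simp)
  simpa [lineSeq, show j ≠ 0 by omega] using this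

theorem DerivBound.fderiv_inner_apply (hf : DerivBound l M f W) (w : E n) (c : ℝ) {z v : E d}
    {s : ℝ} (hs : z + s • v ∈ W) :
    fderiv ℝ (fun z => inner ℝ w (f z) + c) (z + s • v) v = lineSeq f w c z v 1 s := by
  rw [(hf.hasFDerivAt_inner w c hs).fderiv]
  simp [lineSeq]

/-- Along every segment inside `S`, the function `φ` and its derivatives in the direction of the
segment and in arbitrary directions are close to polynomials of degrees `l` and `l - 1`. -/
def LineApprox (l : ℕ) (κ D : ℝ) (S : Set (E d)) (φ : E d → ℝ) : Prop :=
  ∀ z ∈ S, ∀ v : E d, z + v ∈ S → ∃ p : Polynomial ℝ, p.natDegree ≤ l ∧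
    p.derivative.eval 0 = fderiv ℝ φ z v ∧
    (∀ s ∈ Set.Icc (0 : ℝ) 1, |φ (z + s • v) - p.eval s| ≤ κ * (‖v‖ / D) ∧
      |fderiv ℝ φ (z + s • v) v - p.derivative.eval s| ≤ κ * (‖v‖ / D)) ∧
    ∀ e : E d, ‖e‖ = 1 → ∃ q : Polynomial ℝ, q.natDegree ≤ l - 1 ∧
      ∀ s ∈ Set.Icc (0 : ℝ) 1, |fderiv ℝ φ (z + s • v) e - q.eval s| ≤ κ / D

/-- Taylor's formula along the segment. One factor ‖v‖ of the remainder is kept, so that in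
dimension one the error survives division by the length of the segment. -/
theorem DerivBound.lineApprox (hf : DerivBound l M f W) (hl : 1 ≤ l) {S : Set (E d)}
    (hS : Convex ℝ S) (hSW : S ⊆ W) {D : ℝ} (hD : 0 < D) (hdist : ∀ z ∈ S, ∀ z' ∈ S, dist z z' ≤ D)
    (w : E n) (c : ℝ) {κ : ℝ} (hκ : ‖w‖ * (M * D ^ (l + 1) / l.factorial) ≤ κ) :
    LineApprox l κ D S (fun z => inner ℝ w (f z) + c) := by
  intro z hz v hv
  have hvD : ‖v‖ ≤ D := by simpa [dist_eq_norm] using hdist z hz _ hv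
  have hseg : ∀ s ∈ Set.Icc (0 : ℝ) 1, z + s • v ∈ W := fun s hs => hSW <| by
    simpa using hS.add_smul_sub_mem hz hv hs
  have hM := hf.nonneg
  have hfac : (0 : ℝ) < l.factorial := by exact_mod_cast Nat.factorial_pos l
  have hwM : 0 ≤ ‖w‖ * M := by positivity
  set ψ := lineSeq f w c z v with hψ
  have hE : ‖w‖ * M * ‖v‖ ^ (l + 1) / l.factorial ≤ κ * (‖v‖ / D) := by
    calc ‖w‖ * M * ‖v‖ ^ (l + 1) / l.factorial
        = ‖w‖ * M * ‖v‖ ^ l * ‖v‖ / l.factorial := by ring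
      _ ≤ ‖w‖ * M * D ^ l * ‖v‖ / l.factorial := by gcongr
      _ = (‖w‖ * (M * D ^ (l + 1) / l.factorial)) * (‖v‖ / D) := by field_simp; ring
      _ ≤ _ := by gcongr
  refine ⟨taylorPoly ψ (l + 1), (natDegree_taylorPoly_le ψ (l + 1)).trans (by simp), ?_, ?_, ?_⟩
  · rw [derivative_taylorPoly, eval_taylorPoly_zero _ hl]
    have := hf.fderiv_inner_apply w c (z := z) (v := v) (s := 0) (hseg 0 ⟨le_rfl, zero_le_one⟩)
    rw [zero_smul, add_zero] at this
    exact this.symm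
  · intro s hs
    constructor
    · have := abs_sub_taylorPoly_le (l + 1) (ψ := ψ) (L := 1) (C := ‖w‖ * M * ‖v‖ ^ (l + 1))
        (fun i hi x hx => hf.hasDerivAt_lineSeq (by omega) w c z v (hseg x hx))
        (fun x hx => hf.abs_lineSeq_le (by omega) le_rfl w c z v (hseg x hx)) s hs
      rw [hψ, lineSeq_zero] at this
      refine this.trans (le_trans ?_ hE)
      have h1 : s ^ (l + 1) ≤ 1 := pow_le_one₀ hs.1 hs.2
      have h2 : (l.factorial : ℝ) ≤ (l + 1).factorial := by
        exact_mod_cast Nat.factorial_le (Nat.le_succ l)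
      calc ‖w‖ * M * ‖v‖ ^ (l + 1) * s ^ (l + 1) / (l + 1).factorial
          ≤ ‖w‖ * M * ‖v‖ ^ (l + 1) * 1 / l.factorial := by gcongr
        _ = _ := by rw [mul_one]
    · have := abs_sub_taylorPoly_le l (ψ := fun i => ψ (i + 1)) (L := 1)
        (C := ‖w‖ * M * ‖v‖ ^ (l + 1))
        (fun i hi x hx => hf.hasDerivAt_lineSeq (by omega) w c z v (hseg x hx))
        (fun x hx => hf.abs_lineSeq_le (by omega) le_rfl w c z v (hseg x hx)) s hs
      rw [derivative_taylorPoly, hf.fderiv_inner_apply w c (hseg s hs)]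
      refine this.trans (le_trans ?_ hE)
      have h1 : s ^ l ≤ 1 := pow_le_one₀ hs.1 hs.2
      calc ‖w‖ * M * ‖v‖ ^ (l + 1) * s ^ l / l.factorial
          ≤ ‖w‖ * M * ‖v‖ ^ (l + 1) * 1 / l.factorial := by gcongr
        _ = _ := by rw [mul_one]
  · intro e he
    -- The transverse direction e sits in the last slot, so that each derivative along the segment
    -- merely prepends a v.
    set m : ∀ j : ℕ, Fin (j + 1) → E d := fun j i => if i.val = j then e else v with hm
    have hcons : ∀ j, (Fin.cons v (m j) : Fin (j + 1 + 1) → E d) = m (j + 1) := by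
      intro j; funext i
      refine Fin.cases ?_ (fun i => ?_) i
      · simp [hm]
      · simp [hm]
    have hprod : ∏ i, ‖m l i‖ ≤ ‖v‖ ^ l := by
      rw [Fin.prod_univ_castSucc]
      simp only [hm, Fin.val_castSucc, Fin.val_last, if_true, he, mul_one]
      refine le_of_eq ?_
      rw [Finset.prod_congr rfl (g := fun _ => ‖v‖)]
      · simp
      · intro i _; rw [if_neg i.2.ne]
    set χ : ℕ → ℝ → ℝ := fun j s => inner ℝ w (iteratedFDeriv ℝ (j + 1) f (z + s • v) (m j)) with hχ
    refine ⟨taylorPoly χ l, natDegree_taylorPoly_le χ l, fun s hs => ?_⟩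
    have := abs_sub_taylorPoly_le l (ψ := χ) (L := 1) (C := ‖w‖ * M * ‖v‖ ^ l)
        (fun i hi x hx => by
          have := hf.hasDerivAt_line (j := i + 1) (by omega) w z v (m i) (hseg x hx)
          rw [hcons] at this
          exact this)
        (fun x hx => hf.abs_inner_le (by omega) le_rfl w (hseg x hx) _ hprod) s hs
    have h0 : fderiv ℝ (fun z => inner ℝ w (f z) + c) (z + s • v) e = χ 0 s := by
      rw [(hf.hasFDerivAt_inner w c (hseg s hs)).fderiv]
      simp [hχ, hm]
    rw [h0]
    refine this.trans ?_
    have h1 : s ^ l ≤ 1 := pow_le_one₀ hs.1 hs.2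
    have h2 : 0 ≤ s ^ l := pow_nonneg hs.1 l
    calc ‖w‖ * M * ‖v‖ ^ l * s ^ l / l.factorial
        ≤ ‖w‖ * M * D ^ l * 1 / l.factorial := by gcongr
      _ = (‖w‖ * (M * D ^ (l + 1) / l.factorial)) / D := by field_simp; ring
      _ ≤ κ / D := by gcongr

/-- A quantitative lower bound for the deviation of `⟪w, f⟫` from constants on a ball. -/
theorem DerivBound.le_of_abs_le (hf : DerivBound l M f W) {y : E d} {ρ s₁ : ℝ} (hρ : 0 < ρ)
    (hρ1 : ρ ≤ 1) (hyW : closedBall y ρ ⊆ W) (hs₁ : M * ρ ≤ s₁)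
    (hnd : ∀ v : E n, ‖v‖ = 1 → ∃ k : ℕ, 0 < k ∧ k ≤ l ∧ ∃ u : E d, ‖u‖ = 1 ∧
      s₁ ≤ |inner ℝ v (iteratedFDeriv ℝ k f y fun _ => u)|)
    (w : E n) (c : ℝ) {A : ℝ} (hA : ∀ z ∈ closedBall y ρ, |inner ℝ w (f z) + c| ≤ A) :
    (s₁ - M * ρ) * (ρ / l) ^ l * ‖w‖ ≤ A := by
  have hA0 : 0 ≤ A := (abs_nonneg _).trans (hA y (mem_closedBall_self hρ.le))
  rcases eq_or_ne w 0 with rfl | hw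
  · simpa using hA0
  have hwn : 0 < ‖w‖ := norm_pos_iff.2 hw
  set v := (‖w‖)⁻¹ • w with hv
  have hv1 : ‖v‖ = 1 := by rw [hv, norm_smul, norm_inv, norm_norm, inv_mul_cancel₀ hwn.ne']
  obtain ⟨k, hk0, hkl, u, hu, hku⟩ := hnd v hv1
  have hkR : (0 : ℝ) < k := by exact_mod_cast hk0
  have hklR : (k : ℝ) ≤ l := by exact_mod_cast hkl
  -- The sign σ turns the bound on the absolute value into a one-sided bound, which persists on the
  -- whole diameter because the next derivative is at most M.
  obtain ⟨σ, hσ, hσk⟩ : ∃ σ : ℝ, |σ| = 1 ∧ s₁ ≤ σ * inner ℝ v (iteratedFDeriv ℝ k f y fun _ => u) := by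
    rcases abs_cases (inner ℝ v (iteratedFDeriv ℝ k f y fun _ => u)) with h | h
    · exact ⟨1, by simp, by linarith [h.1]⟩
    · exact ⟨-1, by simp, by linarith [h.1]⟩
  set ψ := lineSeq f v ((‖w‖)⁻¹ * c) y u with hψ
  have hline : ∀ s : ℝ, |s| ≤ ρ → y + s • u ∈ closedBall y ρ := by
    intro s hs
    rw [mem_closedBall, dist_eq_norm, add_sub_cancel_left, norm_smul, hu, mul_one]
    exact hs
  have hint : ∀ s ∈ Set.Icc (-ρ) (-ρ + k * (2 * ρ / k)), |s| ≤ ρ := by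
    intro s hs
    rw [mul_div_cancel₀ _ hkR.ne'] at hs
    exact abs_le.2 ⟨hs.1, by linarith [hs.2]⟩
  have hlow : ∀ s, |s| ≤ ρ → s₁ - M * ρ ≤ σ * ψ k s := by
    intro s hs
    have hmv := (convex_closedBall (0 : ℝ) ρ).norm_image_sub_le_of_norm_hasDerivWithin_le
      (f := ψ k) (f' := ψ (k + 1)) (C := M) (x := 0) (y := s)
      (fun x hx => (hf.hasDerivAt_lineSeq hkl v _ y u
        (hyW (hline x (by simpa using hx)))).hasDerivWithinAt)
      (fun x hx => by
        have := hf.abs_lineSeq_le (j := k + 1) (by omega) (by omega) v ((‖w‖)⁻¹ * c) y u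
          (hyW (hline x (by simpa using hx)))
        simpa [hu, hv1] using this)
      (mem_closedBall_self hρ.le) (by simpa using hs)
    have h0 : ψ k 0 = inner ℝ v (iteratedFDeriv ℝ k f y fun _ => u) := by
      simp [hψ, lineSeq, hk0.ne']
    rw [Real.norm_eq_abs, sub_zero, Real.norm_eq_abs] at hmv
    have h1 : |σ * (ψ k s - ψ k 0)| ≤ M * ρ := by
      rw [abs_mul, hσ, one_mul]
      exact hmv.trans (by have := hf.nonneg; gcongr)
    have h2 := neg_le_of_abs_le h1
    rw [mul_sub, h0] at h2
    linarith
  -- With step 2ρ/k the k differences exactly fill [-ρ, ρ], and the factors 2^k on both sides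
  -- cancel.
  have hfd := finite_difference_le k (δ := 2 * ρ / k) (by positivity) (ψ := fun j s => σ * ψ j s)
    (a := -ρ) (c := s₁ - M * ρ) (A := A / ‖w‖)
    (fun i hi s hs => (hf.hasDerivAt_lineSeq (by omega) v _ y u
      (hyW (hline s (hint s hs)))).const_mul σ)
    (fun s hs => hlow s (hint s hs))
    (fun s hs => by
      have := hA _ (hline s (hint s hs))
      rw [abs_mul, hσ, one_mul, hψ, lineSeq_zero, hv, real_inner_smul_left, ← mul_add, abs_mul,
        abs_inv, abs_norm, inv_mul_eq_div]
      gcongr)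
  have h1 : (s₁ - M * ρ) * (ρ / k) ^ k ≤ A / ‖w‖ := by
    have h2k : (0 : ℝ) < 2 ^ k := by positivity
    rw [mul_div_assoc, mul_pow] at hfd
    nlinarith
  rw [le_div_iff₀ hwn] at h1
  refine le_trans ?_ h1
  have h2 : (ρ / l) ^ l ≤ (ρ / k) ^ k := by
    have hle : ρ / l ≤ ρ / k := by gcongr
    have h1' : ρ / k ≤ 1 := (div_le_one hkR).2 (hρ1.trans (by exact_mod_cast hk0))
    calc (ρ / l) ^ l ≤ (ρ / k) ^ l := by gcongr
      _ ≤ (ρ / k) ^ k := pow_le_pow_of_le_one (by positivity) h1' hkl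
  have h3 : 0 ≤ s₁ - M * ρ := by linarith
  gcongr

end SkewGood

/-! ### The skew gradient of a normalised pair -/

namespace SkewGood

variable {d n l : ℕ}

/-- The skew gradient of `(a, b)` as a linear functional. -/
noncomputable def skewForm (a b : E d → ℝ) (z : E d) : E d →L[ℝ] ℝ :=
  a z • fderiv ℝ b z - b z • fderiv ℝ a z

theorem skewForm_apply (a b : E d → ℝ) (z e : E d) :
    skewForm a b z e = a z * fderiv ℝ b z e - b z * fderiv ℝ a z e := by
  simp [skewForm]

theorem one_le_markovConst (hl : 1 ≤ l) : 1 ≤ markovConst l := by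
  have hlR : (1 : ℝ) ≤ l := by exact_mod_cast hl
  have hfac : (0 : ℝ) < l.factorial := by exact_mod_cast Nat.factorial_pos l
  have h1 : (l.factorial : ℝ) ≤ (2 * l) ^ l := by
    calc (l.factorial : ℝ) ≤ (l : ℝ) ^ l := by exact_mod_cast Nat.factorial_le_pow l
      _ ≤ _ := by gcongr; linarith
  have h2 : 1 ≤ (2 * (l : ℝ)) ^ l / l.factorial := (one_le_div hfac).2 h1
  rw [markovConst]
  nlinarith

/-- From a boundary point z the direction e may leave S at once. The Markov bound is therefore
applied on the segments from z to y ± ρe, and the two are subtracted. -/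
theorem LineApprox.norm_fderiv_le {κ ρ : ℝ} {S : Set (E d)} {φ : E d → ℝ} (hl : 1 ≤ l)
    (hρ : 0 < ρ) (hκ : 0 ≤ κ) (h : LineApprox l κ (4 * ρ) S φ)
    (hdist : ∀ z ∈ S, ∀ z' ∈ S, dist z z' ≤ 4 * ρ) {y : E d} (hy : closedBall y ρ ⊆ S)
    (hconv : Convex ℝ S) (hφ : ∀ z ∈ S, |φ z| ≤ 1) {z : E d} (hz : z ∈ S) :
    ‖fderiv ℝ φ z‖ ≤ markovConst l * (1 + κ) / ρ := by
  have hm := one_le_markovConst hl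
  have key : ∀ b ∈ S, |fderiv ℝ φ z (b - z)| ≤ (1 + κ) * markovConst l := by
    intro b hb
    obtain ⟨p, hp, hp0, hps, -⟩ := h z hz (b - z) (by simpa using hb)
    rw [← hp0]
    refine abs_eval_derivative_zero_le hl hp (by linarith) fun s hs => ?_
    have h1 := (hps s hs).1
    have h2 : z + s • (b - z) ∈ S := hconv.add_smul_sub_mem hz hb hs
    have h3 := hφ _ h2
    have h4 : κ * (‖b - z‖ / (4 * ρ)) ≤ κ := by
      refine mul_le_of_le_one_right hκ ((div_le_one (by positivity)).2 ?_)
      rw [← dist_eq_norm]; exact hdist b hb z hz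
    calc |p.eval s| = |φ (z + s • (b - z)) - (φ (z + s • (b - z)) - p.eval s)| := by ring_nf
      _ ≤ _ := (abs_sub _ _).trans (by linarith)
  refine ContinuousLinearMap.opNorm_le_of_unit_norm (by positivity) fun e he => ?_
  have hmem : ∀ σ : ℝ, |σ| ≤ ρ → y + σ • e ∈ S := fun σ hσ => hy <| by
    rw [mem_closedBall, dist_eq_norm, add_sub_cancel_left, norm_smul, he, mul_one]; exact hσ
  have h1 := key _ (hmem ρ (by rw [abs_of_pos hρ]))
  have h2 := key _ (hmem (-ρ) (by rw [abs_neg, abs_of_pos hρ]))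
  have h3 : fderiv ℝ φ z e * (2 * ρ)
      = fderiv ℝ φ z (y + ρ • e - z) - fderiv ℝ φ z (y + (-ρ) • e - z) := by
    rw [← map_sub]
    have : y + ρ • e - z - (y + (-ρ) • e - z) = (2 * ρ) • e := by module
    rw [this, map_smul, smul_eq_mul, mul_comm]
  have h4 : |fderiv ℝ φ z e| * (2 * ρ) ≤ 2 * ((1 + κ) * markovConst l) := by
    rw [← abs_of_pos (show 0 < 2 * ρ by positivity), ← abs_mul, h3]
    exact (abs_sub _ _).trans (by linarith)
  rw [Real.norm_eq_abs, le_div_iff₀ hρ]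
  linarith

/-- The growth constant in the lower bound for the skew gradient. -/
noncomputable def growthConst (l : ℕ) (Λ : ℝ) : ℝ := (16 * l * Λ) ^ l / l.factorial

theorem growthConst_pos (hl : 1 ≤ l) {Λ : ℝ} (hΛ : 0 < Λ) : 0 < growthConst l Λ := by
  have : (0 : ℝ) < l := by exact_mod_cast hl
  have hfac : (0 : ℝ) < l.factorial := by exact_mod_cast Nat.factorial_pos l
  rw [growthConst]
  positivity

/-- A pair of functions on a convex set `S`, normalised to be dual to two points of `S`, both
bounded by `1` and close to polynomials along segments. -/
structure NormalizedPair (l : ℕ) (κ ρ Λ : ℝ) (S : Set (E d)) (a b : E d → ℝ) : Prop where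
  hl : 1 ≤ l
  hρ : 0 < ρ
  hκ : 0 ≤ κ
  hκ1 : κ ≤ 1
  hΛ : 1 ≤ Λ
  convex : Convex ℝ S
  hdist : ∀ z ∈ S, ∀ z' ∈ S, dist z z' ≤ 4 * ρ
  diffa : ∀ z ∈ S, DifferentiableAt ℝ a z
  diffb : ∀ z ∈ S, DifferentiableAt ℝ b z
  approxa : LineApprox l κ (4 * ρ) S a
  approxb : LineApprox l κ (4 * ρ) S b
  lea : ∀ z ∈ S, |a z| ≤ 1
  leb : ∀ z ∈ S, |b z| ≤ 1
  dera : ∀ z ∈ S, ‖fderiv ℝ a z‖ ≤ Λ / ρ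
  derb : ∀ z ∈ S, ‖fderiv ℝ b z‖ ≤ Λ / ρ

/-- The skew gradient of a normalised pair is not small. -/
theorem NormalizedPair.le_of_norm_skewForm_le {κ ρ Λ : ℝ} {S : Set (E d)} {a b : E d → ℝ}
    (h : NormalizedPair l κ ρ Λ S a b) {x₁ x₂ : E d} (hx₁ : x₁ ∈ S) (hx₂ : x₂ ∈ S)
    (ha₁ : a x₁ = 1) (hb₁ : b x₁ = 0) (hb₂ : b x₂ = 1)
    (hκΓ : κ * (growthConst l Λ + 1) ≤ 1 / 2) {H : ℝ} (hH : ∀ z ∈ S, ‖skewForm a b z‖ ≤ H) :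
    Λ ≤ 4 * ρ * growthConst l Λ * H := by
  have hρ := h.hρ
  have hΛ := h.hΛ
  have hΛ0 : 0 < Λ := by linarith
  have hlR : (0 : ℝ) < l := by exact_mod_cast h.hl
  have hH0 : 0 ≤ H := (norm_nonneg _).trans (hH x₁ hx₁)
  set v := x₂ - x₁ with hv
  have hvD : ‖v‖ ≤ 4 * ρ := by rw [hv, ← dist_eq_norm]; exact h.hdist _ hx₂ _ hx₁
  have hxv : x₁ + v = x₂ := by rw [hv]; abel
  have hseg : ∀ s ∈ Set.Icc (0 : ℝ) 1, x₁ + s • v ∈ S := fun s hs =>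
    h.convex.add_smul_sub_mem hx₁ hx₂ hs
  -- Along the segment |a'| ≤ 4Λ, so a ≥ 1/2 up to parameter θ and b/a makes sense there.
  set θ := 1 / (8 * Λ) with hθ
  have hθ0 : 0 < θ := by positivity
  have hθ1 : θ ≤ 1 := by rw [hθ, div_le_one (by positivity)]; linarith
  have hsegθ : ∀ s ∈ Set.Icc (0 : ℝ) θ, x₁ + s • v ∈ S := fun s hs =>
    hseg s ⟨hs.1, hs.2.trans hθ1⟩
  have hline : ∀ s : ℝ, HasDerivAt (fun s : ℝ => x₁ + s • v) v s := fun s => by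
    simpa using ((hasDerivAt_id s).smul_const v).const_add x₁
  have hda : ∀ s ∈ Set.Icc (0 : ℝ) 1, HasDerivAt (fun s : ℝ => a (x₁ + s • v))
      (fderiv ℝ a (x₁ + s • v) v) s := fun s hs =>
    (h.diffa _ (hseg s hs)).hasFDerivAt.comp_hasDerivAt s (hline s)
  have hdb : ∀ s ∈ Set.Icc (0 : ℝ) 1, HasDerivAt (fun s : ℝ => b (x₁ + s • v))
      (fderiv ℝ b (x₁ + s • v) v) s := fun s hs =>
    (h.diffb _ (hseg s hs)).hasFDerivAt.comp_hasDerivAt s (hline s)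
  have hahalf : ∀ s ∈ Set.Icc (0 : ℝ) θ, 1 / 2 ≤ a (x₁ + s • v) := by
    intro s hs
    have := (convex_Icc (0 : ℝ) θ).norm_image_sub_le_of_norm_hasDerivWithin_le
      (f := fun s : ℝ => a (x₁ + s • v)) (C := 4 * Λ)
      (fun x hx => (hda x ⟨hx.1, hx.2.trans hθ1⟩).hasDerivWithinAt)
      (fun x hx => by
        refine (ContinuousLinearMap.le_opNorm _ _).trans ?_
        have h1 := h.dera _ (hsegθ x hx)
        calc _ ≤ Λ / ρ * (4 * ρ) := by gcongr
          _ = 4 * Λ := by field_simp)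
      (⟨le_rfl, hθ0.le⟩ : (0 : ℝ) ∈ Set.Icc 0 θ) hs
    rw [zero_smul, add_zero, ha₁, sub_zero, Real.norm_eq_abs, Real.norm_of_nonneg hs.1] at this
    have h2 : 4 * Λ * s ≤ 1 / 2 := by
      calc 4 * Λ * s ≤ 4 * Λ * θ := by gcongr; exact hs.2
        _ = 1 / 2 := by rw [hθ]; field_simp; norm_num
    linarith [neg_le_of_abs_le (this.trans h2)]
  have hbsmall : ∀ s ∈ Set.Icc (0 : ℝ) θ, |b (x₁ + s • v)| ≤ 16 * ρ * H * θ := by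
    intro s hs
    have hq : ∀ x ∈ Set.Icc (0 : ℝ) θ, HasDerivWithinAt
        (fun s : ℝ => b (x₁ + s • v) / a (x₁ + s • v))
        ((skewForm a b (x₁ + x • v) v) / a (x₁ + x • v) ^ 2) (Set.Icc 0 θ) x := by
      intro x hx
      have hx' : x ∈ Set.Icc (0 : ℝ) 1 := ⟨hx.1, hx.2.trans hθ1⟩
      have hane : a (x₁ + x • v) ≠ 0 := by have := hahalf x hx; linarith
      refine ((hdb x hx').div (hda x hx') hane).hasDerivWithinAt.congr_deriv ?_
      rw [skewForm_apply]; ring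
    have := (convex_Icc (0 : ℝ) θ).norm_image_sub_le_of_norm_hasDerivWithin_le
      (C := 16 * ρ * H) hq
      (fun x hx => by
        have h1 := hahalf x hx
        rw [norm_div, norm_pow, Real.norm_of_nonneg (by linarith : 0 ≤ a (x₁ + x • v)),
          div_le_iff₀ (by nlinarith)]
        have h2 : ‖skewForm a b (x₁ + x • v) v‖ ≤ H * (4 * ρ) :=
          (ContinuousLinearMap.le_opNorm _ _).trans (by gcongr; exact hH _ (hsegθ x hx))
        have h3 : 1 / 4 ≤ a (x₁ + x • v) ^ 2 := by nlinarith
        have h4 : 0 ≤ 16 * ρ * H := by positivity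
        nlinarith)
      (⟨le_rfl, hθ0.le⟩ : (0 : ℝ) ∈ Set.Icc 0 θ) hs
    simp only [zero_smul, add_zero, hb₁, zero_div, sub_zero, Real.norm_eq_abs, abs_div,
      abs_of_nonneg hs.1] at this
    have h1 := hahalf s hs
    have h2 := (le_abs_self _).trans (h.lea _ (hsegθ s hs))
    rw [abs_of_nonneg (by linarith : 0 ≤ a (x₁ + s • v)), div_le_iff₀ (by linarith)] at this
    calc _ ≤ 16 * ρ * H * s * a (x₁ + s • v) := this
      _ ≤ 16 * ρ * H * θ * 1 := by gcongr; exact hs.2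
      _ = _ := mul_one _
  obtain ⟨p, hp, -, hps, -⟩ := h.approxb x₁ hx₁ v (by rw [hxv]; exact hx₂)
  have hpe : ∀ s ∈ Set.Icc (0 : ℝ) 1, |b (x₁ + s • v) - p.eval s| ≤ κ := fun s hs =>
    ((hps s hs).1).trans (mul_le_of_le_one_right h.hκ ((div_le_one (by positivity)).2 hvD))
  have hκ := h.hκ
  -- Smallness of b on [0, θ] is extrapolated to parameter 1, where b = 1. The spacing θ/l produces
  -- exactly `growthConst`.
  have hext := abs_eval_le_of_separated hp (x := fun i => (i : ℝ) * (θ / l)) (h := θ / l)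
    (A := 16 * ρ * H * θ + κ) (L := 1) (y := 1) (by positivity) (by positivity) zero_le_one
    (fun i hi => by push_cast; linarith)
    (fun i hi => by
      have hi' : (i : ℝ) ≤ l := by exact_mod_cast hi
      have hs : (i : ℝ) * (θ / l) ∈ Set.Icc (0 : ℝ) θ := by
        refine ⟨by positivity, ?_⟩
        calc (i : ℝ) * (θ / l) ≤ l * (θ / l) := by gcongr
          _ = θ := by field_simp
      have h1 := hbsmall _ hs
      have h2 := hpe _ ⟨hs.1, hs.2.trans hθ1⟩
      set s := (i : ℝ) * (θ / l)
      calc |p.eval s| = |b (x₁ + s • v) - (b (x₁ + s • v) - p.eval s)| := by ring_nf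
        _ ≤ _ := (abs_sub _ _).trans (by linarith))
    (fun i hi => by
      have hi' : (i : ℝ) ≤ l := by exact_mod_cast hi
      have h1 : (i : ℝ) * (θ / l) ≤ 1 := by
        calc (i : ℝ) * (θ / l) ≤ l * (θ / l) := by gcongr
          _ = θ := by field_simp
          _ ≤ 1 := hθ1
      have h0 : 0 ≤ (i : ℝ) * (θ / l) := by positivity
      rw [abs_of_nonneg (by linarith)]; linarith)
  have hΓ : (2 * 1 / (θ / l)) ^ l / (l.factorial : ℝ) = growthConst l Λ := by
    rw [growthConst]; congr 2; rw [hθ]; field_simp; norm_num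
  rw [hΓ] at hext
  have hΓ0 := growthConst_pos h.hl hΛ0
  have h1 := hpe 1 ⟨zero_le_one, le_rfl⟩
  rw [one_smul, hxv, hb₂] at h1
  have h2 : 1 - κ ≤ |p.eval 1| := by
    have := (abs_le.1 h1).2
    exact le_trans (by linarith) (le_abs_self _)
  have h3 : 1 / 2 ≤ 16 * ρ * H * θ * growthConst l Λ := by nlinarith
  have h4 : 16 * ρ * H * θ * growthConst l Λ = (4 * ρ * growthConst l Λ * H) / (2 * Λ) := by
    rw [hθ]; field_simp; ring
  rw [h4, le_div_iff₀ (by positivity)] at h3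
  linarith

theorem abs_mul_sub_mul_le {a b p q α β A B : ℝ} (ha : |a| ≤ A) (hb : |b| ≤ B) (hp : |a - p| ≤ α)
    (hq : |b - q| ≤ β) : |a * b - p * q| ≤ A * β + (B + β) * α := by
  have h1 : a * b - p * q = a * (b - q) + q * (a - p) := by ring
  have h2 : |q| ≤ B + β := by
    calc |q| = |b - (b - q)| := by ring_nf
      _ ≤ _ := (abs_sub _ _).trans (by linarith)
  have hA := (abs_nonneg a).trans ha
  have hB := (abs_nonneg q).trans h2
  rw [h1]
  refine (abs_add_le _ _).trans ?_
  rw [abs_mul, abs_mul]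
  gcongr

/-- The degree of the polynomials approximating the skew gradient along segments. -/
def skewDegree (d l : ℕ) : ℕ := if d = 1 then 2 * l - 2 else 2 * l - 1

/-- The coefficients of degree 2l - 1 in pq' and qp' cancel. -/
theorem natDegree_wronskian_le (hl : 1 ≤ l) {p q : Polynomial ℝ} (hp : p.natDegree ≤ l)
    (hq : q.natDegree ≤ l) :
    (p * q.derivative - q * p.derivative).natDegree ≤ 2 * l - 2 := by
  have hp' : p.derivative.natDegree ≤ l - 1 :=
    (Polynomial.natDegree_derivative_le p).trans (by omega)
  have hq' : q.derivative.natDegree ≤ l - 1 :=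
    (Polynomial.natDegree_derivative_le q).trans (by omega)
  have h1 : (p * q.derivative - q * p.derivative).natDegree ≤ l + (l - 1) :=
    (Polynomial.natDegree_sub_le _ _).trans (max_le
      (Polynomial.natDegree_mul_le_of_le hp hq') (Polynomial.natDegree_mul_le_of_le hq hp'))
  have h2 : (p * q.derivative - q * p.derivative).coeff (l + (l - 1)) = 0 := by
    rw [Polynomial.coeff_sub, Polynomial.coeff_mul_add_eq_of_natDegree_le hp hq',
      Polynomial.coeff_mul_add_eq_of_natDegree_le hq hp', Polynomial.coeff_derivative,
      Polynomial.coeff_derivative, Nat.sub_add_cancel hl]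
    ring
  by_contra hcon
  have h3 : (p * q.derivative - q * p.derivative).natDegree = l + (l - 1) := by omega
  rw [← h3, Polynomial.coeff_natDegree, Polynomial.leadingCoeff_eq_zero] at h2
  rw [h2] at hcon
  simp at hcon

/-- For d > 1 the approximations of the functions (degree l) and of their derivatives in direction e
(degree l - 1) are multiplied. For d = 1 the direction e is parallel to the segment, so a Wronskian
appears and the degree drops by one. -/
theorem NormalizedPair.exists_polynomial {κ ρ Λ : ℝ} {S : Set (E d)} {a b : E d → ℝ}
    (h : NormalizedPair l κ ρ Λ S a b) {x v e : E d} (hx : x ∈ S) (hxv : x + v ∈ S)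
    (he : ‖e‖ = 1) :
    ∃ q : Polynomial ℝ, q.natDegree ≤ skewDegree d l ∧ ∀ s ∈ Set.Icc (0 : ℝ) 1,
      |skewForm a b (x + s • v) e - q.eval s| ≤ 12 * Λ * κ / (4 * ρ) := by
  have hρ := h.hρ
  have hκ := h.hκ
  have hκ1 := h.hκ1
  have hΛ := h.hΛ
  have hseg : ∀ s ∈ Set.Icc (0 : ℝ) 1, x + s • v ∈ S := fun s hs => by
    simpa using h.convex.add_smul_sub_mem hx hxv hs
  have hvD : ‖v‖ / (4 * ρ) ≤ 1 := by
    rw [div_le_one (by positivity)]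
    simpa [dist_eq_norm] using h.hdist _ hx _ hxv
  obtain ⟨p, hp, -, hps, hpe⟩ := h.approxa x hx v hxv
  obtain ⟨q, hq, -, hqs, hqe⟩ := h.approxb x hx v hxv
  have hval : ∀ {κ' t : ℝ}, κ' ≤ κ * t → t ≤ 1 → κ' ≤ κ := fun h1 h2 =>
    h1.trans (mul_le_of_le_one_right hκ h2)
  by_cases hd : d = 1
  · rw [skewDegree, if_pos hd]
    subst hd
    rcases eq_or_ne v 0 with rfl | hv
    · refine ⟨Polynomial.C (skewForm a b x e), by simp, fun s hs => ?_⟩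
      simp only [smul_zero, add_zero, Polynomial.eval_C, sub_self, abs_zero]
      positivity
    obtain ⟨c, hc⟩ : ∃ c : ℝ, v = c • e := by
      have hfin : Module.finrank ℝ (E 1) = 1 := by simp
      obtain ⟨c, hc⟩ := (finrank_eq_one_iff_of_nonzero' e (by
        rintro rfl; simp at he)).1 hfin v
      exact ⟨c, hc.symm⟩
    have hcv : |c| = ‖v‖ := by rw [hc, norm_smul, he, mul_one, Real.norm_eq_abs]
    have hvpos : 0 < ‖v‖ := norm_pos_iff.2 hv
    have hc0 : c ≠ 0 := by rintro rfl; simp [hc] at hv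
    refine ⟨Polynomial.C c⁻¹ * (p * q.derivative - q * p.derivative),
      (Polynomial.natDegree_C_mul_le _ _).trans (natDegree_wronskian_le h.hl hp hq),
      fun s hs => ?_⟩
    have hS := hseg s hs
    have hda : |fderiv ℝ a (x + s • v) v| ≤ 4 * Λ * (‖v‖ / (4 * ρ)) := by
      refine ((fderiv ℝ a (x + s • v)).le_opNorm v).trans ?_
      calc _ ≤ Λ / ρ * ‖v‖ := by gcongr; exact h.dera _ hS
        _ = _ := by field_simp
    have hdb : |fderiv ℝ b (x + s • v) v| ≤ 4 * Λ * (‖v‖ / (4 * ρ)) := by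
      refine ((fderiv ℝ b (x + s • v)).le_opNorm v).trans ?_
      calc _ ≤ Λ / ρ * ‖v‖ := by gcongr; exact h.derb _ hS
        _ = _ := by field_simp
    have e1 := abs_mul_sub_mul_le (h.lea _ hS) hdb (hval (hps s hs).1 hvD) (hqs s hs).2
    have e2 := abs_mul_sub_mul_le (h.leb _ hS) hda (hval (hqs s hs).1 hvD) (hps s hs).2
    have hform : skewForm a b (x + s • v) e = c⁻¹ * skewForm a b (x + s • v) v := by
      conv_rhs => rw [hc, map_smul, smul_eq_mul]
      rw [← mul_assoc, inv_mul_cancel₀ hc0, one_mul, ← hc]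
    rw [hform, Polynomial.eval_mul, Polynomial.eval_C, ← mul_sub, abs_mul, abs_inv, hcv,
      inv_mul_le_iff₀ hvpos, skewForm_apply, Polynomial.eval_sub, Polynomial.eval_mul,
      Polynomial.eval_mul]
    have e3 : ∀ α β γ δ : ℝ, (α - β) - (γ - δ) = (α - γ) - (β - δ) := by intros; ring
    rw [e3]
    refine (abs_sub _ _).trans ?_
    set t := ‖v‖ / (4 * ρ) with ht
    have ht0 : 0 ≤ t := by positivity
    have h5 : ‖v‖ * (12 * Λ * κ / (4 * ρ)) = 12 * Λ * κ * t := by rw [ht]; ring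
    rw [h5]
    have h6 : κ * t * κ ≤ Λ * κ * t := by
      have : 0 ≤ κ * t := by positivity
      nlinarith
    have h7 : κ * t ≤ Λ * κ * t := by
      have : 0 ≤ κ * t := by positivity
      nlinarith
    nlinarith
  · rw [skewDegree, if_neg hd]
    obtain ⟨p', hp', hps'⟩ := hpe e he
    obtain ⟨q', hq', hqs'⟩ := hqe e he
    have hl := h.hl
    refine ⟨p * q' - q * p', ?_, fun s hs => ?_⟩
    · refine (Polynomial.natDegree_sub_le _ _).trans (max_le ?_ ?_)
      · exact (Polynomial.natDegree_mul_le_of_le hp hq').trans (by omega)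
      · exact (Polynomial.natDegree_mul_le_of_le hq hp').trans (by omega)
    have hS := hseg s hs
    have hda : |fderiv ℝ a (x + s • v) e| ≤ 4 * Λ / (4 * ρ) := by
      refine ((fderiv ℝ a (x + s • v)).le_opNorm e).trans ?_
      rw [he, mul_one]
      refine (h.dera _ hS).trans (le_of_eq ?_)
      field_simp
    have hdb : |fderiv ℝ b (x + s • v) e| ≤ 4 * Λ / (4 * ρ) := by
      refine ((fderiv ℝ b (x + s • v)).le_opNorm e).trans ?_
      rw [he, mul_one]
      refine (h.derb _ hS).trans (le_of_eq ?_)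
      field_simp
    have e1 := abs_mul_sub_mul_le (h.lea _ hS) hdb (hval (hps s hs).1 hvD) (hqs' s hs)
    have e2 := abs_mul_sub_mul_le (h.leb _ hS) hda (hval (hqs s hs).1 hvD) (hps' s hs)
    rw [skewForm_apply, Polynomial.eval_sub, Polynomial.eval_mul, Polynomial.eval_mul]
    have e3 : ∀ α β γ δ : ℝ, (α - β) - (γ - δ) = (α - γ) - (β - δ) := by intros; ring
    rw [e3]
    refine (abs_sub _ _).trans ((add_le_add e1 e2).trans ?_)
    have h8 : 1 * (κ / (4 * ρ)) + (4 * Λ / (4 * ρ) + κ / (4 * ρ)) * κ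
        + (1 * (κ / (4 * ρ)) + (4 * Λ / (4 * ρ) + κ / (4 * ρ)) * κ)
        = (2 * κ + 8 * Λ * κ + 2 * κ * κ) / (4 * ρ) := by ring
    rw [h8]
    gcongr
    nlinarith

end SkewGood

/-! ### Small values at a fixed scale, and normalisation of a pair -/

namespace SkewGood

variable {d n l : ℕ}

theorem exists_unit_apply_eq_norm {ℓ : E d →L[ℝ] ℝ} (hℓ : ℓ ≠ 0) : ∃ e : E d, ‖e‖ = 1 ∧ ℓ e = ‖ℓ‖ := by
  set g := (InnerProductSpace.toDual ℝ (E d)).symm ℓ with hg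
  have hgn : ‖g‖ = ‖ℓ‖ := LinearIsometryEquiv.norm_map _ _
  have hpos : 0 < ‖ℓ‖ := norm_pos_iff.2 hℓ
  refine ⟨(‖g‖)⁻¹ • g, ?_, ?_⟩
  · rw [norm_smul, norm_inv, norm_norm, inv_mul_cancel₀ (by rw [hgn]; exact hpos.ne')]
  · have h1 : ℓ g = ‖g‖ ^ 2 := by
      rw [← real_inner_self_eq_norm_sq, hg, InnerProductSpace.toDual_symm_apply]
    rw [map_smul, smul_eq_mul, h1, hgn]
    field_simp

/-- For a point `x` of the closure of an open bounded convex set and a direction `ω`, the length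
of the ray from `x` inside the set. -/
theorem exists_ray_length {K : Set (E d)} (hK : Convex ℝ K) (hKo : IsOpen K) {R : ℝ}
    (hdist : ∀ z ∈ closure K, ∀ z' ∈ closure K, dist z z' ≤ R) {x ω : E d} (hx : x ∈ closure K)
    (hω : ‖ω‖ = 1) {t₀ : ℝ} (ht₀ : 0 < t₀) (hxt : x + t₀ • ω ∈ K) :
    ∃ L : ℝ, 0 < L ∧ x + L • ω ∈ closure K ∧ (∀ s, 0 < s → s < L → x + s • ω ∈ K) ∧
      ∀ s, 0 < s → x + s • ω ∈ K → s ≤ L := by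
  set T := {t : ℝ | 0 ≤ t ∧ x + t • ω ∈ closure K} with hT
  have hcont : Continuous fun t : ℝ => x + t • ω := by fun_prop
  have hTc : IsClosed T := isClosed_Ici.inter (isClosed_closure.preimage hcont)
  have hTb : BddAbove T := ⟨R, fun t ht => by
    have := hdist _ ht.2 _ hx
    rwa [dist_eq_norm, add_sub_cancel_left, norm_smul, hω, mul_one, Real.norm_of_nonneg ht.1] at this⟩
  have htT : t₀ ∈ T := ⟨ht₀.le, subset_closure hxt⟩
  have hL := hTc.csSup_mem ⟨t₀, htT⟩ hTb
  have ht₀L := le_csSup hTb htT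
  refine ⟨sSup T, lt_of_lt_of_le ht₀ ht₀L, hL.2, fun s hs hsL => ?_, fun s hs hsK =>
    le_csSup hTb ⟨hs.le, subset_closure hsK⟩⟩
  have hint : x + t₀ • ω ∈ interior K := by rwa [hKo.interior_eq]
  rcases lt_trichotomy s t₀ with h | h | h
  · have := hK.openSegment_closure_interior_subset_interior hx hint
      (⟨1 - s / t₀, s / t₀, by rw [sub_pos, div_lt_one ht₀]; exact h, by positivity, by ring, by
        have : s / t₀ * t₀ = s := by field_simp
        rw [smul_add, smul_smul, this, ← add_assoc, ← add_smul]
        simp⟩ : x + s • ω ∈ openSegment ℝ x (x + t₀ • ω))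
    exact interior_subset this
  · rw [h]; exact hxt
  · have hlt : 0 < sSup T - t₀ := by linarith
    have := hK.openSegment_interior_closure_subset_interior hint hL.2
      (⟨(sSup T - s) / (sSup T - t₀), (s - t₀) / (sSup T - t₀), by
        apply div_pos <;> linarith, by apply div_pos <;> linarith, by
        field_simp; ring, by
        rw [smul_add, smul_add, smul_smul, smul_smul]
        have e1 : (sSup T - s) / (sSup T - t₀) + (s - t₀) / (sSup T - t₀) = 1 := by
          field_simp; ring
        have e2 : (sSup T - s) / (sSup T - t₀) * t₀ + (s - t₀) / (sSup T - t₀) * sSup T = s := by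
          field_simp; ring
        calc _ = ((sSup T - s) / (sSup T - t₀) + (s - t₀) / (sSup T - t₀)) • x
              + ((sSup T - s) / (sSup T - t₀) * t₀ + (s - t₀) / (sSup T - t₀) * sSup T) • ω := by
              module
          _ = _ := by rw [e1, e2, one_smul]⟩ :
        x + s • ω ∈ openSegment ℝ (x + t₀ • ω) (x + sSup T • ω))
    exact interior_subset this

variable {κ ρ Λ : ℝ} {S K : Set (E d)} {a b : E d → ℝ}

/-- The normalising conditions at the two dual points. -/
structure DualPoints (a b : E d → ℝ) (S : Set (E d)) (x₁ x₂ : E d) : Prop where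
  mem₁ : x₁ ∈ S
  mem₂ : x₂ ∈ S
  a₁ : a x₁ = 1
  b₁ : b x₁ = 0
  b₂ : b x₂ = 1

/-- The absolute error becomes relative to H because the skew gradient of a normalised pair is
bounded below in terms of Λ/ρ. -/
theorem NormalizedPair.exists_polynomial_rel (h : NormalizedPair l κ ρ Λ S a b) {x₁ x₂ : E d}
    (hp : DualPoints a b S x₁ x₂) (hκΓ : κ * (growthConst l Λ + 1) ≤ 1 / 2) {H : ℝ}
    (hH : ∀ z ∈ S, ‖skewForm a b z‖ ≤ H) {x v e : E d} (hx : x ∈ S) (hxv : x + v ∈ S)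
    (he : ‖e‖ = 1) :
    ∃ q : Polynomial ℝ, q.natDegree ≤ skewDegree d l ∧ ∀ s ∈ Set.Icc (0 : ℝ) 1,
      |skewForm a b (x + s • v) e - q.eval s| ≤ 12 * κ * growthConst l Λ * H := by
  obtain ⟨q, hq, hqs⟩ := h.exists_polynomial hx hxv he
  refine ⟨q, hq, fun s hs => (hqs s hs).trans ?_⟩
  have hρ := h.hρ
  have hκ := h.hκ
  have := h.le_of_norm_skewForm_le hp.mem₁ hp.mem₂ hp.a₁ hp.b₁ hp.b₂ hκΓ hH
  rw [div_le_iff₀ (by positivity)]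
  calc 12 * Λ * κ ≤ 12 * (4 * ρ * growthConst l Λ * H) * κ := by gcongr
    _ = _ := by ring

theorem NormalizedPair.pos_of_norm_skewForm_le (h : NormalizedPair l κ ρ Λ S a b) {x₁ x₂ : E d}
    (hp : DualPoints a b S x₁ x₂) (hκΓ : κ * (growthConst l Λ + 1) ≤ 1 / 2) {H : ℝ}
    (hH : ∀ z ∈ S, ‖skewForm a b z‖ ≤ H) : 0 < H := by
  have hρ := h.hρ
  have hΛ := h.hΛ
  have := h.le_of_norm_skewForm_le hp.mem₁ hp.mem₂ hp.a₁ hp.b₁ hp.b₂ hκΓ hH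
  have hΓ := growthConst_pos h.hl (show 0 < Λ by linarith)
  have h4 : 0 < 4 * ρ * growthConst l Λ := by positivity
  by_contra hcon
  rw [not_lt] at hcon
  nlinarith

/-- Remez on each ray from the maximum point x, for the component along the fixed direction e in
which the maximum is attained. One component suffices, since it is bounded by the norm at the other
points. -/
theorem NormalizedPair.volume_le (hd : 1 ≤ d) (hK : Convex ℝ K) (hKo : IsOpen K)
    (h : NormalizedPair l κ ρ Λ (closure K) a b) {x₁ x₂ : E d}
    (hp : DualPoints a b (closure K) x₁ x₂) (hκΓ : κ * (growthConst l Λ + 1) ≤ 1 / 2)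
    (hcont : ContinuousOn (skewForm a b) (closure K)) {x : E d} (hx : x ∈ closure K)
    (hxmax : ∀ z ∈ closure K, ‖skewForm a b z‖ ≤ ‖skewForm a b x‖) (hk : 1 ≤ skewDegree d l)
    {ε : ℝ} (hε : 0 < ε) (hε1 : ε ≤ 1) (hεκ : 1200 * κ * growthConst l Λ ≤ ε) :
    volume {z | z ∈ K ∧ ‖skewForm a b z‖ < ε * ‖skewForm a b x‖}
      ≤ ENNReal.ofReal (d * (skewDegree d l * (2.06 * ε) ^ (1 / (skewDegree d l : ℝ))))
        * volume K := by
  set H := ‖skewForm a b x‖ with hH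
  have hH0 : 0 < H := h.pos_of_norm_skewForm_le hp hκΓ hxmax
  obtain ⟨e, he, hxe⟩ := exists_unit_apply_eq_norm (norm_pos_iff.1 hH0)
  have hopen : IsOpen {z | z ∈ K ∧ ‖skewForm a b z‖ < ε * H} := by
    have := (hcont.mono subset_closure).norm.isOpen_inter_preimage hKo (isOpen_Iio (a := ε * H))
    exact this
  refine volume_le_of_rays hd hKo.measurableSet hopen.measurableSet (fun z hz => hz.1) x
    (by positivity) fun ω hω => ?_
  by_cases hray : ∃ t₀ : ℝ, 0 < t₀ ∧ x + t₀ • ω ∈ K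
  · obtain ⟨t₀, ht₀, hxt⟩ := hray
    obtain ⟨L, hL, hLK, hL1, hL2⟩ := exists_ray_length hK hKo h.hdist hx hω ht₀ hxt
    refine ⟨L, hL.le, hL1, hL2, ?_⟩
    obtain ⟨q, hq, hqs⟩ := h.exists_polynomial_rel hp hκΓ hxmax hx hLK he
    set κ' := 12 * κ * growthConst l Λ with hκ'
    have hκε : 100 * κ' ≤ ε := by rw [hκ']; linarith
    set q' := q.comp (Polynomial.C (1 / L) * Polynomial.X) with hq'
    have hq'e : ∀ t, q'.eval t = q.eval (t / L) := by
      intro t; simp [hq', Polynomial.eval_comp]; ring_nf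
    have hq'd : q'.natDegree ≤ skewDegree d l := by
      rw [hq']
      refine Polynomial.natDegree_comp_le.trans ?_
      have h1 : (Polynomial.C (1 / L) * Polynomial.X).natDegree ≤ 1 :=
        (Polynomial.natDegree_C_mul_le _ _).trans Polynomial.natDegree_X_le
      calc _ ≤ q.natDegree * 1 := Nat.mul_le_mul_left _ h1
        _ ≤ _ := by rw [mul_one]; exact hq
    have hq0 : 0.99 * H ≤ |q'.eval 0| := by
      have := hqs 0 ⟨le_rfl, zero_le_one⟩
      rw [zero_smul, add_zero, hxe] at this
      rw [hq'e, zero_div]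
      have h1 := (abs_le.1 this).2
      have h2 := le_abs_self (q.eval 0)
      have h3 : ‖skewForm a b x‖ = H := rfl
      rw [h3] at h1
      have : κ' * H ≤ 0.01 * H := by gcongr; linarith
      linarith
    -- The approximating polynomial is at least 0.99 H at x and at most 1.01 εH on the small set,
    -- and 1.01 ≤ 1.03 · 0.99.
    have hR := volume_le_of_abs_eval_le hk hq'd (L := L) (δ := 1.03 * ε)
      (E := {s : ℝ | 0 < s ∧ x + s • ω ∈ {z | z ∈ K ∧ ‖skewForm a b z‖ < ε * H}}) hL.le
      (fun t ht => ⟨ht.1.le, hL2 t ht.1 ht.2.1⟩) (by positivity)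
      (by intro h0; rw [h0, abs_zero] at hq0; linarith)
      (fun t ht => by
        have htL := hL2 t ht.1 ht.2.1
        have := hqs (t / L) ⟨div_nonneg ht.1.le hL.le, (div_le_one hL).2 htL⟩
        have hts : (t / L) • L • ω = t • ω := by rw [smul_smul]; congr 1; field_simp
        rw [hts] at this
        have h1 : |skewForm a b (x + t • ω) e| ≤ ε * H := by
          have := (skewForm a b (x + t • ω)).le_opNorm e
          rw [he, mul_one] at this
          exact this.trans ht.2.2.le
        rw [hq'e]
        have h2 : |q.eval (t / L)| ≤ ε * H + κ' * H := by
          calc |q.eval (t / L)| = |skewForm a b (x + t • ω) e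
                - (skewForm a b (x + t • ω) e - q.eval (t / L))| := by ring_nf
            _ ≤ _ := (abs_sub _ _).trans (by linarith)
        have h3 : κ' * H ≤ 0.01 * ε * H := by gcongr; linarith
        have h4 : 1.03 * ε * (0.99 * H) ≤ 1.03 * ε * |q'.eval 0| := by gcongr
        have h5 : 0 < ε * H := by positivity
        linarith)
    refine hR.trans (le_of_eq ?_)
    rw [show (2 : ℝ) * (1.03 * ε) = 2.06 * ε by ring, mul_assoc]
  · push Not at hray
    refine ⟨0, le_rfl, fun s h1 h2 => absurd h1 (not_lt.2 h2.le), fun s h1 h2 =>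
      absurd h2 (hray s h1), ?_⟩
    rw [mul_zero, ENNReal.ofReal_zero, nonpos_iff_eq_zero]
    convert measure_empty (μ := (volume : Measure ℝ))
    ext s
    simp only [Set.mem_ofPred_eq, Set.mem_empty_iff_false, iff_false]
    exact fun hs => hray s hs.1 hs.2.1

/-- The approximating polynomial on the segment from x to z is constant, so the values at its ends
differ by at most twice the error. -/
theorem NormalizedPair.le_norm_of_degree_zero (h : NormalizedPair l κ ρ Λ S a b) {x₁ x₂ : E d}
    (hp : DualPoints a b S x₁ x₂) (hκΓ : κ * (growthConst l Λ + 1) ≤ 1 / 2)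
    {x : E d} (hx : x ∈ S) (hxmax : ∀ z ∈ S, ‖skewForm a b z‖ ≤ ‖skewForm a b x‖)
    (hk : skewDegree d l = 0) {z : E d} (hz : z ∈ S) :
    (1 - 24 * κ * growthConst l Λ) * ‖skewForm a b x‖ ≤ ‖skewForm a b z‖ := by
  set H := ‖skewForm a b x‖ with hH
  have hH0 : 0 < H := h.pos_of_norm_skewForm_le hp hκΓ hxmax
  obtain ⟨e, he, hxe⟩ := exists_unit_apply_eq_norm (norm_pos_iff.1 hH0)
  obtain ⟨q, hq, hqs⟩ := h.exists_polynomial_rel hp hκΓ hxmax hx (v := z - x) (by simpa using hz) he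
  rw [hk, Nat.le_zero] at hq
  have h0 := hqs 0 ⟨le_rfl, zero_le_one⟩
  have h1 := hqs 1 ⟨zero_le_one, le_rfl⟩
  rw [Polynomial.eq_C_of_natDegree_eq_zero hq, Polynomial.eval_C] at h0 h1
  rw [zero_smul, add_zero, hxe] at h0
  rw [one_smul, add_sub_cancel] at h1
  have h2 := (skewForm a b z).le_opNorm e
  rw [he, mul_one] at h2
  have h3 := (le_abs_self _).trans h2
  have h4 := (abs_le.1 h0).2
  have h5 := (abs_le.1 h1).1
  have h6 : ‖skewForm a b x‖ = H := rfl
  rw [h6] at h4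
  linarith

variable {M : ℝ} {f : E d → E n} {W : Set (E d)}

theorem DerivBound.continuousOn_skewForm (hf : DerivBound l M f W) (hl : 1 ≤ l) (u₁ u₂ : E n)
    (c₁ c₂ : ℝ) :
    ContinuousOn (skewForm (fun z => inner ℝ u₁ (f z) + c₁) fun z => inner ℝ u₂ (f z) + c₂) W := by
  intro x hx
  have h2 : ∀ (w : E n) (c : ℝ), ContDiffAt ℝ ((l + 1 : ℕ) : WithTop ℕ∞)
      (fun z => inner ℝ w (f z) + c) x := fun w c =>
    (contDiffAt_const.inner ℝ (hf.contDiffAt x hx)).add contDiffAt_const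
  have h3 : ∀ (w : E n) (c : ℝ), ContinuousAt (fderiv ℝ (fun z => inner ℝ w (f z) + c)) x :=
    fun w c => ((h2 w c).fderiv_right (m := 0) (by
      norm_cast; omega)).continuousAt
  exact (((h2 u₁ c₁).continuousAt.smul (h3 u₂ c₂)).sub
    ((h2 u₂ c₂).continuousAt.smul (h3 u₁ c₁))).continuousWithinAt

/-- Normalisation of a pair of functions by a linear change of coordinates. -/
theorem DerivBound.exists_normalizedPair (hf : DerivBound l M f W) (hl : 1 ≤ l) (hK : Convex ℝ K)
    (hKo : IsOpen K) (hKW : closure K ⊆ W) {y : E d} {s₁ ω : ℝ} (hρ : 0 < ρ) (hρ1 : ρ ≤ 1)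
    (hy : closedBall y ρ ⊆ closure K)
    (hdist : ∀ z ∈ closure K, ∀ z' ∈ closure K, dist z z' ≤ 4 * ρ) (hs₁ : M * ρ ≤ s₁)
    (hnd : ∀ v : E n, ‖v‖ = 1 → ∃ k : ℕ, 0 < k ∧ k ≤ l ∧ ∃ u : E d, ‖u‖ = 1 ∧
      s₁ ≤ |inner ℝ v (iteratedFDeriv ℝ k f y fun _ => u)|)
    (hω : 0 < ω) (hωs : ω ≤ (s₁ - M * ρ) * (ρ / l) ^ l)
    (hκ : M * (4 * ρ) ^ (l + 1) / l.factorial / ω ≤ κ) (hκ1 : κ ≤ 1)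
    (hΛ : markovConst l * (1 + κ) ≤ Λ) {u₁ u₂ : E n} {c₁ c₂ : ℝ}
    (hex : ∃ z ∈ K, skewForm (fun z => inner ℝ u₁ (f z) + c₁)
      (fun z => inner ℝ u₂ (f z) + c₂) z ≠ 0) :
    ∃ (a b : E d → ℝ) (Φ : ℝ) (x₁ x₂ : E d), 0 < Φ ∧ NormalizedPair l κ ρ Λ (closure K) a b ∧
      DualPoints a b (closure K) x₁ x₂ ∧ ContinuousOn (skewForm a b) (closure K) ∧
      ∀ z ∈ closure K, ‖skewForm (fun z => inner ℝ u₁ (f z) + c₁)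
        (fun z => inner ℝ u₂ (f z) + c₂) z‖ = Φ * ‖skewForm a b z‖ := by
  set g₁ : E d → ℝ := fun z => inner ℝ u₁ (f z) + c₁ with hg₁
  set g₂ : E d → ℝ := fun z => inner ℝ u₂ (f z) + c₂ with hg₂
  set S := closure K with hS
  have hM := hf.nonneg
  have hfac : (0 : ℝ) < l.factorial := by exact_mod_cast Nat.factorial_pos l
  have hκ0 : 0 ≤ κ := le_trans (by positivity) hκ
  have hSc : Convex ℝ S := hK.closure
  have hScomp : IsCompact S := by
    refine Metric.isCompact_of_isClosed_isBounded isClosed_closure ?_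
    exact Metric.isBounded_iff.2 ⟨4 * ρ, fun z hz z' hz' => hdist z hz z' hz'⟩
  have hD : ∀ (w : E n) (c : ℝ), ∀ z ∈ S,
      HasFDerivAt (fun z => inner ℝ w (f z) + c) ((innerSL ℝ w).comp (fderiv ℝ f z)) z :=
    fun w c z hz => hf.hasFDerivAt_inner w c (hKW hz)
  have hdiff : ∀ (w : E n) (c : ℝ), ∀ z ∈ S, DifferentiableAt ℝ (fun z => inner ℝ w (f z) + c) z :=
    fun w c z hz => (hD w c z hz).differentiableAt
  have hcg : ∀ (w : E n) (c : ℝ), ContinuousOn (fun z => inner ℝ w (f z) + c) S :=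
    fun w c z hz => (hdiff w c z hz).continuousAt.continuousWithinAt
  set F : E d × E d → ℝ := fun p => g₁ p.1 * g₂ p.2 - g₂ p.1 * g₁ p.2 with hF
  have hFc : ContinuousOn F (S ×ˢ S) := by
    have e1 : Set.MapsTo (Prod.fst : E d × E d → E d) (S ×ˢ S) S := fun p hp => hp.1
    have e2 : Set.MapsTo (Prod.snd : E d × E d → E d) (S ×ˢ S) S := fun p hp => hp.2
    exact (((hcg u₁ c₁).comp continuousOn_fst e1).mul ((hcg u₂ c₂).comp continuousOn_snd e2)).sub
      (((hcg u₂ c₂).comp continuousOn_fst e1).mul ((hcg u₁ c₁).comp continuousOn_snd e2))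
  have hyS : y ∈ S := hy (mem_closedBall_self hρ.le)
  -- Maximising the determinant |F| makes the dual functions F(·, x₂)/Δ and F(x₁, ·)/Δ bounded by 1.
  obtain ⟨⟨x₁, x₂⟩, ⟨hx₁, hx₂⟩, hmax⟩ := (hScomp.prod hScomp).exists_isMaxOn
    ⟨(y, y), hyS, hyS⟩ hFc.norm
  simp only at hx₁ hx₂
  have hmax' : ∀ z ∈ S, ∀ z' ∈ S, |F (z, z')| ≤ |F (x₁, x₂)| := fun z hz z' hz' => by
    simpa using hmax (⟨hz, hz'⟩ : (z, z') ∈ S ×ˢ S)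
  set Δ := F (x₁, x₂) with hΔ
  have hΔ0 : Δ ≠ 0 := by
    intro h0
    obtain ⟨z, hz, hne⟩ := hex
    have hzS : z ∈ S := subset_closure hz
    apply hne
    -- The skew gradient at z is the derivative of F(z, ·) at z, so it vanishes if F does.
    have hzero : (fun z' => g₁ z * g₂ z' - g₂ z * g₁ z') =ᶠ[nhds z] fun _ => 0 := by
      filter_upwards [hKo.mem_nhds hz] with z' hz'
      have := hmax' z hzS z' (subset_closure hz')
      rw [h0, abs_zero] at this
      exact abs_eq_zero.1 (le_antisymm this (abs_nonneg _))
    have h1 : HasFDerivAt (fun z' => g₁ z * g₂ z' - g₂ z * g₁ z') (skewForm g₁ g₂ z) z :=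
      ((hdiff u₂ c₂ z hzS).hasFDerivAt.const_mul (g₁ z)).sub
        ((hdiff u₁ c₁ z hzS).hasFDerivAt.const_mul (g₂ z))
    rw [← h1.fderiv, hzero.fderiv_eq, fderiv_const_apply]
  have hΔpos : 0 < |Δ| := abs_pos.2 hΔ0
  set wa : E n := (g₂ x₂ / Δ) • u₁ - (g₁ x₂ / Δ) • u₂ with hwa
  set ca : ℝ := g₂ x₂ / Δ * c₁ - g₁ x₂ / Δ * c₂ with hca
  set wb : E n := (g₁ x₁ / Δ) • u₂ - (g₂ x₁ / Δ) • u₁ with hwb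
  set cb : ℝ := g₁ x₁ / Δ * c₂ - g₂ x₁ / Δ * c₁ with hcb
  set a : E d → ℝ := fun z => inner ℝ wa (f z) + ca with ha
  set b : E d → ℝ := fun z => inner ℝ wb (f z) + cb with hb
  have haF : ∀ z, a z = F (z, x₂) / Δ := by
    intro z
    simp only [ha, hwa, hca, hF, hg₁, hg₂, inner_sub_left, real_inner_smul_left]
    field_simp
    ring
  have hbF : ∀ z, b z = F (x₁, z) / Δ := by
    intro z
    simp only [hb, hwb, hcb, hF, hg₁, hg₂, inner_sub_left, real_inner_smul_left]
    field_simp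
    ring
  have hale : ∀ z ∈ S, |a z| ≤ 1 := fun z hz => by
    rw [haF, abs_div, div_le_one hΔpos]; exact hmax' z hz x₂ hx₂
  have hble : ∀ z ∈ S, |b z| ≤ 1 := fun z hz => by
    rw [hbF, abs_div, div_le_one hΔpos]; exact hmax' x₁ hx₁ z hz
  have happ : ∀ (w : E n) (c : ℝ), (∀ z ∈ S, |inner ℝ w (f z) + c| ≤ 1) →
      LineApprox l κ (4 * ρ) S (fun z => inner ℝ w (f z) + c) := by
    intro w c hwc
    refine hf.lineApprox hl hSc hKW (by positivity) hdist w c ?_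
    have h1 := hf.le_of_abs_le hρ hρ1 (hy.trans hKW) hs₁ hnd w c (A := 1) fun z hz => hwc z (hy hz)
    have h2 : ω * ‖w‖ ≤ 1 := le_trans (by gcongr) h1
    have h3 : ‖w‖ ≤ 1 / ω := by rw [le_div_iff₀ hω]; linarith
    calc ‖w‖ * (M * (4 * ρ) ^ (l + 1) / l.factorial)
        ≤ 1 / ω * (M * (4 * ρ) ^ (l + 1) / l.factorial) := by gcongr
      _ = M * (4 * ρ) ^ (l + 1) / l.factorial / ω := by ring
      _ ≤ κ := hκ
  have haa := happ wa ca hale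
  have hbb := happ wb cb hble
  have hder : ∀ {φ : E d → ℝ}, LineApprox l κ (4 * ρ) S φ → (∀ z ∈ S, |φ z| ≤ 1) → ∀ z ∈ S,
      ‖fderiv ℝ φ z‖ ≤ Λ / ρ := fun h1 h2 z hz =>
    (h1.norm_fderiv_le hl hρ hκ0 hdist hy hSc h2 hz).trans (by gcongr)
  have hm := one_le_markovConst hl
  refine ⟨a, b, |Δ|, x₁, x₂, hΔpos, ⟨hl, hρ, hκ0, hκ1, by nlinarith, hSc, hdist, hdiff wa ca,
    hdiff wb cb, haa, hbb, hale, hble, hder haa hale, hder hbb hble⟩,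
    ⟨hx₁, hx₂, ?_, ?_, ?_⟩, (hf.continuousOn_skewForm hl wa wb ca cb).mono hKW, ?_⟩
  · rw [haF]; exact div_self hΔ0
  · rw [hbF]; simp only [hF]; rw [mul_comm, sub_self, zero_div]
  · rw [hbF]; exact div_self hΔ0
  · intro z hz
    -- The skew form is multiplied by the determinant of a change of basis, which is 1/Δ from (g₁,
    -- g₂) to (a, b).
    have h1 : skewForm g₁ g₂ z = Δ • skewForm a b z := by
      ext e
      rw [smul_apply, skewForm_apply, skewForm_apply, haF, hbF, ha, hb, hg₁,
        hg₂, (hD u₁ c₁ z hz).fderiv, (hD u₂ c₂ z hz).fderiv, (hD wa ca z hz).fderiv,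
        (hD wb cb z hz).fderiv]
      simp only [hwa, hwb, ContinuousLinearMap.comp_apply, innerSL_apply_apply, inner_sub_left,
        real_inner_smul_left, smul_eq_mul]
      have hΔ' : Δ = g₁ x₁ * g₂ x₂ - g₂ x₁ * g₁ x₂ := rfl
      simp only [hF]
      have e1 : ∀ α : ℝ, α = Δ * (α / Δ) := fun α => by field_simp
      field_simp
      rw [hΔ']
      simp only [hg₁, hg₂]
      ring
    rw [h1, norm_smul, Real.norm_eq_abs]

end SkewGood

/-! ### Numerical constants -/

namespace SkewGood

theorem ballVol_pos (d : ℕ) : 0 < ballVol d := by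
  rw [ballVol]
  have := Real.Gamma_pos_of_pos (s := 1 + (d : ℝ) / 2) (by positivity)
  positivity

/-- The unit ball lies in a cube of side 2. Analytically, V_{d+2} = V_d π/(1 + d/2) ≤ 4 V_d. -/
theorem ballVol_le (d : ℕ) : ballVol d ≤ 2 ^ d := by
  induction d using Nat.strong_induction_on with
  | _ d ih =>
    match d with
    | 0 => simp [ballVol]
    | 1 =>
      rw [ballVol, Nat.cast_one, add_comm (1 : ℝ), Real.Gamma_add_one (by norm_num),
        Real.Gamma_one_half_eq, ← Real.sqrt_eq_rpow]
      have : 0 < √Real.pi := Real.sqrt_pos.2 Real.pi_pos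
      rw [div_le_iff₀ (by positivity)]
      linarith
    | d + 2 =>
      have h1 : ballVol (d + 2) = ballVol d * (Real.pi / (1 + d / 2)) := by
        have hd : (0 : ℝ) < 1 + d / 2 := by positivity
        have hG := (Real.Gamma_pos_of_pos hd).ne'
        have e1 : (1 : ℝ) + ((d + 2 : ℕ) : ℝ) / 2 = (1 + d / 2) + 1 := by push_cast; ring
        have e2 : (((d + 2 : ℕ) : ℝ) / 2) = d / 2 + 1 := by push_cast; ring
        rw [ballVol, ballVol, e1, e2, Real.Gamma_add_one hd.ne', Real.rpow_add Real.pi_pos,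
          Real.rpow_one]
        field_simp
      have h2 : Real.pi / (1 + d / 2) ≤ 4 := by
        rw [div_le_iff₀ (by positivity)]
        have : (0 : ℝ) ≤ d := by positivity
        linarith [Real.pi_lt_four]
      rw [h1, pow_add]
      have := ih d (by omega)
      have := ballVol_pos d
      nlinarith [Real.pi_pos]

/-- The reciprocal of the base of the power in the definition of `eta`. -/
noncomputable def etaBase (d l : ℕ) : ℝ := 5 ^ d * (2 * goodConst d l)

theorem eta_eq (d l : ℕ) :
    eta d l = min (1 / 16) ((1 / etaBase d l) ^ (d * (2 * l - 1) * (2 * l - 2))) := by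
  rw [eta, etaBase, goodConst]
  congr 2
  have := (ballVol_pos d).ne'
  rw [pow_add 2 d 2, pow_add 2 d 1]
  simp only [div_eq_mul_inv, mul_inv_rev, inv_inv]
  ring

theorem le_two_mul_goodConst (d l : ℕ) :
    4 * d * l * ((l : ℝ) + 1) ^ (1 / (l : ℝ)) ≤ 2 * goodConst d l := by
  rw [goodConst, mul_div_assoc', le_div_iff₀ (ballVol_pos d), pow_succ]
  have h := ballVol_le d
  have hx : 0 ≤ 4 * (d : ℝ) * l * ((l : ℝ) + 1) ^ (1 / (l : ℝ)) := by positivity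
  nlinarith

theorem le_etaBase (d l : ℕ) :
    5 ^ d * (4 * d * l * ((l : ℝ) + 1) ^ (1 / (l : ℝ))) ≤ etaBase d l := by
  rw [etaBase]
  exact mul_le_mul_of_nonneg_left (le_two_mul_goodConst d l) (by positivity)

/-- The relative accuracy of the Taylor polynomials. -/
noncomputable def accuracy (d l : ℕ) : ℝ :=
  eta d l * 4 ^ l / (9900000 * 3 ^ (d + 1) * d * (l : ℝ) ^ 2 * l.factorial * (l + 1).factorial)

theorem eta_pos (d l : ℕ) (hd : 1 ≤ d) (hl : 1 ≤ l) : 0 < eta d l := by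
  rw [eta]
  have := ballVol_pos d
  have : (0 : ℝ) < d := by exact_mod_cast hd
  have : (0 : ℝ) < l := by exact_mod_cast hl
  exact lt_min (by norm_num) (by positivity)

theorem accuracy_nonneg (d l : ℕ) (hd : 1 ≤ d) (hl : 1 ≤ l) : 0 ≤ accuracy d l := by
  have := eta_pos d l hd hl
  rw [accuracy]; positivity

/-- The powers of ρ cancel down to a single factor ρ, so the bound on r controls the error at all
scales at once. -/
theorem taylor_error_le_accuracy {d n l : ℕ} (hd : 1 ≤ d) (hl : 1 ≤ l) {s₀ M r ρ : ℝ} (hs₀ : 0 < s₀)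
    (hM : 1 ≤ M) (hρ : 0 < ρ) (hρr : ρ ≤ 3 ^ (n + 1) * r)
    (hr : r ≤ eta d l * s₀ /
      (4 * 10 ^ 7 * 3 ^ (n + d + 2) * d * M * (l : ℝ) ^ (l + 2) * ((l + 1).factorial : ℝ))) :
    M * (4 * ρ) ^ (l + 1) / l.factorial / (0.99 * s₀ * (ρ / l) ^ l) ≤ accuracy d l := by
  have hdR : (0 : ℝ) < d := by exact_mod_cast hd
  have hlR : (0 : ℝ) < l := by exact_mod_cast hl
  have hfac : (0 : ℝ) < l.factorial := by exact_mod_cast Nat.factorial_pos l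
  have hfac' : (0 : ℝ) < (l + 1).factorial := by exact_mod_cast Nat.factorial_pos (l + 1)
  have hM0 : 0 < M := by linarith
  have h1 : M * (4 * ρ) ^ (l + 1) / l.factorial / (0.99 * s₀ * (ρ / l) ^ l)
      = (M * 4 * (4 * l) ^ l / (l.factorial * (0.99 * s₀))) * ρ := by
    rw [div_pow, mul_pow, mul_pow, pow_succ, pow_succ]
    field_simp
  rw [h1]
  calc _ ≤ (M * 4 * (4 * l) ^ l / (l.factorial * (0.99 * s₀))) * (3 ^ (n + 1) * (eta d l * s₀ /
      (4 * 10 ^ 7 * 3 ^ (n + d + 2) * d * M * (l : ℝ) ^ (l + 2) * ((l + 1).factorial : ℝ)))) := by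
        gcongr
        exact hρr.trans (by gcongr)
    _ = accuracy d l := by
        rw [accuracy, show n + d + 2 = (n + 1) + (d + 1) by ring, pow_add 3 (n + 1), mul_pow,
          pow_add (l : ℝ) l 2]
        field_simp
        ring

theorem pow_self_le_three_pow_mul_factorial (l : ℕ) : (l : ℝ) ^ l ≤ 3 ^ l * l.factorial := by
  have hfac : (0 : ℝ) < l.factorial := by exact_mod_cast Nat.factorial_pos l
  have h := Real.pow_div_factorial_le_exp (l : ℝ) (by positivity) l
  rw [div_le_iff₀ hfac] at h
  refine h.trans ?_
  gcongr
  rw [← mul_one (l : ℝ), Real.exp_nat_mul]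
  gcongr
  linarith [Real.exp_one_lt_d9]

set_option exponentiation.threshold 1000 in
-- For large l the left side grows like 6^(l²) times (l!)² and a geometric factor, using l^l ≤ 3^l
-- l!. The right side grows like 1.9^(4l²), and 1.9⁴ > 13. Small l are computed.
theorem growth_numeric_aux (l : ℕ) (hl : 2 ≤ l) :
    (16 * l * (1.01 * markovConst l)) ^ l * 4 ^ l * 1200
      ≤ 89100000 * (l : ℝ) ^ 2 * (l.factorial : ℝ) ^ 2 * (l + 1).factorial
        * 1.9 ^ ((2 * l - 1) * (2 * l - 2)) := by
  rcases lt_or_ge l 14 with h14 | h14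
  · interval_cases l <;> norm_num [markovConst, Nat.factorial]
  have hfac : (0 : ℝ) < l.factorial := by exact_mod_cast Nat.factorial_pos l
  have hlR : (0 : ℝ) < l := by exact_mod_cast (by omega : 0 < l)
  have h3 := pow_self_le_three_pow_mul_factorial l
  have hm : markovConst l ≤ l * 6 ^ l := by
    rw [markovConst]
    gcongr
    rw [div_le_iff₀ hfac, mul_pow]
    calc (2 : ℝ) ^ l * (l : ℝ) ^ l ≤ 2 ^ l * (3 ^ l * l.factorial) := by gcongr
      _ = 6 ^ l * l.factorial := by rw [← mul_assoc, ← mul_pow]; norm_num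
  have hbase : (27372 : ℝ) * 6 ^ l ≤ (1.9 ^ 4) ^ l := by
    obtain ⟨m, rfl⟩ : ∃ m, l = 14 + m := ⟨l - 14, by omega⟩
    rw [pow_add, pow_add]
    have e1 : (27372 : ℝ) * 6 ^ 14 ≤ (1.9 ^ 4) ^ 14 := by norm_num
    have e2 : (6 : ℝ) ^ m ≤ (1.9 ^ 4) ^ m := by gcongr; norm_num
    rw [← mul_assoc]
    gcongr
  have hexp : (1.9 : ℝ) ^ ((2 * l - 1) * (2 * l - 2)) * (1.9 ^ 6) ^ l
      = ((1.9 ^ 4) ^ l) ^ l * 1.9 ^ 2 := by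
    rw [← pow_mul, ← pow_mul, ← pow_mul, ← pow_add, ← pow_add]
    congr 1
    obtain ⟨m, rfl⟩ : ∃ m, l = m + 1 := ⟨l - 1, by omega⟩
    rw [show 2 * (m + 1) - 1 = 2 * m + 1 by omega, show 2 * (m + 1) - 2 = 2 * m by omega]
    ring
  have key : ((64.64 * 9 : ℝ) * 6 ^ l) ^ l ≤ 1.9 ^ ((2 * l - 1) * (2 * l - 2)) := by
    have h6 : (0 : ℝ) < (1.9 ^ 6) ^ l := by positivity
    rw [← mul_le_mul_iff_left₀ h6, hexp, ← mul_pow]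
    calc ((64.64 * 9 : ℝ) * 6 ^ l * 1.9 ^ 6) ^ l ≤ (27372 * 6 ^ l) ^ l := by
          refine pow_le_pow_left₀ (by positivity) ?_ l
          have : (0 : ℝ) < 6 ^ l := by positivity
          nlinarith
      _ ≤ ((1.9 ^ 4) ^ l) ^ l := by gcongr
      _ ≤ ((1.9 ^ 4) ^ l) ^ l * 1.9 ^ 2 := le_mul_of_one_le_right (by positivity) (by norm_num)
  have hl2 : ((l : ℝ) ^ 2) ^ l ≤ (9 : ℝ) ^ l * (l.factorial : ℝ) ^ 2 := by
    calc ((l : ℝ) ^ 2) ^ l = ((l : ℝ) ^ l) ^ 2 := by rw [← pow_mul, ← pow_mul, mul_comm]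
      _ ≤ ((3 : ℝ) ^ l * (l.factorial : ℝ)) ^ 2 := by gcongr
      _ = _ := by rw [mul_pow, ← pow_mul, mul_comm l, pow_mul]; norm_num
  have hfac' : (1 : ℝ) ≤ (l + 1).factorial := by exact_mod_cast Nat.factorial_pos (l + 1)
  have hl1 : (1 : ℝ) ≤ l := by exact_mod_cast (by omega : 1 ≤ l)
  calc (16 * l * (1.01 * markovConst l)) ^ l * 4 ^ l * 1200
      ≤ (16 * l * (1.01 * (l * 6 ^ l))) ^ l * 4 ^ l * 1200 := by
        have := one_le_markovConst (l := l) (by omega)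
        gcongr
    _ = ((l : ℝ) ^ 2) ^ l * (64.64 * 6 ^ l) ^ l * 1200 := by
        rw [← mul_pow, ← mul_pow]; congr 2; ring
    _ ≤ 9 ^ l * (l.factorial : ℝ) ^ 2 * (64.64 * 6 ^ l) ^ l * 1200 := by gcongr
    _ = (l.factorial : ℝ) ^ 2 * ((64.64 * 9) * 6 ^ l) ^ l * 1200 := by
        rw [mul_pow, mul_pow, mul_pow]; ring
    _ ≤ (l.factorial : ℝ) ^ 2 * 1.9 ^ ((2 * l - 1) * (2 * l - 2)) * 1200 := by gcongr
    _ = 1200 * 1 ^ 2 * (l.factorial : ℝ) ^ 2 * 1 * 1.9 ^ ((2 * l - 1) * (2 * l - 2)) := by ring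
    _ ≤ _ := by gcongr; norm_num

theorem four_le_etaBase {d l : ℕ} (hd : 1 ≤ d) (hl : 1 ≤ l) : 4 ≤ etaBase d l := by
  refine le_trans ?_ (le_etaBase d l)
  have hdR : (1 : ℝ) ≤ d := by exact_mod_cast hd
  have hlR : (1 : ℝ) ≤ l := by exact_mod_cast hl
  have h1 : (1 : ℝ) ≤ ((l : ℝ) + 1) ^ (1 / (l : ℝ)) :=
    Real.one_le_rpow (by linarith) (by positivity)
  have h5 : (1 : ℝ) ≤ 5 ^ d := one_le_pow₀ (by norm_num)
  calc (4 : ℝ) = 1 * (4 * 1 * 1 * 1) := by norm_num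
    _ ≤ _ := by gcongr

/-- For `l ≥ 2`, the Taylor error is negligible at the scale where the covering argument starts. -/
theorem accuracy_growth_le {d l : ℕ} (hd : 1 ≤ d) (hl : 2 ≤ l) :
    1200 * accuracy d l * growthConst l (1.01 * markovConst l)
      ≤ (1.9 / etaBase d l) ^ (d * (2 * l - 1) * (2 * l - 2)) := by
  have hdR : (1 : ℝ) ≤ d := by exact_mod_cast hd
  have hlR : (0 : ℝ) < l := by exact_mod_cast (by omega : 0 < l)
  have hfac : (0 : ℝ) < l.factorial := by exact_mod_cast Nat.factorial_pos l
  have hfac' : (0 : ℝ) < (l + 1).factorial := by exact_mod_cast Nat.factorial_pos (l + 1)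
  have hX := four_le_etaBase hd (by omega : 1 ≤ l)
  have hη : eta d l ≤ (1 / etaBase d l) ^ (d * (2 * l - 1) * (2 * l - 2)) := by
    rw [eta_eq]; exact min_le_right _ _
  have hη0 := eta_pos d l hd (by omega)
  have hnum := growth_numeric_aux l hl
  have hpow : (1.9 : ℝ) ^ ((2 * l - 1) * (2 * l - 2)) ≤ 1.9 ^ (d * (2 * l - 1) * (2 * l - 2)) := by
    refine pow_le_pow_right₀ (by norm_num) ?_
    rw [mul_assoc]
    exact Nat.le_mul_of_pos_left _ hd
  have h3 : (9 : ℝ) ≤ 3 ^ (d + 1) * d := by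
    have : (3 : ℝ) ^ 2 ≤ 3 ^ (d + 1) := pow_le_pow_right₀ (by norm_num) (by omega)
    nlinarith
  have e1 : 1200 * accuracy d l * growthConst l (1.01 * markovConst l)
      = eta d l * (((16 * l * (1.01 * markovConst l)) ^ l * 4 ^ l * 1200) /
        (9900000 * (3 ^ (d + 1) * d) * (l : ℝ) ^ 2 * (l.factorial : ℝ) ^ 2 * (l + 1).factorial)) := by
    rw [accuracy, growthConst]
    field_simp
  have e2 : ((16 * l * (1.01 * markovConst l)) ^ l * 4 ^ l * 1200) /
        (9900000 * (3 ^ (d + 1) * d) * (l : ℝ) ^ 2 * (l.factorial : ℝ) ^ 2 * (l + 1).factorial)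
      ≤ 1.9 ^ (d * (2 * l - 1) * (2 * l - 2)) := by
    rw [div_le_iff₀ (by positivity)]
    refine hnum.trans ?_
    calc _ = 1.9 ^ ((2 * l - 1) * (2 * l - 2)) *
          (9900000 * 9 * (l : ℝ) ^ 2 * (l.factorial : ℝ) ^ 2 * (l + 1).factorial) := by ring
      _ ≤ _ := by gcongr
  have hm := one_le_markovConst (l := l) (by omega)
  rw [e1]
  calc _ ≤ (1 / etaBase d l) ^ (d * (2 * l - 1) * (2 * l - 2))
        * 1.9 ^ (d * (2 * l - 1) * (2 * l - 2)) := by gcongr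
    _ = _ := by rw [← mul_pow]; congr 1; ring

/-- For l = 1 the exponent 2l - 2 in `eta` vanishes, so only η ≤ 1/16 is available; the factor
3^(d+1) d in `accuracy` supplies the dependence on d. -/
theorem accuracy_growth_one {d : ℕ} (hd : 1 ≤ d) :
    1200 * accuracy d 1 * growthConst 1 (1.01 * markovConst 1) ≤ 1 / (18000 * 3 ^ (d - 1) * d) := by
  have hdR : (1 : ℝ) ≤ d := by exact_mod_cast hd
  have hη : eta d 1 ≤ 1 / 16 := by rw [eta_eq]; exact min_le_left _ _
  obtain ⟨m, rfl⟩ : ∃ m, d = m + 1 := ⟨d - 1, by omega⟩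
  have e1 : 1200 * accuracy (m + 1) 1 * growthConst 1 (1.01 * markovConst 1)
      = eta (m + 1) 1 * (1200 * 4 * 32.32 / (9900000 * 9 * 2 * 3 ^ m * ((m + 1 : ℕ) : ℝ))) := by
    rw [accuracy, growthConst, markovConst]
    simp only [Nat.factorial]
    rw [show m + 1 + 1 = m + 2 by ring, pow_add 3 m 2]
    push_cast
    field_simp
    ring
  rw [e1, Nat.add_sub_cancel]
  calc _ ≤ 1 / 16 * (1200 * 4 * 32.32 / (9900000 * 9 * 2 * 3 ^ m * ((m + 1 : ℕ) : ℝ))) := by gcongr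
    _ ≤ _ := by
      rw [mul_div_assoc', div_le_div_iff₀ (by positivity) (by positivity)]
      have : (0 : ℝ) < 3 ^ m * ((m + 1 : ℕ) : ℝ) := by positivity
      nlinarith

end SkewGood

/-! ### The hypotheses in usable form, and normalisation at every scale -/

namespace SkewGood

variable {d n l : ℕ} {M : ℝ} {f : E d → E n} {W : Set (E d)}

theorem derivBound_of_contDiffOn {x₀ : E d} {R : ℝ}
    (hf : ContDiffOn ℝ ((l + 1 : ℕ) : WithTop ℕ∞) f (closedBall x₀ R)) (hM : 0 ≤ M)
    (hfM : ∀ k : ℕ, 1 ≤ k → k ≤ l + 1 → ∀ u : Fin k → E d, (∀ i, ‖u i‖ = 1) →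
      ∀ x ∈ ball x₀ R, ‖iteratedFDeriv ℝ k f x u‖ ≤ M) : DerivBound l M f (ball x₀ R) where
  isOpen := isOpen_ball
  contDiffAt _ hx := hf.contDiffAt (Filter.mem_of_superset (isOpen_ball.mem_nhds hx)
    ball_subset_closedBall)
  nonneg := hM
  bound k hk hkl x hx m :=
    norm_multilinear_le_of_unit (fun u hu => hfM k hk hkl u hu x hx) hM m

/-- Every unit vector `v` has a directional derivative of `⟪v, f⟫` of some order `1, …, l` of
size at least `s`, at each point of `W`. -/
def NondegOn (l : ℕ) (s : ℝ) (f : E d → E n) (W : Set (E d)) : Prop :=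
  ∀ y ∈ W, ∀ v : E n, ‖v‖ = 1 → ∃ k : ℕ, 0 < k ∧ k ≤ l ∧ ∃ u : E d, ‖u‖ = 1 ∧
    s ≤ |inner ℝ v (iteratedFDeriv ℝ k f y fun _ => u)|

theorem DerivBound.iteratedFDeriv_inner (hf : DerivBound l M f W) {k : ℕ} (hk : k ≤ l + 1)
    (v : E n) {x : E d} (hx : x ∈ W) (m : Fin k → E d) :
    iteratedFDeriv ℝ k (fun y => inner ℝ (f y) v) x m = inner ℝ v (iteratedFDeriv ℝ k f x m) := by
  have h1 : (fun y => inner ℝ (f y) v) = innerSL ℝ v ∘ f := by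
    funext y; simp [real_inner_comm]
  rw [h1, (innerSL ℝ v).iteratedFDeriv_comp_left (hf.contDiffAt x hx) (by exact_mod_cast hk)]
  simp

/-- The supremum need not be attained, hence only s strictly below it. Positivity rules out the
default value of `sSup` on the empty set. -/
theorem DerivBound.nondegOn (hf : DerivBound l M f W) (h0 : 0 < nondegMeasure l f W) {s : ℝ}
    (hs : s < nondegMeasure l f W) : NondegOn l s f W := by
  rw [nondegMeasure] at h0 hs
  have hne : Set.Nonempty {s : ℝ | ∀ x ∈ W, ∀ v : E n, ‖v‖ = 1 → ∃ k : ℕ, 0 < k ∧ k ≤ l ∧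
      ∃ u : E d, ‖u‖ = 1 ∧
        s ≤ |iteratedFDeriv ℝ k (fun y => inner ℝ (f y) v) x (fun _ => u)|} := by
    by_contra hcon
    rw [Set.not_nonempty_iff_eq_empty] at hcon
    rw [hcon, Real.sSup_empty] at h0
    exact lt_irrefl _ h0
  obtain ⟨s', hs', hss'⟩ := exists_lt_of_lt_csSup hne hs
  intro x hx v hv
  obtain ⟨k, hk, hkl, u, hu, hku⟩ := hs' x hx v hv
  refine ⟨k, hk, hkl, u, hu, hss'.le.trans ?_⟩
  rwa [hf.iteratedFDeriv_inner (hkl.trans (Nat.le_succ l)) v hx] at hku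

theorem DerivBound.le_of_nondegOn (hf : DerivBound l M f W) (hn : 1 ≤ n) (hW : W.Nonempty) {s : ℝ}
    (h : NondegOn l s f W) : s ≤ M := by
  obtain ⟨x, hx⟩ := hW
  have hv : ‖EuclideanSpace.single (⟨0, hn⟩ : Fin n) (1 : ℝ)‖ = 1 := by simp
  obtain ⟨k, hk, hkl, u, hu, hku⟩ := h x hx _ hv
  refine hku.trans ((hf.abs_inner_le hk (hkl.trans (Nat.le_succ l)) _ hx _ (v := 1) ?_).trans ?_)
  · simp [hu]
  · rw [hv]; simp

/-- The data of the main theorem: the map `f` on the large ball, with the derivative bound `M` and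
the nondegeneracy constant `s₀`, and the smallness of the radius. -/
structure SmallBall (d n l : ℕ) (x₀ : E d) (r s₀ M : ℝ) (f : E d → E n) : Prop where
  hd : 1 ≤ d
  hl : 1 ≤ l
  hr : 0 < r
  hM : 1 ≤ M
  hs₀ : 0 < s₀
  hsM : s₀ ≤ M
  derivBound : DerivBound l M f (ball x₀ (3 ^ (n + d + 2) * r))
  nondeg : ∀ s < s₀, NondegOn l s f (ball x₀ (3 ^ (n + d + 2) * r))
  radius : r ≤ eta d l * s₀ /
      (4 * 10 ^ 7 * 3 ^ (n + d + 2) * d * M * (l : ℝ) ^ (l + 2) * ((l + 1).factorial : ℝ))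

variable {x₀ : E d} {r s₀ : ℝ}

theorem SmallBall.mul_radius_le (h : SmallBall d n l x₀ r s₀ M f) :
    M * (3 ^ (n + 1) * r) ≤ 1e-6 * s₀ := by
  have hd : (1 : ℝ) ≤ d := by exact_mod_cast h.hd
  have hl : (1 : ℝ) ≤ l := by exact_mod_cast h.hl
  have hM := h.hM
  have hr := h.hr
  have hs := h.hs₀
  have hη : eta d l ≤ 1 := by
    rw [eta_eq]; exact (min_le_left _ _).trans (by norm_num)
  have hfac : (1 : ℝ) ≤ (l + 1).factorial := by exact_mod_cast Nat.factorial_pos (l + 1)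
  have h1 := h.radius
  rw [le_div_iff₀ (by positivity)] at h1
  have h2 : (1 : ℝ) ≤ (l : ℝ) ^ (l + 2) := one_le_pow₀ hl
  have h3 : (3 : ℝ) ^ (n + 1) ≤ 3 ^ (n + d + 2) := pow_le_pow_right₀ (by norm_num) (by omega)
  have h4 : r * (4 * 10 ^ 7 * 3 ^ (n + 1) * 1 * M * 1 * 1) ≤ eta d l * s₀ := by
    refine le_trans ?_ h1
    gcongr
  have h5 : eta d l * s₀ ≤ 1 * s₀ := by gcongr
  linarith

theorem SmallBall.radius_le_one (h : SmallBall d n l x₀ r s₀ M f) : 3 ^ (n + 1) * r ≤ 1 := by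
  have h1 := h.mul_radius_le
  have hM := h.hM
  have hr := h.hr
  have h3 := h.hsM
  have h4 : M * (3 ^ (n + 1) * r) ≤ M * 1 := by linarith
  exact le_of_mul_le_mul_left h4 (by linarith)

theorem SmallBall.closedBall_subset (h : SmallBall d n l x₀ r s₀ M f) :
    closedBall x₀ (3 ^ (n + 1) * r) ⊆ ball x₀ (3 ^ (n + d + 2) * r) := by
  refine closedBall_subset_ball ?_
  have hr := h.hr
  have h3 : (3 : ℝ) ^ (n + 1) < 3 ^ (n + d + 2) := pow_lt_pow_right₀ (by norm_num) (by omega)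
  gcongr

/-- Take y = c if x is within s/2 of c; otherwise move x towards c by s/2. The inscribed ball has
radius a quarter of the diameter bound 2s, whence the 4ρ in `NormalizedPair`. -/
theorem closedBall_subset_closure_inter_ball {c x : E d} {t s : ℝ} (hx : x ∈ ball c t) (hs : 0 < s)
    (hst : s ≤ 2 * t) :
    ∃ y, closedBall y (s / 2) ⊆ closure (ball c t ∩ ball x s) := by
  suffices h : ∃ y, ball y (s / 2) ⊆ ball c t ∩ ball x s by
    obtain ⟨y, hy⟩ := h
    exact ⟨y, by rw [← closure_ball y (by positivity)]; exact closure_mono hy⟩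
  rw [mem_ball] at hx
  rcases le_or_gt (dist x c) (s / 2) with h1 | h1
  · exact ⟨c, Set.subset_inter (ball_subset_ball (by linarith))
      (ball_subset_ball' (by rw [dist_comm]; linarith))⟩
  · have hδ : 0 < dist x c := by linarith [show 0 < s / 2 by positivity]
    refine ⟨AffineMap.lineMap x c (s / (2 * dist x c)), Set.subset_inter ?_ ?_⟩
    · refine ball_subset_ball' ?_
      rw [dist_lineMap_right, Real.norm_of_nonneg, sub_mul, div_mul_eq_mul_div]
      · rw [show s * dist x c / (2 * dist x c) = s / 2 by field_simp]; linarith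
      · rw [sub_nonneg, div_le_one (by positivity)]; linarith
    · refine ball_subset_ball' ?_
      rw [dist_lineMap_left, Real.norm_of_nonneg (by positivity), div_mul_eq_mul_div,
        show s * dist x c / (2 * dist x c) = s / 2 by field_simp]
      linarith

/-- Normalisation at every scale inside the ball `3^{n+1} U`. -/
theorem SmallBall.exists_normalizedPair (h : SmallBall d n l x₀ r s₀ M f)
    (hacc : accuracy d l ≤ 0.01) {c : E d} {t : ℝ}
    (hct : ball c t ⊆ ball x₀ (3 ^ (n + 1) * r)) {x : E d} (hx : x ∈ ball c t) {s : ℝ} (hs : 0 < s)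
    (hst : s ≤ 2 * t) {u₁ u₂ : E n} {c₁ c₂ : ℝ}
    (hex : ∃ z ∈ ball c t ∩ ball x s, skewForm (fun z => inner ℝ u₁ (f z) + c₁)
      (fun z => inner ℝ u₂ (f z) + c₂) z ≠ 0) :
    ∃ (a b : E d → ℝ) (Φ : ℝ) (x₁ x₂ : E d), 0 < Φ ∧
      NormalizedPair l (accuracy d l) (s / 2) (1.01 * markovConst l)
        (closure (ball c t ∩ ball x s)) a b ∧
      DualPoints a b (closure (ball c t ∩ ball x s)) x₁ x₂ ∧
      ContinuousOn (skewForm a b) (closure (ball c t ∩ ball x s)) ∧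
      ∀ z ∈ closure (ball c t ∩ ball x s), ‖skewForm (fun z => inner ℝ u₁ (f z) + c₁)
        (fun z => inner ℝ u₂ (f z) + c₂) z‖ = Φ * ‖skewForm a b z‖ := by
  have hd := h.hd
  have ht : 0 < t := by linarith
  have hr := h.hr
  have hM := h.hM
  have hs₀ := h.hs₀
  have hl : (0 : ℝ) < l := by exact_mod_cast h.hl
  have htr : t ≤ 3 ^ (n + 1) * r := by
    have : Nonempty (Fin d) := ⟨⟨0, hd⟩⟩
    have h1 : closedBall c t ⊆ closedBall x₀ (3 ^ (n + 1) * r) := by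
      rw [← closure_ball c ht.ne']
      exact closure_minimal (hct.trans ball_subset_closedBall) isClosed_closedBall
    have h2 := diam_mono h1 isBounded_closedBall
    rw [diam_closedBall_eq _ ht.le, diam_closedBall_eq _ (by positivity)] at h2
    linarith
  have hKW : closure (ball c t ∩ ball x s) ⊆ closedBall x₀ (3 ^ (n + 1) * r) := by
    refine closure_minimal ?_ isClosed_closedBall
    exact Set.inter_subset_left.trans (hct.trans ball_subset_closedBall)
  obtain ⟨y, hy⟩ := closedBall_subset_closure_inter_ball hx hs hst
  have hyW := h.closedBall_subset (hKW (hy (mem_closedBall_self (by positivity))))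
  have hρr : s / 2 ≤ 3 ^ (n + 1) * r := by linarith
  have hMρ : M * (s / 2) ≤ 1e-6 * s₀ := le_trans (by gcongr) h.mul_radius_le
  have hm := one_le_markovConst h.hl
  -- The value 0.995 s₀ is strictly below the supremum s₀; after subtracting Mρ ≤ 10⁻⁶ s₀, more than
  -- 0.99 s₀ is left.
  refine h.derivBound.exists_normalizedPair h.hl ((convex_ball c t).inter (convex_ball x s))
    (isOpen_ball.inter isOpen_ball) (hKW.trans h.closedBall_subset) (y := y) (s₁ := 0.995 * s₀)
    (ω := 0.99 * s₀ * (s / 2 / l) ^ l)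
    (by positivity) (hρr.trans h.radius_le_one) hy ?_ (by linarith)
    (h.nondeg _ (by linarith) y hyW) (by positivity) ?_
    (taylor_error_le_accuracy hd h.hl hs₀ hM (by positivity) hρr h.radius) (by linarith)
    (by nlinarith) hex
  · have hsub : closure (ball c t ∩ ball x s) ⊆ closedBall x s :=
      closure_minimal (Set.inter_subset_right.trans ball_subset_closedBall) isClosed_closedBall
    intro z hz z' hz'
    have h1 := mem_closedBall.1 (hsub hz)
    have h2 := mem_closedBall.1 (hsub hz')
    linarith [dist_triangle_right z z' x]
  · gcongr
    linarith

end SkewGood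

/-! ### Part (a): goodness at all scales -/

namespace SkewGood

variable {d n l : ℕ} {M : ℝ} {f : E d → E n} {x₀ : E d} {r s₀ : ℝ}

theorem one_le_growthConst (hl : 1 ≤ l) {Λ : ℝ} (hΛ : 1 ≤ Λ) : 1 ≤ growthConst l Λ := by
  have hfac : (0 : ℝ) < l.factorial := by exact_mod_cast Nat.factorial_pos l
  rw [growthConst, le_div_iff₀ hfac, one_mul]
  have hlR : (0 : ℝ) ≤ l := by positivity
  calc (l.factorial : ℝ) ≤ (l : ℝ) ^ l := by exact_mod_cast Nat.factorial_le_pow l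
    _ ≤ _ := by
      refine pow_le_pow_left₀ hlR ?_ l
      nlinarith

theorem accuracy_growth_le_inv (hd : 1 ≤ d) (hl : 1 ≤ l) :
    1200 * accuracy d l * growthConst l (1.01 * markovConst l) ≤ 1 := by
  rcases Nat.lt_or_ge l 2 with h | h
  · obtain rfl : l = 1 := by omega
    refine (accuracy_growth_one hd).trans ?_
    have hdR : (1 : ℝ) ≤ d := by exact_mod_cast hd
    have h3 : (1 : ℝ) ≤ 3 ^ (d - 1) := one_le_pow₀ (by norm_num)
    rw [div_le_one (by positivity)]
    calc (1 : ℝ) ≤ 18000 * 1 * 1 := by norm_num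
      _ ≤ _ := by gcongr
  · refine (accuracy_growth_le hd h).trans (pow_le_one₀ ?_ ?_)
    · have := four_le_etaBase hd hl
      positivity
    · have := four_le_etaBase hd hl
      rw [div_le_one (by linarith)]
      linarith

theorem accuracy_le (hd : 1 ≤ d) (hl : 1 ≤ l) : accuracy d l ≤ 0.001 := by
  have h1 := accuracy_growth_le_inv hd hl
  have h2 := one_le_growthConst hl (Λ := 1.01 * markovConst l) (by
    linarith [one_le_markovConst hl])
  have h3 := accuracy_nonneg d l hd hl
  have h4 : 1200 * accuracy d l * 1 ≤ 1 := le_trans (by gcongr) h1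
  linarith

theorem accuracy_mul_growth_add_one_le (hd : 1 ≤ d) (hl : 1 ≤ l) :
    accuracy d l * (growthConst l (1.01 * markovConst l) + 1) ≤ 1 / 2 := by
  linarith [accuracy_growth_le_inv hd hl, accuracy_le hd hl]

/-- The constant in the estimate at a fixed scale. -/
noncomputable def scaleConst (d l : ℕ) : ℝ :=
  d * (skewDegree d l * 2.06 ^ (1 / (skewDegree d l : ℝ)))

theorem skewDegree_le (d l : ℕ) : skewDegree d l ≤ 2 * l - 1 := by
  rw [skewDegree]; split_ifs <;> omega

theorem scaleConst_nonneg (d l : ℕ) : 0 ≤ scaleConst d l := by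
  rw [scaleConst]; positivity

theorem scaleConst_le (d : ℕ) (hl : 1 ≤ l) (hk : 1 ≤ skewDegree d l) :
    scaleConst d l ≤ 2.1 * d * l * ((l : ℝ) + 1) ^ (1 / (l : ℝ)) := by
  have hlR : (1 : ℝ) ≤ l := by exact_mod_cast hl
  rcases Nat.lt_or_ge l 2 with h | h
  · obtain rfl : l = 1 := by omega
    have h1 : skewDegree d 1 = 1 := le_antisymm (skewDegree_le d 1) hk
    rw [scaleConst, h1]
    have : (0 : ℝ) ≤ d := by positivity
    norm_num
    linarith
  · have hkl : l ≤ skewDegree d l := by rw [skewDegree]; split_ifs <;> omega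
    have h1 : ((skewDegree d l : ℕ) : ℝ) ≤ 2 * l := by
      exact_mod_cast (skewDegree_le d l).trans (by omega)
    have hklR : (l : ℝ) ≤ skewDegree d l := by exact_mod_cast hkl
    have hl2 : (2 : ℝ) ≤ l := by exact_mod_cast h
    have h2 : (2.06 : ℝ) ^ (1 / (skewDegree d l : ℝ)) ≤ ((l : ℝ) + 1) ^ (1 / (l : ℝ)) := by
      calc _ ≤ ((l : ℝ) + 1) ^ (1 / (skewDegree d l : ℝ)) :=
            Real.rpow_le_rpow (by norm_num) (by linarith) (by positivity)
        _ ≤ _ := by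
          refine Real.rpow_le_rpow_of_exponent_le (by linarith) ?_
          exact one_div_le_one_div_of_le (by linarith) hklR
    rw [scaleConst]
    calc _ ≤ (d : ℝ) * (2 * l * ((l : ℝ) + 1) ^ (1 / (l : ℝ))) := by gcongr
      _ = 2 * (d * l * ((l : ℝ) + 1) ^ (1 / (l : ℝ))) := by ring
      _ ≤ 2.1 * (d * l * ((l : ℝ) + 1) ^ (1 / (l : ℝ))) := by gcongr; norm_num
      _ = _ := by ring

/-- The estimate for the proportion of small values at a fixed scale. -/
theorem SmallBall.volume_lt_le_at_scale (h : SmallBall d n l x₀ r s₀ M f) {c : E d} {t : ℝ}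
    (hct : ball c t ⊆ ball x₀ (3 ^ (n + 1) * r)) (hk : 1 ≤ skewDegree d l) (u₁ u₂ : E n)
    (c₁ c₂ : ℝ) {x : E d} (hx : x ∈ ball c t) {s : ℝ} (hs : 0 < s) (hst : s ≤ 2 * t) {ε : ℝ}
    (hε : 0 < ε) (hεκ : 1200 * accuracy d l * growthConst l (1.01 * markovConst l) ≤ ε)
    (hε1 : ε ≤ 1) {A : ℝ} (hA : 0 < A)
    (hex : ∃ z ∈ ball c t ∩ ball x s, A ≤ ‖skewForm (fun z => inner ℝ u₁ (f z) + c₁)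
      (fun z => inner ℝ u₂ (f z) + c₂) z‖) :
    volume {z | z ∈ ball c t ∩ ball x s ∧ ‖skewForm (fun z => inner ℝ u₁ (f z) + c₁)
      (fun z => inner ℝ u₂ (f z) + c₂) z‖ < ε * A}
      ≤ ENNReal.ofReal (scaleConst d l * ε ^ (1 / (skewDegree d l : ℝ)))
        * volume (ball c t ∩ ball x s) := by
  obtain ⟨z₀, hz₀, hAz⟩ := hex
  obtain ⟨a, b, Φ, x₁, x₂, hΦ, hN, hp, hc, heq⟩ := h.exists_normalizedPair
    ((accuracy_le h.hd h.hl).trans (by norm_num)) hct hx hs hst (u₁ := u₁) (u₂ := u₂) (c₁ := c₁)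
    (c₂ := c₂) ⟨z₀, hz₀, norm_pos_iff.1 (hA.trans_le hAz)⟩
  set K := ball c t ∩ ball x s with hK
  have hcomp : IsCompact (closure K) :=
    (isBounded_ball.subset Set.inter_subset_left).isCompact_closure
  obtain ⟨y, hy, hymax⟩ := hcomp.exists_isMaxOn ⟨z₀, subset_closure hz₀⟩ hc.norm
  have hymax' : ∀ z ∈ closure K, ‖skewForm a b z‖ ≤ ‖skewForm a b y‖ := fun z hz => hymax hz
  have hv := hN.volume_le h.hd ((convex_ball c t).inter (convex_ball x s))
    (isOpen_ball.inter isOpen_ball) hp (accuracy_mul_growth_add_one_le h.hd h.hl) hc hy hymax' hk hε hε1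
    hεκ
  have hC : scaleConst d l * ε ^ (1 / (skewDegree d l : ℝ))
      = d * (skewDegree d l * (2.06 * ε) ^ (1 / (skewDegree d l : ℝ))) := by
    rw [scaleConst, Real.mul_rpow (by norm_num) hε.le]; ring
  rw [hC]
  refine (measure_mono ?_).trans hv
  rintro z ⟨hzK, hz⟩
  refine ⟨hzK, ?_⟩
  rw [heq z (subset_closure hzK)] at hz
  rw [heq z₀ (subset_closure hz₀)] at hAz
  have h1 : ε * A ≤ ε * (Φ * ‖skewForm a b y‖) := by
    have := hymax' z₀ (subset_closure hz₀)
    exact mul_le_mul_of_nonneg_left (hAz.trans (by gcongr)) hε.le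
  have h2 : Φ * ‖skewForm a b z‖ < Φ * (ε * ‖skewForm a b y‖) := by linarith
  exact lt_of_mul_lt_mul_left h2 hΦ.le

theorem SmallBall.le_norm_of_degree_zero (h : SmallBall d n l x₀ r s₀ M f) {c : E d} {t : ℝ}
    (hct : ball c t ⊆ ball x₀ (3 ^ (n + 1) * r)) (hk : skewDegree d l = 0) (u₁ u₂ : E n)
    (c₁ c₂ : ℝ) {A : ℝ} (hA : 0 < A) {z₀ : E d} (hz₀ : z₀ ∈ ball c t)
    (hAz : A ≤ ‖skewForm (fun z => inner ℝ u₁ (f z) + c₁) (fun z => inner ℝ u₂ (f z) + c₂) z₀‖)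
    {z : E d} (hz : z ∈ ball c t) :
    0.9 * A ≤ ‖skewForm (fun z => inner ℝ u₁ (f z) + c₁) (fun z => inner ℝ u₂ (f z) + c₂) z‖ := by
  have ht : 0 < t := pos_of_mem_ball hz
  obtain ⟨a, b, Φ, x₁, x₂, hΦ, hN, hp, hc, heq⟩ := h.exists_normalizedPair
    ((accuracy_le h.hd h.hl).trans (by norm_num)) hct (mem_ball_self ht) ht (by linarith) (u₁ := u₁)
    (u₂ := u₂) (c₁ := c₁) (c₂ := c₂) ⟨z₀, ⟨hz₀, hz₀⟩, norm_pos_iff.1 (hA.trans_le hAz)⟩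
  rw [Set.inter_self] at hN hp hc heq
  have hcomp : IsCompact (closure (ball c t)) := isBounded_ball.isCompact_closure
  obtain ⟨y, hy, hymax⟩ := hcomp.exists_isMaxOn ⟨z₀, subset_closure hz₀⟩ hc.norm
  have hymax' : ∀ z ∈ closure (ball c t), ‖skewForm a b z‖ ≤ ‖skewForm a b y‖ := fun z hz => hymax hz
  have h1 := hN.le_norm_of_degree_zero hp (accuracy_mul_growth_add_one_le h.hd h.hl) hy hymax' hk
    (subset_closure hz)
  have h2 := accuracy_growth_le_inv h.hd h.hl
  have h3 := hymax' z₀ (subset_closure hz₀)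
  rw [heq z₀ (subset_closure hz₀)] at hAz
  rw [heq z (subset_closure hz)]
  have h4 : 0.9 * ‖skewForm a b z₀‖ ≤ ‖skewForm a b z‖ := by
    refine le_trans ?_ h1
    have h5 : 0.9 ≤ 1 - 24 * accuracy d l * growthConst l (1.01 * markovConst l) := by linarith
    exact mul_le_mul h5 h3 (norm_nonneg _) (by linarith)
  calc 0.9 * A ≤ 0.9 * (Φ * ‖skewForm a b z₀‖) := by gcongr
    _ = Φ * (0.9 * ‖skewForm a b z₀‖) := by ring
    _ ≤ _ := by gcongr

/-- With y = 1.9/`etaBase` and ε₀ = y^(d(2l-1)(2l-2)), the right side is y^(2l-2) and the left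
contains y^e with e ≥ 2l - 1. The spare factor y absorbs the covering constant. -/
theorem scale_recursion_of_two_le (hd : 1 ≤ d) (hl : 2 ≤ l) :
    (3 + 2 / (d : ℝ)) ^ d * (scaleConst d l *
      ((1.9 / etaBase d l) ^ (d * (2 * l - 1) * (2 * l - 2))) ^ (1 / (skewDegree d l : ℝ)))
      ≤ ((1.9 / etaBase d l) ^ (d * (2 * l - 1) * (2 * l - 2))) ^ (1 / ((d : ℝ) * (2 * l - 1))) := by
  have hdR : (1 : ℝ) ≤ d := by exact_mod_cast hd
  have hlR : (2 : ℝ) ≤ l := by exact_mod_cast hl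
  have hk : 1 ≤ skewDegree d l := by rw [skewDegree]; split_ifs <;> omega
  have hX := four_le_etaBase hd (by omega : 1 ≤ l)
  have hXl := le_etaBase d l
  have hC := scaleConst_le d (by omega : 1 ≤ l) hk
  set y := 1.9 / etaBase d l with hy
  have hy0 : 0 < y := by positivity
  have hy1 : y ≤ 1 := by rw [hy, div_le_one (by linarith)]; linarith
  obtain ⟨e, he, hee⟩ : ∃ e, d * (2 * l - 1) * (2 * l - 2) = skewDegree d l * e ∧ 2 * l - 1 ≤ e := by
    rw [skewDegree]
    split_ifs with h1
    · exact ⟨2 * l - 1, by rw [h1]; ring, le_rfl⟩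
    · refine ⟨d * (2 * l - 2), by ring, ?_⟩
      calc 2 * l - 1 ≤ 2 * (2 * l - 2) := by omega
        _ ≤ _ := Nat.mul_le_mul_right _ (by omega)
  have h1 : (y ^ (d * (2 * l - 1) * (2 * l - 2))) ^ (1 / (skewDegree d l : ℝ)) = y ^ e := by
    rw [he, mul_comm, pow_mul, one_div, Real.pow_rpow_inv_natCast (by positivity) (by omega)]
  have h2 : (y ^ (d * (2 * l - 1) * (2 * l - 2))) ^ (1 / ((d : ℝ) * (2 * l - 1))) = y ^ (2 * l - 2) := by
    have : (d : ℝ) * (2 * l - 1) = ((d * (2 * l - 1) : ℕ) : ℝ) := by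
      rw [Nat.cast_mul, Nat.cast_sub (by omega)]; push_cast; ring
    rw [this, mul_comm, pow_mul, one_div, Real.pow_rpow_inv_natCast (by positivity)]
    exact Nat.mul_ne_zero (by omega) (by omega)
  rw [h1, h2]
  have h5 : (3 + 2 / (d : ℝ)) ^ d ≤ 5 ^ d := by
    gcongr
    have : 2 / (d : ℝ) ≤ 2 := div_le_self (by norm_num) hdR
    linarith
  -- The constant 1.9 fits because 2.1 · 1.9 = 3.99 ≤ 4, and 5^d comes from 3 + 2/d ≤ 5.
  have h6 : (3 + 2 / (d : ℝ)) ^ d * scaleConst d l ≤ 1 / y := by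
    have := scaleConst_nonneg d l
    rw [hy, one_div, inv_div, le_div_iff₀ (by norm_num)]
    refine le_trans ?_ hXl
    set Q := ((l : ℝ) + 1) ^ (1 / (l : ℝ)) with hQ
    have hQ0 : 0 ≤ Q := by positivity
    calc _ ≤ 5 ^ d * (2.1 * d * l * Q) * 1.9 := by gcongr
      _ = 3.99 * (5 ^ d * (d * l * Q)) := by ring
      _ ≤ 4 * (5 ^ d * (d * l * Q)) := by gcongr; norm_num
      _ = _ := by ring
  calc (3 + 2 / (d : ℝ)) ^ d * (scaleConst d l * y ^ e)
      = ((3 + 2 / (d : ℝ)) ^ d * scaleConst d l) * y ^ e := by ring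
    _ ≤ 1 / y * y ^ (2 * l - 1) := by
      gcongr ?_ * ?_
      exact pow_le_pow_of_le_one hy0.le hy1 hee
    _ = y ^ (2 * l - 2) := by
      rw [show 2 * l - 1 = (2 * l - 2) + 1 by omega, pow_succ]; field_simp

/-- Here k = 1, so the left side is linear in ε₀, whose 3^(d-1) must cancel the covering constant;
hence the enlargement factor 3 + 2/d, with (3 + 2/d)^d ≤ e^(2/3) 3^d ≤ 2 · 3^d. Both sides are
compared with 1/1455. -/
theorem scale_recursion_one (hd : 2 ≤ d) :
    (3 + 2 / (d : ℝ)) ^ d * (scaleConst d 1 *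
      (1 / (18000 * 3 ^ (d - 1) * d)) ^ (1 / (skewDegree d 1 : ℝ)))
      ≤ (1 / (18000 * 3 ^ (d - 1) * d)) ^ (1 / ((d : ℝ) * (2 * (1 : ℕ) - 1))) := by
  have hdR : (2 : ℝ) ≤ d := by exact_mod_cast hd
  have hk : skewDegree d 1 = 1 := by rw [skewDegree, if_neg (by omega)]
  have h1 : (3 + 2 / (d : ℝ)) ^ d ≤ 2 * 3 ^ d := by
    have e1 : 3 + 2 / (d : ℝ) = 3 * (1 + 2 / 3 / d) := by field_simp
    have e2 : 1 + 2 / 3 / (d : ℝ) ≤ Real.exp (2 / 3 / d) := by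
      linarith [Real.add_one_le_exp (2 / 3 / (d : ℝ))]
    have e3 : Real.exp (2 / 3 / d) ^ d = Real.exp (2 / 3) := by
      rw [← Real.exp_nat_mul]; congr 1; field_simp
    have e4 : Real.exp (2 / 3) ≤ 2 := by
      have := Real.log_two_gt_d9
      rw [← Real.le_log_iff_exp_le (by norm_num)]
      linarith
    rw [e1, mul_pow]
    calc _ ≤ 3 ^ d * Real.exp (2 / 3 / d) ^ d := by gcongr
      _ ≤ _ := by rw [e3]; linarith [mul_le_mul_of_nonneg_left e4 (show (0 : ℝ) ≤ 3 ^ d by positivity)]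
  have hmain : (1 : ℝ) / 1455 ≤
      (1 / (18000 * 3 ^ (d - 1) * d)) ^ (1 / ((d : ℝ) * (2 * (1 : ℕ) - 1))) := by
    have e0 : (d : ℝ) * (2 * (1 : ℕ) - 1) = d := by norm_num
    have e5 : (18000 : ℝ) * 3 ^ (d - 1) * d ≤ 1455 ^ d := by
      have a1 : (18000 : ℝ) ≤ 242 ^ d :=
        le_trans (by norm_num) (pow_le_pow_right₀ (by norm_num) hd : (242 : ℝ) ^ 2 ≤ 242 ^ d)
      have a2 : (d : ℝ) ≤ 2 ^ d := by exact_mod_cast (Nat.lt_two_pow_self (n := d)).le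
      have a3 : (3 : ℝ) ^ (d - 1) ≤ 3 ^ d := pow_le_pow_right₀ (by norm_num) (by omega)
      calc _ ≤ (242 : ℝ) ^ d * 3 ^ d * 2 ^ d := by gcongr
        _ = 1452 ^ d := by rw [← mul_pow, ← mul_pow]; norm_num
        _ ≤ _ := by gcongr; norm_num
    have e6 : (1 / 1455 : ℝ) ^ d ≤ 1 / (18000 * 3 ^ (d - 1) * d) := by
      rw [div_pow, one_pow]
      exact one_div_le_one_div_of_le (by positivity) e5
    rw [e0]
    calc (1 : ℝ) / 1455 = ((1 / 1455 : ℝ) ^ d) ^ (1 / (d : ℝ)) := by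
          rw [one_div (d : ℝ), Real.pow_rpow_inv_natCast (by positivity) (by omega)]
      _ ≤ _ := Real.rpow_le_rpow (by positivity) e6 (by positivity)
  refine le_trans ?_ hmain
  rw [scaleConst, hk]
  norm_num only [Nat.cast_one, div_one, Real.rpow_one, one_mul]
  calc (3 + 2 / (d : ℝ)) ^ d * (d * (103 / 50) * (1 / (18000 * 3 ^ (d - 1) * d)))
      ≤ 2 * 3 ^ d * (d * (103 / 50) * (1 / (18000 * 3 ^ (d - 1) * d))) := by gcongr
    _ = 2 * 3 * (103 / 50) / 18000 := by
      rw [show (3 : ℝ) ^ d = 3 ^ (d - 1) * 3 by rw [← pow_succ]; congr 1; omega]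
      field_simp
    _ ≤ _ := by norm_num

theorem goodExponent_pos (hd : 1 ≤ d) (hl : 1 ≤ l) : 0 < 1 / ((d : ℝ) * (2 * l - 1)) := by
  have hdR : (1 : ℝ) ≤ d := by exact_mod_cast hd
  have hlR : (1 : ℝ) ≤ l := by exact_mod_cast hl
  have : (0 : ℝ) < 2 * l - 1 := by linarith
  positivity

theorem goodExponent_le_one (hd : 1 ≤ d) (hl : 1 ≤ l) : 1 / ((d : ℝ) * (2 * l - 1)) ≤ 1 := by
  have hdR : (1 : ℝ) ≤ d := by exact_mod_cast hd
  have hlR : (1 : ℝ) ≤ l := by exact_mod_cast hl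
  rw [div_le_one (by nlinarith)]
  nlinarith

theorem goodExponent_le (hd : 1 ≤ d) (hl : 1 ≤ l) (hk : 1 ≤ skewDegree d l) :
    1 / ((d : ℝ) * (2 * l - 1)) ≤ 1 / (skewDegree d l : ℝ) := by
  have hdR : (1 : ℝ) ≤ d := by exact_mod_cast hd
  have hlR : (1 : ℝ) ≤ l := by exact_mod_cast hl
  have hkR : (1 : ℝ) ≤ skewDegree d l := by exact_mod_cast hk
  have h1 : ((skewDegree d l : ℕ) : ℝ) ≤ 2 * l - 1 := by
    have : skewDegree d l + 1 ≤ 2 * l := by have := skewDegree_le d l; omega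
    have : ((skewDegree d l + 1 : ℕ) : ℝ) ≤ ((2 * l : ℕ) : ℝ) := by exact_mod_cast this
    push_cast at this
    linarith
  refine one_div_le_one_div_of_le (by linarith) ?_
  nlinarith

theorem SmallBall.volume_lt_le (h : SmallBall d n l x₀ r s₀ M f) {c : E d} {t : ℝ} (ht : 0 < t)
    (hct : ball c t ⊆ ball x₀ (3 ^ (n + 1) * r)) (u₁ u₂ : E n) (c₁ c₂ : ℝ) {ε A : ℝ} (hε : 0 < ε)
    (hε1 : ε ≤ 0.9) (hA : 0 < A)
    (hex : ∃ z ∈ ball c t, A ≤ ‖skewForm (fun z => inner ℝ u₁ (f z) + c₁)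
      (fun z => inner ℝ u₂ (f z) + c₂) z‖) :
    volume {z | z ∈ ball c t ∧ ‖skewForm (fun z => inner ℝ u₁ (f z) + c₁)
      (fun z => inner ℝ u₂ (f z) + c₂) z‖ < ε * A}
      ≤ ENNReal.ofReal (2.1 * d * l * ((l : ℝ) + 1) ^ (1 / (l : ℝ))
        * ε ^ (1 / ((d : ℝ) * (2 * l - 1)))) * volume (ball c t) := by
  have hd := h.hd
  have hl := h.hl
  have hdR : (1 : ℝ) ≤ d := by exact_mod_cast hd
  have hcont := (h.derivBound.continuousOn_skewForm hl u₁ u₂ c₁ c₂).norm.mono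
    (hct.trans (ball_subset_closedBall.trans h.closedBall_subset))
  rcases Nat.eq_zero_or_pos (skewDegree d l) with hk | hk
  · obtain ⟨z₀, hz₀, hAz⟩ := hex
    -- For d = l = 1 the norm stays above 0.9 A, so the set is empty.
    refine (measure_mono_null (t := ∅) ?_ measure_empty).le.trans zero_le
    rintro z ⟨hz, hlt⟩
    have := h.le_norm_of_degree_zero hct hk u₁ u₂ c₁ c₂ hA hz₀ hAz hz
    nlinarith
  · have hrec : ∃ ε₀ : ℝ, 0 < ε₀ ∧ ε₀ < 1 ∧
        1200 * accuracy d l * growthConst l (1.01 * markovConst l) ≤ ε₀ ∧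
        (3 + 2 / (d : ℝ)) ^ d * (scaleConst d l * ε₀ ^ (1 / (skewDegree d l : ℝ)))
          ≤ ε₀ ^ (1 / ((d : ℝ) * (2 * l - 1))) := by
      rcases Nat.lt_or_ge l 2 with hl2 | hl2
      · obtain rfl : l = 1 := by omega
        have hd2 : 2 ≤ d := by
          rw [skewDegree] at hk
          split_ifs at hk <;> omega
        have h3 : (1 : ℝ) ≤ 3 ^ (d - 1) := one_le_pow₀ (by norm_num)
        refine ⟨_, by positivity, ?_, accuracy_growth_one hd, scale_recursion_one hd2⟩
        rw [div_lt_one (by positivity)]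
        calc (1 : ℝ) < 18000 * 1 * 1 := by norm_num
          _ ≤ _ := by gcongr
      · have hX := four_le_etaBase hd hl
        refine ⟨_, by positivity, pow_lt_one₀ (by positivity) ?_ ?_, accuracy_growth_le hd hl2,
          scale_recursion_of_two_le hd hl2⟩
        · rw [div_lt_one (by linarith)]; linarith
        · exact Nat.mul_ne_zero (Nat.mul_ne_zero (by omega) (by omega)) (by omega)
    obtain ⟨ε₀, hε₀, hε₀1, hκ, hrec⟩ := hrec
    refine (volume_lt_le_of_scale ht hcont hε₀ hε₀1 (scaleConst_nonneg d l) (goodExponent_le hd hl hk)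
      (by have : 0 < 2 / (d : ℝ) := by positivity
          linarith) hrec ?_ hε (hε1.trans (by norm_num)) hA hex).trans ?_
    · intro x hx s hs hst ε' h1 h2 A' hA' hex'
      exact h.volume_lt_le_at_scale hct hk u₁ u₂ c₁ c₂ hx hs hst (hε₀.trans_le h1) (hκ.trans h1) h2
        hA' hex'
    · gcongr
      exact scaleConst_le d hl hk

theorem SmallBall.isGood (h : SmallBall d n l x₀ r s₀ M f) (u₁ u₂ : E n) (c₁ c₂ : ℝ) :
    IsGood (2 * goodConst d l) (1 / ((d : ℝ) * (2 * (l : ℝ) - 1))) (ball x₀ (3 ^ (n + 1) * r))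
      (fun x => ‖skewForm (fun z => inner ℝ u₁ (f z) + c₁) (fun z => inner ℝ u₂ (f z) + c₂) x‖) := by
  have hd := h.hd
  have hl := h.hl
  have hdR : (1 : ℝ) ≤ d := by exact_mod_cast hd
  have hlR : (1 : ℝ) ≤ l := by exact_mod_cast hl
  intro c t hct ε hε
  set F := fun x => ‖skewForm (fun z => inner ℝ u₁ (f z) + c₁) (fun z => inner ℝ u₂ (f z) + c₂) x‖
    with hF
  set α := 1 / ((d : ℝ) * (2 * (l : ℝ) - 1)) with hα
  have hα0 : 0 < α := goodExponent_pos hd hl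
  have hα1 : α ≤ 1 := goodExponent_le_one hd hl
  rcases le_or_gt t 0 with ht | ht
  · rw [ball_eq_empty.2 ht]; simp
  have hgood := le_two_mul_goodConst d l
  set Q := (d : ℝ) * l * ((l : ℝ) + 1) ^ (1 / (l : ℝ)) with hQ
  have hQ1 : 1 ≤ Q := by
    have : (1 : ℝ) ≤ ((l : ℝ) + 1) ^ (1 / (l : ℝ)) :=
      Real.one_le_rpow (by linarith) (by positivity)
    exact one_le_mul_of_one_le_of_one_le (one_le_mul_of_one_le_of_one_le hdR hlR) this
  have hgood' : 4 * Q ≤ 2 * goodConst d l := by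
    rw [hQ]; linarith
  -- For ε ≥ 1/2 the claimed bound already exceeds the volume of the ball.
  rcases le_or_gt (1 / 2) ε with hε2 | hε2
  · have h1 : (1 : ℝ) ≤ 2 * goodConst d l * ε ^ α := by
      have e1 : (1 / 2 : ℝ) ≤ ε ^ α := by
        calc (1 / 2 : ℝ) = (1 / 2 : ℝ) ^ (1 : ℝ) := by rw [Real.rpow_one]
          _ ≤ (1 / 2 : ℝ) ^ α :=
            Real.rpow_le_rpow_of_exponent_ge (by norm_num) (by norm_num) hα1
          _ ≤ ε ^ α := Real.rpow_le_rpow (by norm_num) hε2 hα0.le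
      nlinarith
    calc _ ≤ volume (ball c t) := measure_mono fun x hx => hx.1
      _ = 1 * volume (ball c t) := (one_mul _).symm
      _ ≤ _ := by
        refine mul_le_mul_left ?_ _
        rwa [ENNReal.one_le_ofReal]
  set S := ⨆ y ∈ ball c t, ‖F y‖ₑ with hS
  have hcomp : IsCompact (closedBall x₀ (3 ^ (n + 1) * r)) := isCompact_closedBall _ _
  obtain ⟨B, hB⟩ := hcomp.exists_bound_of_continuousOn
    ((h.derivBound.continuousOn_skewForm hl u₁ u₂ c₁ c₂).norm.mono h.closedBall_subset)
  have hfin : S ≠ ⊤ := by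
    refine ne_top_of_le_ne_top (b := ENNReal.ofReal B) ENNReal.ofReal_ne_top (iSup₂_le fun y hy => ?_)
    rw [← ofReal_norm]
    exact ENNReal.ofReal_le_ofReal (hB y (ball_subset_closedBall (hct hy)))
  rcases eq_or_ne S 0 with h0 | h0
  · rw [h0]; simp
  have hS' : S = ENNReal.ofReal S.toReal := (ENNReal.ofReal_toReal hfin).symm
  have hSpos : 0 < S.toReal := ENNReal.toReal_pos h0 hfin
  -- The supremum over the open ball may not be attained. Dividing by 1.5 gives an attained level;
  -- then 1.5 ε ≤ 0.75 < 0.9, and 2.1 · 1.5 = 3.15 ≤ 4 leaves room for the loss.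
  set A := S.toReal / 1.5 with hA
  have hA0 : 0 < A := by positivity
  have hFn : ∀ y, ‖F y‖ₑ = ENNReal.ofReal (F y) := fun y =>
    Real.enorm_of_nonneg (norm_nonneg _)
  have hex : ∃ z ∈ ball c t, A ≤ F z := by
    have h1 : ENNReal.ofReal A < S := by
      rw [hS']
      exact (ENNReal.ofReal_lt_ofReal_iff hSpos).2 (by rw [hA, div_lt_iff₀ (by norm_num)]; linarith)
    rw [hS, lt_iSup_iff] at h1
    obtain ⟨z, hz⟩ := h1
    rw [lt_iSup_iff] at hz
    obtain ⟨hzb, hz⟩ := hz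
    rw [hFn] at hz
    exact ⟨z, hzb, ((ENNReal.ofReal_lt_ofReal_iff_of_nonneg hA0.le).1 hz).le⟩
  have hv := h.volume_lt_le ht hct u₁ u₂ c₁ c₂ (ε := 1.5 * ε) (by positivity) (by linarith) hA0 hex
  refine (measure_mono ?_).trans (hv.trans ?_)
  · rintro z ⟨hz, hlt⟩
    refine ⟨hz, ?_⟩
    rw [hFn, hS', ← ENNReal.ofReal_mul hε.le] at hlt
    have h1 := (ENNReal.ofReal_lt_ofReal_iff_of_nonneg (norm_nonneg _)).1 hlt
    calc F z < ε * S.toReal := h1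
      _ = 1.5 * ε * A := by rw [hA]; ring
  · gcongr ENNReal.ofReal ?_ * _
    have e1 : (1.5 * ε) ^ α ≤ 1.5 * ε ^ α := by
      rw [Real.mul_rpow (by norm_num) hε.le]
      gcongr
      calc (1.5 : ℝ) ^ α ≤ 1.5 ^ (1 : ℝ) := Real.rpow_le_rpow_of_exponent_le (by norm_num) hα1
        _ = 1.5 := Real.rpow_one _
    calc 2.1 * (d : ℝ) * l * ((l : ℝ) + 1) ^ (1 / (l : ℝ)) * (1.5 * ε) ^ α
        = 2.1 * Q * (1.5 * ε) ^ α := by rw [hQ]; ring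
      _ ≤ 2.1 * Q * (1.5 * ε ^ α) := by gcongr
      _ = 3.15 * Q * ε ^ α := by ring
      _ ≤ 4 * Q * ε ^ α := by gcongr; norm_num
      _ ≤ _ := by gcongr

theorem norm_skewGradient_pairMap (f : E d → E n) (u₁ u₂ : E n) (u₀ : ℝ) (x : E d) :
    ‖skewGradient (pairMap f u₁ u₂ u₀) x‖
      = ‖skewForm (fun z => inner ℝ u₁ (f z) + 0) (fun z => inner ℝ u₂ (f z) + u₀) x‖ := by
  rw [← LinearIsometryEquiv.norm_map (InnerProductSpace.toDual ℝ (E d)).symm]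
  simp only [skewGradient, pairMap, skewForm, gradient, add_zero, map_sub, map_smul]

end SkewGood

/-! ### Part (b): lower bound for the supremum of the skew gradient -/

namespace SkewGood

variable {d n l : ℕ} {M : ℝ} {f : E d → E n} {x₀ : E d} {r s₀ : ℝ} {W : Set (E d)}

theorem DerivBound.norm_fderiv_le (hf : DerivBound l M f W) {x : E d} (hx : x ∈ W) :
    ‖fderiv ℝ f x‖ ≤ M := by
  refine ContinuousLinearMap.opNorm_le_bound _ hf.nonneg fun v => ?_
  have := hf.bound 1 le_rfl (by omega) x hx fun _ => v
  simpa [iteratedFDeriv_one_apply] using this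

theorem DerivBound.abs_inner_sub_le (hf : DerivBound l M f W) {w : E n} (hw : ‖w‖ = 1) (c : ℝ)
    {x z : E d} {R : ℝ} (hxW : closedBall x R ⊆ W) (hz : z ∈ closedBall x R) :
    |(inner ℝ w (f z) + c) - (inner ℝ w (f x) + c)| ≤ M * R := by
  have hR : 0 ≤ R := dist_nonneg.trans (mem_closedBall.1 hz)
  have h := (convex_closedBall x R).norm_image_sub_le_of_norm_hasFDerivWithin_le
    (f := fun z => inner ℝ w (f z) + c) (C := M)
    (fun y hy => (hf.hasFDerivAt_inner w c (hxW hy)).hasFDerivWithinAt) (fun y hy => by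
      refine (ContinuousLinearMap.opNorm_comp_le _ _).trans ?_
      rw [innerSL_apply_norm, hw, one_mul]
      exact hf.norm_fderiv_le (hxW hy)) (mem_closedBall_self hR) hz
  rw [Real.norm_eq_abs] at h
  refine h.trans ?_
  have := hf.nonneg
  gcongr
  rwa [← dist_eq_norm, ← mem_closedBall]

/-- If the angle of a planar curve varies slowly, the curve stays close to a line. -/
theorem DerivBound.abs_le_of_norm_skewForm_le (hf : DerivBound l M f W) {w₁ w₂ : E n}
    (hw₁ : ‖w₁‖ = 1) {c₁ c₂ : ℝ} {x : E d} {R T H : ℝ} (hxW : closedBall x R ⊆ W) (hMT : M * R < T)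
    (h₁ : inner ℝ w₁ (f x) + c₁ = T) (h₂ : inner ℝ w₂ (f x) + c₂ = 0)
    (hH : ∀ z ∈ closedBall x R, ‖skewForm (fun z => inner ℝ w₁ (f z) + c₁)
      (fun z => inner ℝ w₂ (f z) + c₂) z‖ ≤ H) {z : E d} (hz : z ∈ closedBall x R) :
    |inner ℝ w₂ (f z) + c₂| ≤ H / (T - M * R) ^ 2 * R * (T + M * R) := by
  set N : E d → ℝ := fun z => inner ℝ w₁ (f z) + c₁ with hN
  set D : E d → ℝ := fun z => inner ℝ w₂ (f z) + c₂ with hD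
  have hR : 0 ≤ R := dist_nonneg.trans (mem_closedBall.1 hz)
  have hNb : ∀ y ∈ closedBall x R, T - M * R ≤ N y ∧ N y ≤ T + M * R := fun y hy => by
    have := abs_le.1 (hf.abs_inner_sub_le hw₁ c₁ hxW hy)
    rw [h₁] at this
    constructor <;> simp only [hN] <;> linarith
  have hm : 0 < T - M * R := by linarith
  have hH0 : 0 ≤ H := (norm_nonneg _).trans (hH z hz)
  -- D/N is the tangent of the angle of the curve; its gradient is the skew gradient divided by N².
  have hq : ∀ y ∈ closedBall x R, HasFDerivWithinAt (fun y => D y / N y)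
      ((N y ^ 2)⁻¹ • skewForm N D y) (closedBall x R) y := fun y hy => by
    have hNy : N y ≠ 0 := (hm.trans_le (hNb y hy).1).ne'
    have e1 := (hf.hasFDerivAt_inner w₂ c₂ (hxW hy)).differentiableAt.hasFDerivAt
    have e2 := (hf.hasFDerivAt_inner w₁ c₁ (hxW hy)).differentiableAt.hasFDerivAt
    have e3 := e1.mul ((hasDerivAt_inv hNy).comp_hasFDerivAt y e2)
    refine (e3.congr_fderiv ?_).hasFDerivWithinAt
    ext v
    simp only [add_apply, smul_apply, smul_eq_mul, skewForm_apply, Function.comp_apply]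
    field_simp
    ring
  have hmv := (convex_closedBall x R).norm_image_sub_le_of_norm_hasFDerivWithin_le
    (C := H / (T - M * R) ^ 2) hq (fun y hy => by
      have h3 := (hNb y hy).1
      have h4 : (T - M * R) ^ 2 ≤ N y ^ 2 := by gcongr
      rw [norm_smul, norm_inv, Real.norm_of_nonneg (by positivity), inv_mul_eq_div]
      have := hH y hy
      gcongr) (mem_closedBall_self hR) hz
  have hDx : D x = 0 := h₂
  rw [hDx, zero_div, sub_zero, norm_div, Real.norm_eq_abs, Real.norm_eq_abs] at hmv
  have hNz := hNb z hz
  have hNz0 : 0 < N z := hm.trans_le hNz.1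
  rw [abs_of_pos hNz0, div_le_iff₀ hNz0] at hmv
  have hzx : ‖z - x‖ ≤ R := by rwa [← dist_eq_norm, ← mem_closedBall]
  refine hmv.trans ?_
  gcongr
  exact hNz.2

theorem DerivBound.skewForm_rotate (hf : DerivBound l M f W) (u₁ u₂ : E n) (c₁ c₂ : ℝ) {p q : ℝ}
    (hpq : p ^ 2 + q ^ 2 = 1) {z : E d} (hz : z ∈ W) :
    skewForm (fun z => inner ℝ (p • u₁ + q • u₂) (f z) + (p * c₁ + q * c₂))
      (fun z => inner ℝ (p • u₂ - q • u₁) (f z) + (p * c₂ - q * c₁)) z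
      = skewForm (fun z => inner ℝ u₁ (f z) + c₁) (fun z => inner ℝ u₂ (f z) + c₂) z := by
  ext e
  rw [skewForm_apply, skewForm_apply, (hf.hasFDerivAt_inner _ _ hz).fderiv,
    (hf.hasFDerivAt_inner _ _ hz).fderiv, (hf.hasFDerivAt_inner _ _ hz).fderiv,
    (hf.hasFDerivAt_inner _ _ hz).fderiv]
  simp only [ContinuousLinearMap.comp_apply, innerSL_apply_apply, inner_add_left, inner_sub_left,
    real_inner_smul_left]
  generalize inner ℝ u₁ (f z) = a
  generalize inner ℝ u₂ (f z) = b
  generalize inner ℝ u₁ (fderiv ℝ f z e) = a'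
  generalize inner ℝ u₂ (fderiv ℝ f z e) = b'
  linear_combination ((a + c₁) * b' - (b + c₂) * a') * hpq

theorem two_pow_le_factorial_succ (l : ℕ) : (2 : ℝ) ^ l ≤ (l + 1).factorial := by
  have := Nat.factorial_mul_pow_le_factorial (m := 1) (n := l)
  rw [Nat.factorial_one, one_mul, Nat.add_comm 1 l, one_add_one_eq_two] at this
  exact_mod_cast this

theorem SmallBall.tau_pos (h : SmallBall d n l x₀ r s₀ M f) : 0 < tau l s₀ r := by
  have hl : (0 : ℝ) < l := by exact_mod_cast h.hl
  have := h.hr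
  have := h.hs₀
  have hfac : (0 : ℝ) < (l + 1).factorial := by exact_mod_cast Nat.factorial_pos (l + 1)
  rw [tau]; positivity

theorem SmallBall.radius_le_one_and_le (h : SmallBall d n l x₀ r s₀ M f) : r ≤ 1 ∧ r ≤ 3 ^ (n + 1) * r := by
  have h1 := h.radius_le_one
  have hr := h.hr
  have h3 : (1 : ℝ) ≤ 3 ^ (n + 1) := one_le_pow₀ (by norm_num)
  have : r ≤ 3 ^ (n + 1) * r := le_mul_of_one_le_left hr.le h3
  exact ⟨by linarith, this⟩

theorem SmallBall.tau_le (h : SmallBall d n l x₀ r s₀ M f) : tau l s₀ r ≤ M * r / 4 := by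
  have hl : (1 : ℝ) ≤ l := by exact_mod_cast h.hl
  have hr := h.hr
  have hs₀ := h.hs₀
  have hM := h.hM
  have hfac : (1 : ℝ) ≤ (l + 1).factorial := by exact_mod_cast Nat.factorial_pos (l + 1)
  have h1 : r ^ l ≤ r := by
    calc r ^ l ≤ r ^ 1 := pow_le_pow_of_le_one hr.le h.radius_le_one_and_le.1 h.hl
      _ = r := pow_one r
  have hl' : (1 : ℝ) ≤ (l : ℝ) ^ l := one_le_pow₀ hl
  rw [tau]
  calc _ ≤ r * M / (4 * 1 * 1) := by
        have := h.hsM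
        gcongr
    _ = _ := by ring

/-- The image of every ball of radius `R` in `U` deviates from each line by a definite amount. -/
theorem SmallBall.le_of_abs_le (h : SmallBall d n l x₀ r s₀ M f) {y : E d} {R : ℝ} (hR : 0 < R)
    (hRr : R ≤ r) (hyU : closedBall y R ⊆ ball x₀ r) {w : E n} (hw : ‖w‖ = 1) (c : ℝ) {A : ℝ}
    (hA : ∀ z ∈ closedBall y R, |inner ℝ w (f z) + c| ≤ A) :
    0.99 * s₀ * (R / l) ^ l ≤ A := by
  have hr := h.radius_le_one_and_le
  have hs := h.hs₀
  have hM := h.hM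
  have hW : closedBall y R ⊆ ball x₀ (3 ^ (n + d + 2) * r) := hyU.trans
    ((ball_subset_ball hr.2).trans (ball_subset_closedBall.trans h.closedBall_subset))
  have hMR : M * R ≤ 1e-6 * s₀ := le_trans (by gcongr; exact hRr.trans hr.2) h.mul_radius_le
  have := h.derivBound.le_of_abs_le hR (hRr.trans hr.1) hW (s₁ := 0.995 * s₀) (by linarith)
    (h.nondeg _ (by linarith) y (hW (mem_closedBall_self hR.le))) w c hA
  rw [hw, mul_one] at this
  refine le_trans ?_ this
  gcongr
  linarith

/-- Otherwise the deviation bound on the half ball would give 3.96 (l+1)! ≤ 2^l. Half the radius is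
kept as room for a ball around z inside U. -/
theorem SmallBall.exists_tau_lt (h : SmallBall d n l x₀ r s₀ M f) {w : E n} (hw : ‖w‖ = 1) (c : ℝ) :
    ∃ z ∈ closedBall x₀ (r / 2), tau l s₀ r < |inner ℝ w (f z) + c| := by
  have hr := h.hr
  by_contra! hcon
  have h1 := h.le_of_abs_le (half_pos hr) (by linarith) (closedBall_subset_ball (by linarith)) hw c hcon
  have hl : (0 : ℝ) < l := by exact_mod_cast h.hl
  have hfac := two_pow_le_factorial_succ l
  have hfac0 : (0 : ℝ) < (l + 1).factorial := by exact_mod_cast Nat.factorial_pos (l + 1)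
  have hs := h.hs₀
  rw [tau, le_div_iff₀ (by positivity), div_pow, div_pow] at h1
  have e1 : 0.99 * s₀ * (r ^ l / 2 ^ l / (l : ℝ) ^ l) * (4 * (l : ℝ) ^ l * ((l + 1).factorial : ℝ))
      = r ^ l * s₀ * (3.96 * (l + 1).factorial / 2 ^ l) := by field_simp; ring
  rw [e1] at h1
  have e2 : r ^ l * s₀ * (3.96 * (l + 1).factorial / 2 ^ l) ≤ r ^ l * s₀ * 1 := by linarith
  have e3 := le_of_mul_le_mul_left e2 (by positivity)
  rw [div_le_one (by positivity)] at e3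
  linarith

theorem rhoTwo_le_of_le (hl : 1 ≤ l) (hs : 0 < s₀) (hM : 1 ≤ M) (hτ : 0 < tau l s₀ r) {H : ℝ}
    (hH : 0 ≤ H) (hdev : 0.99 * s₀ * (1 / √2 * tau l s₀ r / M / l) ^ l
      ≤ H * (1 / √2 * tau l s₀ r / M) * (1 + 1 / √2) / (tau l s₀ r * (1 - 1 / √2) ^ 2)) :
    rhoTwo l s₀ M r ≤ H := by
  have hfac := two_pow_le_factorial_succ l
  have hfac0 : (0 : ℝ) < (l + 1).factorial := by exact_mod_cast Nat.factorial_pos (l + 1)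
  obtain ⟨m, rfl⟩ : ∃ m, l = m + 1 := ⟨l - 1, by omega⟩
  rw [rhoTwo, Nat.add_sub_cancel]
  generalize tau (m + 1) s₀ r = τ at *
  have h2 : (0 : ℝ) < √2 := by positivity
  have hδ0 : 0 < 1 / √2 := by positivity
  have hδ1 : 1 / √2 < 1 := by
    rw [div_lt_one h2]; exact Real.lt_sqrt_of_sq_lt (by norm_num)
  have hδsq : (1 / √2) ^ 2 = (1 / 2 : ℝ) := by rw [div_pow, one_pow, Real.sq_sqrt (by norm_num)]
  generalize 1 / √2 = δ at *
  have hδ' : 0 < 1 - δ := by linarith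
  have hR : δ * τ / M = δ * (τ / M) := mul_div_assoc _ _ _
  have hR0 : 0 < δ * τ / M := by positivity
  generalize δ * τ / M = R at *
  set c₀ := s₀ / (4 * ((m + 1 : ℕ) : ℝ) ^ (m + 1) * ((m + 1 + 1).factorial : ℝ)) with hc₀
  have hc₀0 : 0 < c₀ := by positivity
  -- The factor δ^m lost from R = δτ/M is compensated by the factorial in c₀.
  have hlow : c₀ * (τ / M) ^ m * R ≤ 0.99 * s₀ * (R / (m + 1 : ℕ)) ^ (m + 1) := by
    have e1 : 0.99 * s₀ * (R / (m + 1 : ℕ)) ^ (m + 1)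
        = c₀ * (τ / M) ^ m * R * (3.96 * ((m + 1 + 1).factorial * δ ^ m)) := by
      rw [hc₀, div_pow, pow_succ R, show R ^ m = δ ^ m * (τ / M) ^ m by rw [hR, mul_pow]]
      field_simp
      ring
    rw [e1]
    refine le_mul_of_one_le_right (by positivity) ?_
    have e2 : (1 / 2 : ℝ) ^ m ≤ δ ^ m := by
      refine pow_le_pow_left₀ (by norm_num) ?_ m
      nlinarith
    have e3 : (1 : ℝ) ≤ (m + 1 + 1).factorial * δ ^ m := by
      calc (1 : ℝ) ≤ 2 ^ (m + 1) * (1 / 2) ^ m := by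
            rw [pow_succ, mul_right_comm, ← mul_pow]; norm_num
        _ ≤ _ := by gcongr
    linarith
  have hfin : c₀ * (τ / M) ^ m * (τ * (1 - δ) ^ 2) ≤ H * (1 + δ) := by
    have e1 := hlow.trans hdev
    rw [le_div_iff₀ (by positivity)] at e1
    refine le_of_mul_le_mul_right (a := R) ?_ hR0
    linarith
  -- Only the second term under the root in `rhoTwo` is needed: dropping the first only enlarges the
  -- bound to be proved.
  have hsq : τ * (1 + δ) ≤ √((c₀ * (τ / M) ^ (m + 1)) ^ 2 + (τ * (1 + δ)) ^ 2) :=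
    Real.le_sqrt_of_sq_le (by nlinarith [sq_nonneg (c₀ * (τ / M) ^ (m + 1))])
  rw [mul_div_assoc', div_le_iff₀ (lt_of_lt_of_le (by positivity) hsq)]
  calc c₀ * (τ / M) ^ m * (τ * (1 - δ)) ^ 2 = c₀ * (τ / M) ^ m * (τ * (1 - δ) ^ 2) * τ := by ring
    _ ≤ H * (1 + δ) * τ := by gcongr
    _ = H * (τ * (1 + δ)) := by ring
    _ ≤ _ := by gcongr

/-- The estimate for the second coordinate improves as |g(x)| = T grows, so T = τ is the worst case.
-/
theorem div_sq_mul_le {T τ δ R H : ℝ} (hδ0 : 0 < δ) (hδ1 : δ < 1) (hτ : 0 < τ) (hTτ : τ ≤ T)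
    (hR : 0 ≤ R) (hH : 0 ≤ H) :
    H / (T - δ * τ) ^ 2 * R * (T + δ * τ) ≤ H * R * (1 + δ) / (τ * (1 - δ) ^ 2) := by
  have hT : 0 < T := hτ.trans_le hTτ
  have hδ' : 0 < 1 - δ := by linarith
  have h1 := mul_le_mul_of_nonneg_left hTτ hδ0.le
  have e1 : T * (1 - δ) ≤ T - δ * τ := by linarith
  have e2 : T + δ * τ ≤ T * (1 + δ) := by linarith
  calc H / (T - δ * τ) ^ 2 * R * (T + δ * τ) ≤ H / (T * (1 - δ)) ^ 2 * R * (T * (1 + δ)) := by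
        gcongr
    _ = H * R * (1 + δ) / (T * (1 - δ) ^ 2) := by field_simp
    _ ≤ _ := by gcongr

theorem SmallBall.rhoTwo_le (h : SmallBall d n l x₀ r s₀ M f) {u₁ u₂ : E n} (hu : inner ℝ u₁ u₂ = 0)
    (hu₁ : ‖u₁‖ = 1) (hu₂ : ‖u₂‖ = 1) (c₁ c₂ : ℝ) {H : ℝ}
    (hH : ∀ z ∈ ball x₀ r, ‖skewForm (fun z => inner ℝ u₁ (f z) + c₁)
      (fun z => inner ℝ u₂ (f z) + c₂) z‖ ≤ H) : rhoTwo l s₀ M r ≤ H := by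
  have hr := h.hr
  have hM := h.hM
  have hs := h.hs₀
  have hl : (0 : ℝ) < l := by exact_mod_cast h.hl
  have hf := h.derivBound
  have hτ := h.tau_pos
  have hτM := h.tau_le
  obtain ⟨x, hx, hxτ⟩ := h.exists_tau_lt hu₁ c₁
  set τ := tau l s₀ r with hτdef
  set δ := 1 / √2 with hδ
  have h2 : (0 : ℝ) < √2 := by positivity
  have hδ0 : 0 < δ := by positivity
  have hδ1 : δ < 1 := by
    rw [hδ, div_lt_one h2]; exact Real.lt_sqrt_of_sq_lt (by norm_num)
  have hδsq : δ ^ 2 = 1 / 2 := by rw [hδ, div_pow, one_pow, Real.sq_sqrt (by norm_num)]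
  -- The radius for which MR = δτ: the first coordinate then varies by at most δτ < T and keeps its
  -- sign.
  set R := δ * τ / M with hR
  have hR0 : 0 < R := by positivity
  have hMR : M * R = δ * τ := by rw [hR]; field_simp
  have hRr : R < r / 2 := by
    have : M * R < M * (r / 2) := by rw [hMR]; nlinarith
    exact lt_of_mul_lt_mul_left this (by linarith)
  have hxU : closedBall x R ⊆ ball x₀ r := by
    intro z hz
    have := mem_closedBall.1 hz
    have := mem_closedBall.1 hx
    rw [mem_ball]
    linarith [dist_triangle z x x₀]
  have hUW : ball x₀ r ⊆ ball x₀ (3 ^ (n + d + 2) * r) := (ball_subset_ball h.radius_le_one_and_le.2).trans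
    (ball_subset_closedBall.trans h.closedBall_subset)
  set α := inner ℝ u₁ (f x) + c₁ with hα
  set β := inner ℝ u₂ (f x) + c₂ with hβ
  set T := √(α ^ 2 + β ^ 2) with hT
  have hTτ : τ ≤ T := by
    refine hxτ.le.trans (Real.abs_le_sqrt ?_)
    nlinarith [sq_nonneg β]
  have hT0 : 0 < T := hτ.trans_le hTτ
  have hTsq : T ^ 2 = α ^ 2 + β ^ 2 := Real.sq_sqrt (by positivity)
  have hpq : (α / T) ^ 2 + (β / T) ^ 2 = 1 := by
    rw [div_pow, div_pow, ← add_div, ← hTsq, div_self (by positivity)]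
  obtain ⟨p, hp⟩ : ∃ p, p = α / T := ⟨_, rfl⟩
  obtain ⟨q, hq⟩ : ∃ q, q = β / T := ⟨_, rfl⟩
  -- The rotation by the angle of g(x), with cosine p and sine q, puts g(x) on the first axis and
  -- leaves the skew gradient unchanged.
  rw [← hp, ← hq] at hpq
  have hn : ∀ p' q' : ℝ, ‖p' • u₁ + q' • u₂‖ ^ 2 = p' ^ 2 + q' ^ 2 := fun p' q' => by
    rw [norm_add_sq_real, norm_smul, norm_smul, real_inner_smul_left, real_inner_smul_right, hu, hu₁,
      hu₂]
    simp
  have hw₁ : ‖p • u₁ + q • u₂‖ = 1 := by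
    rw [← sq_eq_sq₀ (norm_nonneg _) zero_le_one, hn, hpq, one_pow]
  have hw₂ : ‖p • u₂ - q • u₁‖ = 1 := by
    rw [← sq_eq_sq₀ (norm_nonneg _) zero_le_one, sub_eq_neg_add, ← neg_smul, hn, neg_sq, add_comm, hpq,
      one_pow]
  have hMT : M * R < T := by rw [hMR]; nlinarith
  have hx1 : inner ℝ (p • u₁ + q • u₂) (f x) + (p * c₁ + q * c₂) = T := by
    rw [inner_add_left, real_inner_smul_left, real_inner_smul_left]
    calc _ = p * α + q * β := by rw [hα, hβ]; ring
      _ = (α ^ 2 + β ^ 2) / T := by rw [hp, hq]; ring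
      _ = T := by rw [← hTsq]; field_simp
  have hx2 : inner ℝ (p • u₂ - q • u₁) (f x) + (p * c₂ - q * c₁) = 0 := by
    rw [inner_sub_left, real_inner_smul_left, real_inner_smul_left]
    calc _ = p * β - q * α := by rw [hα, hβ]; ring
      _ = 0 := by rw [hp, hq]; ring
  have hrot : ∀ y ∈ closedBall x R,
      ‖skewForm (fun z => inner ℝ (p • u₁ + q • u₂) (f z) + (p * c₁ + q * c₂))
        (fun z => inner ℝ (p • u₂ - q • u₁) (f z) + (p * c₂ - q * c₁)) y‖ ≤ H := fun y hy =>
    (congrArg norm (hf.skewForm_rotate u₁ u₂ c₁ c₂ hpq (hUW (hxU hy)))).trans_le (hH y (hxU hy))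
  have hdev := h.le_of_abs_le hR0 (by linarith) hxU hw₂ (p * c₂ - q * c₁)
    fun z hz => hf.abs_le_of_norm_skewForm_le hw₁ (hxU.trans hUW) hMT hx1 hx2 hrot hz
  have hH0 : 0 ≤ H := (norm_nonneg _).trans (hH x (hxU (mem_closedBall_self hR0.le)))
  have hdev2 : 0.99 * s₀ * (R / l) ^ l ≤ H * R * (1 + δ) / (τ * (1 - δ) ^ 2) := by
    refine hdev.trans ?_
    rw [hMR]
    exact div_sq_mul_le hδ0 hδ1 hτ hTτ hR0.le hH0
  exact rhoTwo_le_of_le h.hl hs hM hτ hH0 hdev2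

/-- Boundedness is needed for the real `sSup` in (b) to dominate the values; it follows from
continuity on a larger compact ball. -/
theorem SmallBall.bddAbove_image (h : SmallBall d n l x₀ r s₀ M f) (u₁ u₂ : E n) (c₁ c₂ : ℝ) :
    BddAbove ((fun x => ‖skewForm (fun z => inner ℝ u₁ (f z) + c₁)
      (fun z => inner ℝ u₂ (f z) + c₂) x‖) '' ball x₀ r) := by
  have hc := (h.derivBound.continuousOn_skewForm h.hl u₁ u₂ c₁ c₂).norm.mono h.closedBall_subset
  refine ((isCompact_closedBall _ _).bddAbove_image hc).mono (Set.image_mono ?_)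
  exact (ball_subset_ball h.radius_le_one_and_le.2).trans ball_subset_closedBall

theorem smallBall_of_le_radiusBound (hd : 1 ≤ d) (hn : 1 ≤ n) (hl : 1 ≤ l) (hr : 0 < r)
    (hf : ContDiffOn ℝ ((l + 1 : ℕ) : WithTop ℕ∞) f (closedBall x₀ (3 ^ (n + d + 2) * r)))
    (hs₀ : s₀ = nondegMeasure l f (ball x₀ (3 ^ (n + d + 2) * r))) (hM : 1 ≤ M)
    (hfM : ∀ k : ℕ, 1 ≤ k → k ≤ l + 1 → ∀ u : Fin k → E d, (∀ i, ‖u i‖ = 1) →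
      ∀ x ∈ ball x₀ (3 ^ (n + d + 2) * r), ‖iteratedFDeriv ℝ k f x u‖ ≤ M)
    (hrad : r ≤ radiusBound d n l s₀ M) : SmallBall d n l x₀ r s₀ M f := by
  have hD := derivBound_of_contDiffOn hf (by linarith) hfM
  have hrad' := hrad.trans (min_le_right _ _)
  -- Since r > 0, the upper bound on r itself forces s₀ > 0.
  have hpos : 0 < s₀ := by
    have h1 := hr.trans_le hrad'
    have hη := eta_pos d l hd hl
    have hdR : (0 : ℝ) < d := by exact_mod_cast hd
    have hlR : (0 : ℝ) < l := by exact_mod_cast hl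
    have hfac : (0 : ℝ) < (l + 1).factorial := by exact_mod_cast Nat.factorial_pos (l + 1)
    rw [lt_div_iff₀ (by positivity), zero_mul] at h1
    exact pos_of_mul_pos_right h1 hη.le
  have hnd : ∀ s < s₀, NondegOn l s f (ball x₀ (3 ^ (n + d + 2) * r)) := fun s hs =>
    hD.nondegOn (hs₀ ▸ hpos) (hs₀ ▸ hs)
  exact ⟨hd, hl, hr, hM, hpos, le_of_forall_lt fun s hs => by
    obtain ⟨s', h1, h2⟩ := exists_between hs
    exact h1.trans_le (hD.le_of_nondegOn hn ⟨x₀, mem_ball_self (by positivity)⟩ (hnd s' h2)),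
    hD, hnd, hrad'⟩

end SkewGood

theorem mainTheorem9 (d n l : ℕ) (hd : 1 ≤ d) (hn : 1 ≤ n) (hl : 1 ≤ l)
    (x₀ : SkewGood.E d) (r : ℝ) (hr : 0 < r)
    (f : SkewGood.E d → SkewGood.E n)
    -- `f` is `C^{l+1}` and `l`-non-degenerate on the closure of the ball `3^{n+d+2} U`
    (hf : ContDiffOn ℝ ((l + 1 : ℕ) : WithTop ℕ∞) f (Metric.closedBall x₀ (3 ^ (n + d + 2) * r)))
    (hnd : ∀ x ∈ Metric.closedBall x₀ (3 ^ (n + d + 2) * r),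
      SkewGood.NondegenerateAt l f (Metric.closedBall x₀ (3 ^ (n + d + 2) * r)) x)
    (s₀ : ℝ) (hs₀ : s₀ = SkewGood.nondegMeasure l f (Metric.ball x₀ (3 ^ (n + d + 2) * r)))
    (M : ℝ) (hM : 1 ≤ M)
    (hfM : ∀ k : ℕ, 1 ≤ k → k ≤ l + 1 → ∀ u : Fin k → SkewGood.E d, (∀ i, ‖u i‖ = 1) →
      ∀ x ∈ Metric.ball x₀ (3 ^ (n + d + 2) * r), ‖iteratedFDeriv ℝ k f x u‖ ≤ M)
    (hrad : r ≤ SkewGood.radiusBound d n l s₀ M) :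
    (∀ (u₁ u₂ : SkewGood.E n) (u₀ : ℝ), inner ℝ u₁ u₂ = 0 →
      SkewGood.IsGood (2 * SkewGood.goodConst d l) (1 / ((d : ℝ) * (2 * (l : ℝ) - 1)))
        (Metric.ball x₀ (3 ^ (n + 1) * r))
        (fun x => ‖SkewGood.skewGradient (SkewGood.pairMap f u₁ u₂ u₀) x‖)) ∧
    (∀ (u₁ u₂ : SkewGood.E n) (u₀ : ℝ), inner ℝ u₁ u₂ = 0 → ‖u₁‖ = 1 → ‖u₂‖ = 1 →
      SkewGood.rhoTwo l s₀ M r ≤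
        sSup ((fun x => ‖SkewGood.skewGradient (SkewGood.pairMap f u₁ u₂ u₀) x‖) ''
          Metric.ball x₀ r)) := by
  have h := SkewGood.smallBall_of_le_radiusBound hd hn hl hr hf hs₀ hM hfM hrad
  simp only [SkewGood.norm_skewGradient_pairMap]
  refine ⟨fun u₁ u₂ u₀ _ => h.isGood u₁ u₂ 0 u₀, fun u₁ u₂ u₀ hu hu₁ hu₂ => ?_⟩
  exact h.rhoTwo_le hu hu₁ hu₂ 0 u₀ fun z hz =>
    le_csSup (h.bddAbove_image u₁ u₂ 0 u₀) ⟨z, hz, rfl⟩
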